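/- Let $d\ge 1$, let $f:\mathbb Z^d\to\mathbb R$ be bounded, and let $A=-\Delta+f$ be the discrete Schrödinger operator on $\ell^2(\mathbb Z^d)$, $$[Au]_n=-\sum_{|m-n|=1}u_m+2d\,u_n+f(n)u_n ,$$ where $|\cdot|$ is the Euclidean norm. Assume that the spectrum $\sigma(A)$ has a bounded gap $\Lambda=(\lambda_-,\lambda_+)$, that is, $\lambda_-<\lambda_+$, $\lambda_\pm\in\sigma(A)$ and $\Lambda\cap\sigma(A)=\emptyset$. For a bounded set $\Omega\subset\mathbb R^d$ let $A_\Omega$ be the operator on $\ell^2(\Omega\cap\mathbb Z^d)$ given by $[A_\Omega u]_n=-\sum_{|m-n|=1,\ m\in\Omega\cap\mathbb Z^d}u_m+2d\,u_n+f(n)u_n$, and let $N(A_\Omega,\mu)$ be the number of its eigenvalues, counted with multiplicity, that are strictly smaller than $\mu$. Assume that the density of states exists: there is a function $\rho:\mathbb R\to\mathbb R$ such that for every bounded domain (nonempty connected open set) $\Omega\subset\mathbb R^d$ whose boundary has Lebesgue measure zero and for every $\mu\in\mathbb R$, $$\lim_{\beta\to\infty}\frac{N(A_{\beta\Omega},\mu)}{\beta^d\,\mathrm{vol}\,\Omega}=\rho(\mu).$$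 Let $p>0$, let $\Psi$ be a continuous real function on the unit sphere of $\mathbb R^d$, and let $V:\mathbb Z^d\to[0,\infty)$ satisfy $V(n)\sim\Psi(\theta)|n|^{-p}$ as $|n|\to\infty$, with $\theta=n/|n|$, in the sense that $|n|^pV(n)-\Psi(n/|n|)\to0$. For $\lambda\in\Lambda$ and $\alpha>0$ let $$N(\lambda,\alpha)=\sum_{0<t<\alpha}\dim\ker(A-tV-\lambda)$$ be the number of eigenvalues of $A(t)=A-tV$, counted with multiplicity, that pass through $\lambda$ as $t$ increases from $0$ to $\alpha$. Then for every $\lambda\in\Lambda$ the number $N(\lambda,\alpha)$ is finite for all $\alpha>0$, the function $x\mapsto\rho(\lambda+\Psi(\theta)|x|^{-p})-\rho(\lambda)$, $\theta=x/|x|$, is integrable on $\mathbb R^d$, and $$\lim_{\alpha\to\infty}\alpha^{-d/p}N(\lambda,\alpha)=\int_{\mathbb R^d}\bigl(\rho(\lambda+\Psi(\theta)|x|^{-p})-\rho(\lambda)\bigr)\,dx .$$ In particular, if the integral is nonzero, then $$N(\lambda,\alpha)\sim\alpha^{d/p}\int_{\mathbb R^d}\bigl(\rho(\lambda+\Psi(\theta)|x|^{-p})-\rho(\lambda)\bigr)\,dx\qquad\text{as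 }\alpha\to\infty .$$ -/

import Mathlib

open Filter Topology MeasureTheory
open scoped ENNReal lp

noncomputable section

/-- The lattice `ℤ^d`. -/
abbrev Zd (d : ℕ) : Type := Fin d → ℤ

/-- The Hilbert space `ℓ²(ℤ^d)` of square-summable complex-valued functions. -/
abbrev L2 (d : ℕ) : Type := ℓ²(Zd d, ℂ)

/-- A lattice point regarded as a point of Euclidean space; `‖pt n‖` is the Euclidean length `|n|`. -/
def pt {d : ℕ} (n : Zd d) : EuclideanSpace ℝ (Fin d) :=
  WithLp.toLp 2 fun i => (n i : ℝ)

/-- A bounded region of `ℝ^d` contains finitely many lattice points. -/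
theorem finite_lattice_of_isBounded {d : ℕ} {Ω : Set (EuclideanSpace ℝ (Fin d))}
    (hΩ : Bornology.IsBounded Ω) : {n : Zd d | pt n ∈ Ω}.Finite := by
  obtain ⟨R, hR⟩ := hΩ.exists_norm_le
  refine (Set.finite_Icc (fun _ : Fin d => -⌈R⌉) (fun _ => ⌈R⌉)).subset ?_
  intro n hn
  have h (i : Fin d) : |(n i : ℝ)| ≤ (⌈R⌉ : ℝ) := by
    have h1 := PiLp.norm_apply_le (pt n) i
    have h2 := hR _ hn
    simp only [pt, Real.norm_eq_abs] at h1 h2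
    exact (h1.trans h2).trans (Int.le_ceil R)
  refine ⟨fun i => ?_, fun i => ?_⟩
  · exact_mod_cast (abs_le.1 (h i)).1
  · exact_mod_cast (abs_le.1 (h i)).2

/-- The finite set `Ω ∩ ℤ^d` for a bounded region `Ω`. -/
def latticePoints {d : ℕ} (Ω : Set (EuclideanSpace ℝ (Fin d))) (hΩ : Bornology.IsBounded Ω) :
    Finset (Zd d) :=
  (finite_lattice_of_isBounded hΩ).toFinset

/-- The lattice vectors of Euclidean length one. -/
def unitVectors (d : ℕ) : Finset (Zd d) :=
  latticePoints (Metric.sphere 0 1) Metric.isBounded_sphere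

theorem mem_unitVectors {d : ℕ} (v : Zd d) : v ∈ unitVectors d ↔ ‖pt v‖ = 1 := by
  simp [unitVectors, latticePoints]

/-- Translation on `ℓ²(ℤ^d)`: `(T_v u)(n) = u(n + v)`. -/
def translation {d : ℕ} (v : Zd d) : L2 d →L[ℂ] L2 d :=
  LinearMap.mkContinuous
    { toFun := fun u => ⟨fun n => u (n + v), by
        have h := (lp.memℓp u).summable (by norm_num)
        exact memℓp_gen (h.comp_injective (add_left_injective v))⟩
      map_add' := fun _ _ => rfl
      map_smul' := fun _ _ => rfl }
    1
    (fun u => by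
      rw [one_mul]
      refine lp.norm_le_of_tsum_le (by norm_num) (norm_nonneg u) ?_
      rw [lp.norm_rpow_eq_tsum (by norm_num) u]
      exact ((Equiv.addRight v).tsum_eq fun n => ‖u n‖ ^ (2 : ℝ≥0∞).toReal).le)

@[simp] theorem translation_apply {d : ℕ} (v : Zd d) (u : L2 d) (n : Zd d) :
    translation v u n = u (n + v) := rfl

/-- A bounded real function on the lattice. -/
def IsBoundedFun {d : ℕ} (g : Zd d → ℝ) : Prop := ∃ C : ℝ, ∀ n, |g n| ≤ C

/-- The operator of multiplication by a bounded real function: `(M_g u)(n) = g(n) u(n)`. -/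
def mulOp {d : ℕ} (g : Zd d → ℝ) (hg : IsBoundedFun g) : L2 d →L[ℂ] L2 d :=
  LinearMap.mkContinuousOfExistsBound
    { toFun := fun u => ⟨fun n => (g n : ℂ) * u n, by
        obtain ⟨C, hC⟩ := hg
        refine ((lp.memℓp u).norm.const_mul C).mono fun n => ?_
        rw [norm_mul, Complex.norm_real, Real.norm_eq_abs]
        exact mul_le_mul_of_nonneg_right (hC n) (norm_nonneg _)⟩
      map_add' := fun u v => by ext n; exact mul_add (g n : ℂ) (u n) (v n)
      map_smul' := fun c u => by ext n; exact mul_left_comm (g n : ℂ) c (u n) }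
    (by
      obtain ⟨C, hC⟩ := hg
      have hC0 : 0 ≤ C := (abs_nonneg _).trans (hC 0)
      refine ⟨C, fun u => ?_⟩
      have hn : ‖(C : ℂ) • u‖ = C * ‖u‖ := by
        rw [norm_smul, Complex.norm_real, Real.norm_of_nonneg hC0]
      rw [← hn]
      refine lp.norm_mono (by norm_num) fun n => ?_
      change ‖(g n : ℂ) * u n‖ ≤ ‖(C : ℂ) * u n‖
      rw [norm_mul, norm_mul, Complex.norm_real, Complex.norm_real, Real.norm_eq_abs,
        Real.norm_of_nonneg hC0]
      exact mul_le_mul_of_nonneg_right (hC n) (norm_nonneg _))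

@[simp] theorem mulOp_apply {d : ℕ} (g : Zd d → ℝ) (hg : IsBoundedFun g) (u : L2 d)
    (n : Zd d) : mulOp g hg u n = (g n : ℂ) * u n := rfl

/-- The discrete Schrödinger operator `A = -Δ + f` on `ℓ²(ℤ^d)`. -/
def schrodinger {d : ℕ} (f : Zd d → ℝ) (hf : IsBoundedFun f) : L2 d →L[ℂ] L2 d :=
  -(∑ v ∈ unitVectors d, translation v) + (2 * d : ℂ) • ContinuousLinearMap.id ℂ (L2 d)
    + mulOp f hf

/-- The defining formula
`(A u)(n) = - ∑_{|m - n| = 1} u(m) + 2 d u(n) + f(n) u(n)`, with `m = n + v`, `|v| = 1`. -/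
theorem schrodinger_apply {d : ℕ} (f : Zd d → ℝ) (hf : IsBoundedFun f) (u : L2 d)
    (n : Zd d) :
    schrodinger f hf u n
      = -(∑ v ∈ unitVectors d, u (n + v)) + (2 * d : ℂ) * u n + (f n : ℂ) * u n := by
  have h : ((∑ v ∈ unitVectors d, translation v u : L2 d) : Zd d → ℂ) n
      = ∑ v ∈ unitVectors d, u (n + v) := by
    rw [lp.coeFn_sum, Finset.sum_apply]
    rfl
  rw [← h, ← sum_apply (unitVectors d)]
  rfl

/-- `(a, b)` is a bounded gap in the spectrum of `A`. -/
structure IsSpectralGap {d : ℕ} (A : L2 d →L[ℂ] L2 d) (a b : ℝ) : Prop where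
  lt : a < b
  left_mem : (a : ℂ) ∈ spectrum ℂ A
  right_mem : (b : ℂ) ∈ spectrum ℂ A
  disjoint : ∀ μ : ℝ, a < μ → μ < b → (μ : ℂ) ∉ spectrum ℂ A

open Classical in
/-- The operator `A_Ω` on `ℓ²(Ω ∩ ℤ^d)`, as a matrix, where `S = Ω ∩ ℤ^d` is finite:
`(A_Ω u)(n) = - ∑_{m ∈ S, |m - n| = 1} u(m) + 2 d u(n) + f(n) u(n)` for `n ∈ S`. -/
def restrictedMatrix {d : ℕ} (f : Zd d → ℝ) (S : Finset (Zd d)) : Matrix S S ℂ :=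
  Matrix.of fun n m =>
    (if ‖pt (m.1 - n.1)‖ = 1 then -1 else 0) + (if m = n then 2 * (d : ℂ) + (f n.1 : ℂ) else 0)

theorem restrictedMatrix_isHermitian {d : ℕ} (f : Zd d → ℝ) (S : Finset (Zd d)) :
    (restrictedMatrix f S).IsHermitian := by
  ext n m
  have h : ‖pt (n.1 - m.1)‖ = ‖pt (m.1 - n.1)‖ := by
    rw [← norm_neg]
    congr 1
    ext i
    simp [pt]
  rw [Matrix.conjTranspose_apply]
  simp only [restrictedMatrix, Matrix.of_apply, h]
  by_cases hnm : n = m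
  · subst hnm
    split_ifs <;> simp
  · rw [if_neg hnm, if_neg (Ne.symm hnm)]
    split_ifs <;> simp

open Classical in
/-- `N(A_Ω, E)`: the number of eigenvalues of `A_Ω`, counted with multiplicity, that are strictly
smaller than `E`. -/
def eigenvalueCount {d : ℕ} (f : Zd d → ℝ) (Ω : Set (EuclideanSpace ℝ (Fin d)))
    (hΩ : Bornology.IsBounded Ω) (E : ℝ) : ℕ :=
  (Finset.univ.filter fun i =>
    (restrictedMatrix_isHermitian f (latticePoints Ω hΩ)).eigenvalues i < E).card

open scoped Pointwise in
/-- `ρ` is the density of states of `-Δ + f`: for every bounded domain `Ω` (nonempty, open,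
connected) whose boundary is Lebesgue null and every real `E`,
`N(A_{βΩ}, E) / (β^d vol Ω) → ρ(E)` as `β → ∞`. -/
def HasDensityOfStates {d : ℕ} (f : Zd d → ℝ) (ρ : ℝ → ℝ) : Prop :=
  ∀ (Ω : Set (EuclideanSpace ℝ (Fin d))) (hΩ : Bornology.IsBounded Ω),
    IsOpen Ω → IsConnected Ω → volume (frontier Ω) = 0 → ∀ E : ℝ,
      Tendsto (fun β : ℝ => (eigenvalueCount f (β • Ω) (hΩ.smul₀ β) E : ℝ)
        / (β ^ d * (volume Ω).toReal)) atTop (𝓝 (ρ E))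

/-- `V(n) ~ Ψ(θ) |n|^{-p}` as `|n| → ∞`, where `θ = n / |n|`; that is, `|n|^p V(n) - Ψ(θ) → 0`.
(Infinity in the lattice is the cofinite filter, as balls contain finitely many points.) -/
def HasDecay {d : ℕ} (V : Zd d → ℝ) (Ψ : EuclideanSpace ℝ (Fin d) → ℝ) (p : ℝ) : Prop :=
  Tendsto (fun n : Zd d => ‖pt n‖ ^ p * V n - Ψ (‖pt n‖⁻¹ • pt n)) cofinite (𝓝 0)

theorem one_le_norm_pt {d : ℕ} {n : Zd d} (hn : n ≠ 0) : 1 ≤ ‖pt n‖ := by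
  obtain ⟨i, hi⟩ := Function.ne_iff.1 hn
  have h1 := PiLp.norm_apply_le (pt n) i
  simp only [pt, Real.norm_eq_abs] at h1
  refine le_trans ?_ h1
  exact_mod_cast Int.one_le_abs hi

/-- A decaying potential is bounded. -/
theorem HasDecay.isBoundedFun {d : ℕ} {V : Zd d → ℝ} {Ψ : EuclideanSpace ℝ (Fin d) → ℝ}
    {p : ℝ} (hV : HasDecay V Ψ p) (hp : 0 < p) (hΨ : ContinuousOn Ψ (Metric.sphere 0 1)) :
    IsBoundedFun V := by
  obtain ⟨C, hC⟩ := (isCompact_sphere (0 : EuclideanSpace ℝ (Fin d)) 1).exists_bound_of_continuousOn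
    hΨ
  have h1 : ∀ᶠ n in cofinite, |V n| ≤ |C| + 1 := by
    filter_upwards [hV (Metric.ball_mem_nhds 0 one_pos),
      (Set.finite_singleton (0 : Zd d)).compl_mem_cofinite] with n hn hn0
    have hr := one_le_norm_pt (n := n) hn0
    have hθ : ‖pt n‖⁻¹ • pt n ∈ Metric.sphere (0 : EuclideanSpace ℝ (Fin d)) 1 := by
      rw [mem_sphere_zero_iff_norm, norm_smul, norm_inv, norm_norm]
      exact inv_mul_cancel₀ (by positivity)
    have h2 := hC _ hθ
    rw [Set.mem_preimage, mem_ball_zero_iff] at hn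
    rw [Real.norm_eq_abs] at h2 hn
    have h3 : |‖pt n‖ ^ p * V n| ≤ |C| + 1 := by
      have h4 := abs_add_le (‖pt n‖ ^ p * V n - Ψ (‖pt n‖⁻¹ • pt n)) (Ψ (‖pt n‖⁻¹ • pt n))
      rw [sub_add_cancel] at h4
      linarith [le_abs_self C]
    rw [abs_mul, abs_of_nonneg (by positivity : (0 : ℝ) ≤ ‖pt n‖ ^ p)] at h3
    exact le_trans (le_mul_of_one_le_left (abs_nonneg _) (Real.one_le_rpow hr hp.le)) h3
  have hfin : {n | ¬ |V n| ≤ |C| + 1}.Finite := h1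
  have hsum : 0 ≤ ∑ n ∈ hfin.toFinset, |V n| := Finset.sum_nonneg fun _ _ => abs_nonneg _
  refine ⟨|C| + 1 + ∑ n ∈ hfin.toFinset, |V n|, fun n => ?_⟩
  by_cases hn : |V n| ≤ |C| + 1
  · linarith
  · have hmem : n ∈ hfin.toFinset := by simpa using hn
    have h5 := Finset.single_le_sum (f := fun n => |V n|) (fun _ _ => abs_nonneg _) hmem
    linarith [abs_nonneg C]

/-- The number of eigenvalues of `A(t) = A - t V`, counted with multiplicity, that pass through
the point `E` as `t` increases from `0` to `α`. An eigenvalue passes through `E` at the coupling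
constant `t` when `E` is an eigenvalue of `A(t)`, and the number of those that do so at `t` is the
multiplicity of `E` as an eigenvalue of `A(t)`; the count is the sum of these multiplicities over
`0 < t < α`. (For `V ≥ 0` and `E` outside the spectrum of `A`, the eigenvalues near `E` only move
to the left, and none of them stays at `E`, so each contributes exactly one passage.) -/
def crossingNumber {d : ℕ} (A V : L2 d →L[ℂ] L2 d) (E α : ℝ) : ℝ≥0∞ :=
  ∑' t : Set.Ioo (0 : ℝ) α,
    ((Cardinal.toENat (Module.rank ℂ
      (Module.End.eigenspace ((A - ((t : ℝ) : ℂ) • V : L2 d →L[ℂ] L2 d) : Module.End ℂ (L2 d))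
        (E : ℂ))) : ℕ∞) : ℝ≥0∞)

/-- The integrand `ρ(E + Ψ(θ) |x|^{-p}) - ρ(E)`, where `θ = x / |x|`. -/
def dosIncrement {d : ℕ} (ρ : ℝ → ℝ) (Ψ : EuclideanSpace ℝ (Fin d) → ℝ) (p E : ℝ)
    (x : EuclideanSpace ℝ (Fin d)) : ℝ :=
  ρ (E + Ψ (‖x‖⁻¹ • x) * ‖x‖ ^ (-p)) - ρ E

end

/-!
Put `B = A - E`, which is invertible. Since `V ≥ 0`, the eigenvalues of `A - tV` crossing `E` for
`0 < t < α` correspond, with multiplicity, to the eigenvalues of the compact self-adjoint operator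
`√V B⁻¹ √V` above `1 / α` (Birman–Schwinger), so that they count the negative directions of the
Schur complement `1 - α √V B⁻¹ √V`. As `αV` is small outside a cube of side `~ α^{1/p}`, these
directions can be tested on functions supported in that cube, and inertia additivity for Schur
complements turns the count into `N(A_S - αV, E) - N(A_S, E)`, `S` being the cube's lattice points,
up to an error of the order of the number of points near the boundary of `S`.

With `α = β^p`, the potential `αV` at the lattice point `n` is close to `Ψ(θ) |x|^{-p}`, `x = n/β`.
On a small cube around `x` it is almost constant, so the finite section there has about
`β^d vol · ρ(E + Ψ(θ) |x|^{-p})` eigenvalues below `E`; summing over the small cubes gives the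
integral. The same boundary estimate with a constant potential shows that `ρ` is constant near `E`,
which makes the integrand compactly supported.
-/

noncomputable section

section SignOfForms

open Module (finrank)

variable {K V V' : Type*} [DivisionRing K] [AddCommGroup V] [Module K V] [AddCommGroup V']
  [Module K V']

theorem finrank_submodule_prod (L : Submodule K V) (M : Submodule K V') [FiniteDimensional K L]
    [FiniteDimensional K M] : finrank K (L.prod M) = finrank K L + finrank K M := by
  have hinj : Function.Injective (L.subtype.prodMap M.subtype) :=
    L.injective_subtype.prodMap M.injective_subtype
  rw [← Module.finrank_prod, ← LinearMap.finrank_range_of_inj hinj, LinearMap.range_prodMap,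
    L.range_subtype, M.range_subtype]

instance finiteDimensional_submodule_prod (L : Submodule K V) (M : Submodule K V')
    [FiniteDimensional K L] [FiniteDimensional K M] : FiniteDimensional K (L.prod M) :=
  Module.Finite.iff_fg.2 ((Module.Finite.iff_fg.1 ‹_›).prod (Module.Finite.iff_fg.1 ‹_›))

theorem finrank_add_finrank_le_inf_comap (φ : V →ₗ[K] V') (Y : Submodule K V)
    {X Z : Submodule K V'} [FiniteDimensional K Y] [FiniteDimensional K X] (hY : Y ≤ X.comap φ)
    (hZ : Z ≤ X) :
    finrank K Y + finrank K Z ≤ finrank K (Y ⊓ Z.comap φ : Submodule K V) + finrank K X := by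
  let Z' : Submodule K X := Z.comap X.subtype
  let χ : Y →ₗ[K] X ⧸ Z' := Z'.mkQ ∘ₗ φ.restrict hY
  have hker : LinearMap.ker χ = (Y ⊓ Z.comap φ).comap Y.subtype := by
    ext y
    simp [χ, Z']
  have hkerfin : finrank K (LinearMap.ker χ) = finrank K (Y ⊓ Z.comap φ : Submodule K V) := by
    rw [hker]
    exact (Submodule.comapSubtypeEquivOfLe inf_le_left).finrank_eq
  have hZ' : finrank K Z' = finrank K Z := (Submodule.comapSubtypeEquivOfLe hZ).finrank_eq
  have hrange : finrank K (LinearMap.range χ) ≤ finrank K (X ⧸ Z') := Submodule.finrank_le _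
  have hrank := χ.finrank_range_add_finrank_ker
  have hquot := Z'.finrank_quotient_add_finrank
  omega

/-- The function `Q`, in practice the quadratic form of a symmetric operator, is negative definite
on the subspace `L`. -/
def NegDefOn (Q : V → ℝ) (L : Submodule K V) : Prop := ∀ u ∈ L, u ≠ 0 → Q u < 0

/-- The function `Q`, in practice the quadratic form of a symmetric operator, is nonnegative on the
subspace `P`. -/
def NonnegOn (Q : V → ℝ) (P : Submodule K V) : Prop := ∀ u ∈ P, 0 ≤ Q u

variable {Q : V → ℝ} {Q' : V' → ℝ} {L P X : Submodule K V} {L' P' : Submodule K V'}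

theorem NegDefOn.disjoint (hL : NegDefOn Q L) (hP : NonnegOn Q P) : Disjoint L P :=
  Submodule.disjoint_def.2 fun u hu hu' => by
    by_contra h0
    exact (hL u hu h0).not_ge (hP u hu')

theorem NegDefOn.finrank_add_finrank_le [FiniteDimensional K X] (hL : NegDefOn Q L)
    (hP : NonnegOn Q P) (hLX : L ≤ X) (hPX : P ≤ X) :
    finrank K L + finrank K P ≤ finrank K X := by
  have := Submodule.finiteDimensional_of_le hLX
  have := Submodule.finiteDimensional_of_le hPX
  have h := Submodule.finrank_sup_add_finrank_inf_eq L P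
  rw [(hL.disjoint hP).eq_bot, finrank_bot, add_zero] at h
  exact h ▸ Submodule.finrank_mono (sup_le hLX hPX)

theorem NegDefOn.prod (hL : NegDefOn Q L) (hL' : NegDefOn Q' L') (hQ : Q 0 = 0) (hQ' : Q' 0 = 0) :
    NegDefOn (fun x : V × V' => Q x.1 + Q' x.2) (L.prod L') := by
  have nonpos {W : Type _} [AddCommGroup W] [Module K W] {q : W → ℝ} {M : Submodule K W}
      (hM : NegDefOn q M) (hq : q 0 = 0) : ∀ u ∈ M, q u ≤ 0 := fun u hu => by
    rcases eq_or_ne u 0 with rfl | h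
    exacts [hq.le, (hM u hu h).le]
  rintro ⟨u, w⟩ ⟨hu, hw⟩ h
  rcases eq_or_ne u 0 with rfl | hu0
  · exact add_neg_of_nonpos_of_neg hQ.le (hL' w hw fun hw0 => h (by rw [hw0]; rfl))
  · exact add_neg_of_neg_of_nonpos (hL u hu hu0) (nonpos hL' hQ' w hw)

theorem NonnegOn.prod (hP : NonnegOn Q P) (hP' : NonnegOn Q' P') :
    NonnegOn (fun x : V × V' => Q x.1 + Q' x.2) (P.prod P') :=
  fun x hx => add_nonneg (hP x.1 hx.1) (hP' x.2 hx.2)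

theorem NegDefOn.map {φ : V →ₗ[K] V'} (hL : NegDefOn (Q' ∘ φ) L) : NegDefOn Q' (L.map φ) := by
  rintro _ ⟨u, hu, rfl⟩ h
  exact hL u hu fun h0 => h (by rw [h0, map_zero])

theorem NegDefOn.finrank_map {φ : V →ₗ[K] V'} (hL : NegDefOn (Q' ∘ φ) L) (hQ' : Q' 0 = 0) :
    finrank K (L.map φ) = finrank K L := by
  have hker : LinearMap.ker (φ.domRestrict L) = ⊥ := by
    rw [LinearMap.ker_eq_bot']
    rintro ⟨u, hu⟩ h
    by_contra h0
    refine (hL u hu fun h' => h0 (Subtype.ext h')).ne ?_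
    rw [Function.comp_apply, show φ u = 0 from h, hQ']
  rw [← LinearMap.finrank_range_of_inj (LinearMap.ker_eq_bot.1 hker), LinearMap.range_domRestrict]

theorem NonnegOn.map {φ : V →ₗ[K] V'} (hP : NonnegOn (Q' ∘ φ) P) : NonnegOn Q' (P.map φ) := by
  rintro _ ⟨u, hu, rfl⟩
  exact hP u hu

end SignOfForms

section SchurComplement

open Module (finrank)
open RCLike (re)

variable {𝕜 H : Type*} [RCLike 𝕜] [NormedAddCommGroup H] [InnerProductSpace 𝕜 H]

open scoped InnerProductSpace

theorem NegDefOn.finiteDimensional {Q : H → ℝ} {L X : Submodule 𝕜 H} [FiniteDimensional 𝕜 X]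
    (hL : NegDefOn Q L) (hX : NonnegOn Q Xᗮ) : FiniteDimensional 𝕜 L := by
  refine FiniteDimensional.of_injective
    (X.orthogonalProjectionOnto.toLinearMap ∘ₗ L.subtype) ?_
  rw [injective_iff_map_eq_zero]
  intro w hw
  have hwX : (w : H) ∈ Xᗮ := Submodule.orthogonalProjectionOnto_eq_zero_iff.1 hw
  exact Subtype.ext ((Submodule.disjoint_def.1 (hL.disjoint hX)) w w.2 hwX)

theorem finrank_le_inf_orthogonal (Y L : Submodule 𝕜 H) [FiniteDimensional 𝕜 Y]
    [FiniteDimensional 𝕜 L] : finrank 𝕜 Y ≤ finrank 𝕜 (Y ⊓ Lᗮ : Submodule 𝕜 H) + finrank 𝕜 L := by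
  have h := finrank_add_finrank_le_inf_comap (L.starProjection : H →ₗ[𝕜] H) Y (X := L) (Z := ⊥)
    (fun y _ => L.starProjection_apply_mem y) bot_le
  have hker : (⊥ : Submodule 𝕜 H).comap (L.starProjection : H →ₗ[𝕜] H) = Lᗮ := by
    ext x
    simp
  rwa [hker, finrank_bot, add_zero] at h

theorem isSymmetric_symm {B : H ≃L[𝕜] H} (hB : (B : H →ₗ[𝕜] H).IsSymmetric) :
    (B.symm : H →ₗ[𝕜] H).IsSymmetric := fun x y => by
  simpa using (hB (B.symm x) (B.symm y)).symm

/-- The form of the operator matrix with rows `(B, s)` and `(s, 1)` on `H × H`. Its two Schur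
complements are `B - s²` and `1 - s B⁻¹ s`. -/
def blockForm (B : H ≃L[𝕜] H) (s : H →L[𝕜] H) (x : H × H) : ℝ :=
  re ⟪B x.1, x.1⟫_𝕜 + 2 * re ⟪s x.2, x.1⟫_𝕜 + ‖x.2‖ ^ 2

/-- The form of `1 - s B⁻¹ s`, the Schur complement of the entry `B` in `blockForm B s`. -/
def schurForm (B : H ≃L[𝕜] H) (s : H →L[𝕜] H) (w : H) : ℝ :=
  ‖w‖ ^ 2 - re ⟪B.symm (s w), s w⟫_𝕜

@[simp] theorem schurForm_zero (B : H ≃L[𝕜] H) (s : H →L[𝕜] H) : schurForm B s 0 = 0 := by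
  simp [schurForm]

variable {B : H ≃L[𝕜] H} {s : H →L[𝕜] H} {X W : Submodule 𝕜 H}

theorem blockForm_lowerShear (hs : (s : H →ₗ[𝕜] H).IsSymmetric) (u z : H) :
    blockForm B s (u, z - s u) = re ⟪B u, u⟫_𝕜 - ‖s u‖ ^ 2 + ‖z‖ ^ 2 := by
  have hsq : re ⟪s (s u), u⟫_𝕜 = ‖s u‖ ^ 2 := by
    rw [show ⟪s (s u), u⟫_𝕜 = ⟪s u, s u⟫_𝕜 from hs _ _, inner_self_eq_norm_sq]
  have hmix : re ⟪s z, u⟫_𝕜 = re ⟪z, s u⟫_𝕜 := congrArg re (hs z u)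
  simp only [blockForm]
  rw [map_sub, inner_sub_left, map_sub, hsq, hmix, norm_sub_sq (𝕜 := 𝕜)]
  ring

theorem blockForm_upperShear (hB : (B : H →ₗ[𝕜] H).IsSymmetric) (y w : H) :
    blockForm B s (y - B.symm (s w), w) = re ⟪B y, y⟫_𝕜 + schurForm B s w := by
  have hmix : re ⟪B y, B.symm (s w)⟫_𝕜 = re ⟪s w, y⟫_𝕜 := by
    rw [show ⟪B y, B.symm (s w)⟫_𝕜 = ⟪y, B (B.symm (s w))⟫_𝕜 from hB _ _, B.apply_symm_apply,
      inner_re_symm]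
  simp only [blockForm, schurForm, map_sub, inner_sub_left, inner_sub_right,
    B.apply_symm_apply, hmix, inner_re_symm (𝕜 := 𝕜) (B.symm (s w))]
  ring

theorem schurForm_add_of_inner_eq_zero (hB : (B : H →ₗ[𝕜] H).IsSymmetric) {w z : H}
    (hwz : ⟪w, z⟫_𝕜 = 0) (h : ⟪B.symm (s w), s z⟫_𝕜 = 0) :
    schurForm B s (w + z) = schurForm B s w + schurForm B s z := by
  have h' : ⟪B.symm (s z), s w⟫_𝕜 = 0 := by
    rw [show ⟪B.symm (s z), s w⟫_𝕜 = ⟪s z, B.symm (s w)⟫_𝕜 from isSymmetric_symm hB _ _,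
      inner_eq_zero_symm, h]
  simp only [schurForm, map_add, inner_add_left, inner_add_right, h, h', map_zero,
    norm_add_sq (𝕜 := 𝕜) w z, hwz]
  ring

theorem map_equiv_le (hBW : ∀ u ∈ W, B u ∈ X) : W.map (B : H →ₗ[𝕜] H) ≤ X := by
  rintro _ ⟨u, hu, rfl⟩
  exact hBW u hu

theorem symm_apply_mem {z : H} (hz : z ∈ W.map (B : H →ₗ[𝕜] H)) : B.symm z ∈ W := by
  obtain ⟨u, hu, rfl⟩ := hz
  simpa using hu

theorem exists_negDefOn_schurForm_le [FiniteDimensional 𝕜 X]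
    (hB : (B : H →ₗ[𝕜] H).IsSymmetric) (hs : (s : H →ₗ[𝕜] H).IsSymmetric) (hW : W ≤ X)
    (hBW : ∀ u ∈ W, B u ∈ X) (hsX : ∀ u ∈ X, s u ∈ X) (hX : NonnegOn (schurForm B s) Xᗮ)
    {M : Submodule 𝕜 H} [FiniteDimensional 𝕜 M] (hM : NegDefOn (schurForm B s) M) :
    ∃ Y ≤ X, NegDefOn (schurForm B s) Y ∧ (∀ w ∈ Y, B.symm (s w) ∈ X) ∧
      finrank 𝕜 M + finrank 𝕜 W ≤ finrank 𝕜 Y + finrank 𝕜 X := by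
  let P : H →ₗ[𝕜] H := X.starProjection
  have hPX (w : H) : P w ∈ X := X.starProjection_apply_mem w
  let Z : Submodule 𝕜 H := M ⊓ (W.map (B : H →ₗ[𝕜] H)).comap ((s : H →ₗ[𝕜] H) ∘ₗ P)
  have hRZ : ∀ w ∈ Z, B.symm (s (P w)) ∈ X := fun w hw => hW (symm_apply_mem hw.2)
  have hle : ∀ w ∈ Z, schurForm B s (P w) ≤ schurForm B s w := fun w hw => by
    have hz : w - P w ∈ Xᗮ := X.sub_starProjection_mem_orthogonal w
    have hsz : ⟪B.symm (s (P w)), s (w - P w)⟫_𝕜 = 0 := by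
      refine (hs _ _).symm.trans ?_
      exact Submodule.inner_right_of_mem_orthogonal (hsX _ (hRZ w hw)) hz
    have hadd := schurForm_add_of_inner_eq_zero hB
      (Submodule.inner_right_of_mem_orthogonal (hPX w) hz) hsz
    rw [add_sub_cancel] at hadd
    linarith [hX _ hz]
  have hZ : NegDefOn (schurForm B s ∘ P) Z := fun w hw h0 => (hle w hw).trans_lt (hM w hw.1 h0)
  have hdim := finrank_add_finrank_le_inf_comap ((s : H →ₗ[𝕜] H) ∘ₗ P) M
    (fun w _ => hsX _ (hPX w)) (map_equiv_le hBW)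
  rw [B.toLinearEquiv.finrank_map_eq W] at hdim
  refine ⟨Z.map P, ?_, hZ.map, ?_, (hZ.finrank_map (schurForm_zero B s)).symm ▸ hdim⟩
  · rintro _ ⟨w, -, rfl⟩
    exact hPX w
  · rintro _ ⟨w, hw, rfl⟩
    exact hRZ w hw

theorem exists_nonnegOn_schurForm_le [FiniteDimensional 𝕜 X] (hW : W ≤ X)
    (hBW : ∀ u ∈ W, B u ∈ X) (hsX : ∀ u ∈ X, s u ∈ X) {M : Submodule 𝕜 H}
    [FiniteDimensional 𝕜 M] (hM : NonnegOn (schurForm B s) Mᗮ) :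
    ∃ Y ≤ X, NonnegOn (schurForm B s) Y ∧ (∀ w ∈ Y, B.symm (s w) ∈ X) ∧
      finrank 𝕜 W ≤ finrank 𝕜 Y + finrank 𝕜 M := by
  have hfin : FiniteDimensional 𝕜 (X ⊓ Mᗮ : Submodule 𝕜 H) :=
    Submodule.finiteDimensional_of_le inf_le_left
  have horth := finrank_le_inf_orthogonal X M
  have hdim := finrank_add_finrank_le_inf_comap (s : H →ₗ[𝕜] H) (X ⊓ Mᗮ)
    (fun w hw => hsX w hw.1) (map_equiv_le hBW)
  rw [B.toLinearEquiv.finrank_map_eq W] at hdim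
  refine ⟨X ⊓ Mᗮ ⊓ (W.map (B : H →ₗ[𝕜] H)).comap (s : H →ₗ[𝕜] H), fun w hw => hw.1.1,
    fun w hw => hM w hw.1.2, fun w hw => hW (symm_apply_mem hw.2), by omega⟩

/-- The shear `(u, z) ↦ (u, z - s u)`, which splits off `B - s²` from `blockForm B s`. -/
def lowerShear (s : H →L[𝕜] H) : (H × H) ≃ₗ[𝕜] H × H :=
  (LinearEquiv.refl 𝕜 H).skewProd (LinearEquiv.refl 𝕜 H) (-(s : H →ₗ[𝕜] H))

/-- The shear `(y, w) ↦ (y - B⁻¹ s w, w)`, which splits off `1 - s B⁻¹ s` from `blockForm B s`. -/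
def upperShear (B : H ≃L[𝕜] H) (s : H →L[𝕜] H) : (H × H) ≃ₗ[𝕜] H × H :=
  (LinearEquiv.prodComm 𝕜 H H).trans (lowerShear (B.symm ∘L s)) |>.trans
    (LinearEquiv.prodComm 𝕜 H H)

theorem lowerShear_apply (s : H →L[𝕜] H) (x : H × H) : lowerShear s x = (x.1, x.2 - s x.1) := by
  simp [lowerShear, sub_eq_add_neg]

theorem upperShear_apply (B : H ≃L[𝕜] H) (s : H →L[𝕜] H) (x : H × H) :
    upperShear B s x = (x.1 - B.symm (s x.2), x.2) := by
  simp [upperShear, lowerShear_apply]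

theorem NegDefOn.finrank_add_finrank_schurForm_le [FiniteDimensional 𝕜 X]
    (hB : (B : H →ₗ[𝕜] H).IsSymmetric) (hs : (s : H →ₗ[𝕜] H).IsSymmetric) (hW : W ≤ X)
    (hBW : ∀ u ∈ W, B u ∈ X) (hsX : ∀ u ∈ X, s u ∈ X) (hX : NonnegOn (schurForm B s) Xᗮ)
    {L P M : Submodule 𝕜 H} [FiniteDimensional 𝕜 M] (hL : NegDefOn (fun u => re ⟪B u, u⟫_𝕜) L)
    (hLX : L ≤ X) (hP : NonnegOn (fun u => re ⟪B u, u⟫_𝕜 - ‖s u‖ ^ 2) P) (hPX : P ≤ X)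
    (hM : NegDefOn (schurForm B s) M) :
    finrank 𝕜 L + finrank 𝕜 M + finrank 𝕜 P + finrank 𝕜 W ≤ 2 * finrank 𝕜 X := by
  obtain ⟨Y, hYX, hY, hYB, hdim⟩ := exists_negDefOn_schurForm_le hB hs hW hBW hsX hX hM
  have hneg : NegDefOn (blockForm B s) ((L.prod Y).map (upperShear B s).toLinearMap) := by
    refine NegDefOn.map fun x hx h0 => ?_
    have hLY := hL.prod hY (by simp) (schurForm_zero B s) x hx h0
    simpa [upperShear_apply, blockForm_upperShear hB] using hLY
  have hnonneg : NonnegOn (blockForm B s) ((P.prod X).map (lowerShear s).toLinearMap) := by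
    refine NonnegOn.map fun x hx => ?_
    have hPX' := hP.prod (P' := X) (fun z _ => sq_nonneg ‖z‖) x hx
    simpa [lowerShear_apply, blockForm_lowerShear hs] using hPX'
  have hle := hneg.finrank_add_finrank_le (X := X.prod X) hnonneg
    (by
      rintro _ ⟨x, hx, rfl⟩
      rw [LinearEquiv.coe_coe, upperShear_apply]
      exact ⟨X.sub_mem (hLX hx.1) (hYB _ hx.2), hYX hx.2⟩)
    (by
      rintro _ ⟨x, hx, rfl⟩
      rw [LinearEquiv.coe_coe, lowerShear_apply]
      exact ⟨hPX hx.1, X.sub_mem hx.2 (hsX _ (hPX hx.1))⟩)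
  have := Submodule.finiteDimensional_of_le hLX
  have := Submodule.finiteDimensional_of_le hPX
  have := Submodule.finiteDimensional_of_le hYX
  rw [LinearEquiv.finrank_map_eq, LinearEquiv.finrank_map_eq] at hle
  simp only [finrank_submodule_prod] at hle
  omega

theorem NonnegOn.finrank_add_finrank_le_schurForm [FiniteDimensional 𝕜 X]
    (hB : (B : H →ₗ[𝕜] H).IsSymmetric) (hs : (s : H →ₗ[𝕜] H).IsSymmetric) (hW : W ≤ X)
    (hBW : ∀ u ∈ W, B u ∈ X) (hsX : ∀ u ∈ X, s u ∈ X)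
    {L P M : Submodule 𝕜 H} [FiniteDimensional 𝕜 M] (hP : NonnegOn (fun u => re ⟪B u, u⟫_𝕜) P)
    (hPX : P ≤ X) (hL : NegDefOn (fun u => re ⟪B u, u⟫_𝕜 - ‖s u‖ ^ 2) L) (hLX : L ≤ X)
    (hM : NonnegOn (schurForm B s) Mᗮ) :
    finrank 𝕜 L + finrank 𝕜 P + finrank 𝕜 W ≤ finrank 𝕜 M + 2 * finrank 𝕜 X := by
  obtain ⟨Y, hYX, hY, hYB, hdim⟩ := exists_nonnegOn_schurForm_le hW hBW hsX hM
  have hneg : NegDefOn (blockForm B s)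
      ((L.prod (⊥ : Submodule 𝕜 H)).map (lowerShear s).toLinearMap) := by
    refine NegDefOn.map fun x hx h0 => ?_
    have hL' := hL.prod (L' := ⊥) (Q' := fun z : H => ‖z‖ ^ 2)
      (fun z hz h => absurd hz h) (by simp) (by simp) x hx h0
    simpa [lowerShear_apply, blockForm_lowerShear hs] using hL'
  have hnonneg : NonnegOn (blockForm B s) ((P.prod Y).map (upperShear B s).toLinearMap) := by
    refine NonnegOn.map fun x hx => ?_
    simpa [upperShear_apply, blockForm_upperShear hB] using hP.prod hY x hx
  have hle := hneg.finrank_add_finrank_le (X := X.prod X) hnonneg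
    (by
      rintro _ ⟨x, hx, rfl⟩
      rw [LinearEquiv.coe_coe, lowerShear_apply, (Submodule.mem_bot 𝕜).1 hx.2]
      exact ⟨hLX hx.1, X.sub_mem X.zero_mem (hsX _ (hLX hx.1))⟩)
    (by
      rintro _ ⟨x, hx, rfl⟩
      rw [LinearEquiv.coe_coe, upperShear_apply]
      exact ⟨X.sub_mem (hPX hx.1) (hYB _ hx.2), hYX hx.2⟩)
  have := Submodule.finiteDimensional_of_le hLX
  have := Submodule.finiteDimensional_of_le hPX
  have := Submodule.finiteDimensional_of_le hYX
  rw [LinearEquiv.finrank_map_eq, LinearEquiv.finrank_map_eq] at hle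
  simp only [finrank_submodule_prod, finrank_bot] at hle
  omega

end SchurComplement

section IndependentSubspaces

open Module (finrank)

variable {K V ι : Type*} [DivisionRing K] [AddCommGroup V] [Module K V] {p : ι → Submodule K V}

theorem finrank_finsetSup_eq_sum (hp : iSupIndep p) [∀ i, FiniteDimensional K (p i)]
    (F : Finset ι) : finrank K (F.sup p : Submodule K V) = ∑ i ∈ F, finrank K (p i) := by
  classical
  induction F using Finset.induction_on with
  | empty => simp
  | insert a F ha ih =>
    have := Submodule.finiteDimensional_finset_sup F p
    have hdisj : Disjoint (p a) (F.sup p) :=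
      hp.supIndep' (insert a F) (Finset.subset_insert a F) (Finset.mem_insert_self a F) ha
    have hsup := Submodule.finrank_sup_add_finrank_inf_eq (p a) (F.sup p)
    rw [hdisj.eq_bot, finrank_bot, add_zero, ih] at hsup
    rw [Finset.sup_insert, Finset.sum_insert ha, hsup]

theorem tsum_finrank_eq_finrank_iSup (hp : iSupIndep p)
    [FiniteDimensional K (⨆ i, p i : Submodule K V)] :
    ∑' i, (finrank K (p i) : ℝ≥0∞) = finrank K (⨆ i, p i : Submodule K V) := by
  have (i : ι) : FiniteDimensional K (p i) := Submodule.finiteDimensional_of_le (le_iSup p i)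
  have hle (F : Finset ι) : F.sup p ≤ ⨆ i, p i := Finset.sup_le fun i _ => le_iSup p i
  refine le_antisymm ?_ ?_
  · rw [ENNReal.tsum_eq_iSup_sum]
    refine iSup_le fun F => ?_
    rw [← Nat.cast_sum, ← finrank_finsetSup_eq_sum hp F]
    exact_mod_cast Submodule.finrank_mono (hle F)
  · have hfg : (⨆ i, p i : Submodule K V).FG := (Submodule.fg_iff_finiteDimensional _).2 ‹_›
    obtain ⟨F, hF⟩ := CompleteLattice.IsCompactElement.exists_finset_of_le_iSup _
      ((Submodule.fg_iff_compact _).1 hfg) p le_rfl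
    rw [← Finset.sup_eq_iSup] at hF
    rw [le_antisymm hF (hle F), finrank_finsetSup_eq_sum hp F, Nat.cast_sum]
    exact ENNReal.sum_le_tsum F

theorem tsum_toENat_rank_eq_finrank_iSup (hp : iSupIndep p)
    [FiniteDimensional K (⨆ i, p i : Submodule K V)] :
    ∑' i, ((Cardinal.toENat (Module.rank K (p i)) : ℕ∞) : ℝ≥0∞)
      = finrank K (⨆ i, p i : Submodule K V) := by
  rw [← tsum_finrank_eq_finrank_iSup hp]
  refine tsum_congr fun i => ?_
  have := Submodule.finiteDimensional_of_le (le_iSup p i)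
  rw [← Module.finrank_eq_rank, Cardinal.toENat_nat, ENat.toENNReal_coe]

end IndependentSubspaces

section SpectralSubspaces

open Module.End (eigenspace)
open RCLike (re)

variable {𝕜 H : Type*} [RCLike 𝕜] [NormedAddCommGroup H] [InnerProductSpace 𝕜 H]

open scoped InnerProductSpace

theorem orthogonal_le_topologicalClosure [CompleteSpace H] {U W : Submodule 𝕜 H} (hUW : U ⟂ W)
    (h : (U ⊔ W)ᗮ = ⊥) : Uᗮ ≤ W.topologicalClosure := by
  intro u hu
  let C := W.topologicalClosure
  have : CompleteSpace C := W.isClosed_topologicalClosure.completeSpace_coe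
  have hCU : C ≤ Uᗮ := W.topologicalClosure_minimal hUW.symm.le U.isClosed_orthogonal
  have hmem : u - C.starProjection u ∈ (U ⊔ W)ᗮ := by
    rw [← Submodule.inf_orthogonal]
    exact ⟨Uᗮ.sub_mem hu (hCU (C.starProjection_apply_mem u)),
      Submodule.orthogonal_le W.le_topologicalClosure (C.sub_starProjection_mem_orthogonal u)⟩
  rw [h, Submodule.mem_bot, sub_eq_zero] at hmem
  exact hmem ▸ C.starProjection_apply_mem u

/-- The sum of the eigenspaces of `T` for the real eigenvalues in `s`. For a compact symmetric `T`
and `0 ∉ closure s` this is the range of the spectral projection of `T` on `s`. -/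
def spectralSubspace (T : H →ₗ[𝕜] H) (s : Set ℝ) : Submodule 𝕜 H :=
  ⨆ μ : s, eigenspace T ((μ : ℝ) : 𝕜)

variable {T : H →ₗ[𝕜] H} {s : Set ℝ} {c : ℝ}

theorem eigenspace_le_spectralSubspace (T : H →ₗ[𝕜] H) {μ : ℝ} (hμ : μ ∈ s) :
    eigenspace T (μ : 𝕜) ≤ spectralSubspace T s :=
  le_iSup (fun μ : s => eigenspace T ((μ : ℝ) : 𝕜)) ⟨μ, hμ⟩

theorem ofReal_comp_val_injective (s : Set ℝ) :
    Function.Injective fun μ : s => ((μ : ℝ) : 𝕜) :=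
  RCLike.ofReal_injective.comp Subtype.val_injective

theorem spectralSubspace_isOrtho (hT : T.IsSymmetric) {t : Set ℝ} (hst : Disjoint s t) :
    spectralSubspace T s ⟂ spectralSubspace T t := by
  refine Submodule.isOrtho_iSup_left.2 fun μ => Submodule.isOrtho_iSup_right.2 fun ν => ?_
  have hne : ((μ : ℝ) : 𝕜) ≠ ((ν : ℝ) : 𝕜) := fun h =>
    hst.ne_of_mem μ.2 ν.2 (RCLike.ofReal_injective h)
  exact hT.orthogonalFamily_eigenspaces.isOrtho hne

theorem exists_sum_of_mem_spectralSubspace (hT : T.IsSymmetric) {u : H}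
    (hu : u ∈ spectralSubspace T s) :
    ∃ (F : Finset s) (v : s → H), ‖u‖ ^ 2 = ∑ μ ∈ F, ‖v μ‖ ^ 2 ∧
      re ⟪T u, u⟫_𝕜 = ∑ μ ∈ F, (μ : ℝ) * ‖v μ‖ ^ 2 := by
  rw [spectralSubspace, Submodule.mem_iSup_iff_exists_finsupp] at hu
  obtain ⟨φ, hφ, rfl⟩ := hu
  have hO := hT.orthogonalFamily_eigenspaces.comp (ofReal_comp_val_injective s)
  let l (μ : s) : eigenspace T ((μ : ℝ) : 𝕜) := ⟨φ μ, hφ μ⟩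
  refine ⟨φ.support, φ, hO.norm_sum l φ.support, ?_⟩
  have hTφ : T (φ.sum fun _ x => x) = ∑ μ ∈ φ.support, ((μ : ℝ) : 𝕜) • φ μ := by
    rw [Finsupp.sum, map_sum]
    exact Finset.sum_congr rfl fun μ _ => Module.End.mem_eigenspace_iff.1 (hφ μ)
  have hinner : ⟪∑ μ ∈ φ.support, ((μ : ℝ) : 𝕜) • φ μ, φ.sum fun _ x => x⟫_𝕜
      = ∑ μ ∈ φ.support, ⟪((μ : ℝ) : 𝕜) • φ μ, φ μ⟫_𝕜 :=
    hO.inner_sum (fun μ => ((μ : ℝ) : 𝕜) • l μ) l φ.support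
  rw [hTφ, hinner, map_sum]
  refine Finset.sum_congr rfl fun μ _ => ?_
  rw [inner_smul_left, RCLike.conj_ofReal, RCLike.re_ofReal_mul, inner_self_eq_norm_sq]

theorem negDefOn_spectralSubspace_Ioi (hT : T.IsSymmetric) (c : ℝ) :
    NegDefOn (fun u => c * ‖u‖ ^ 2 - re ⟪T u, u⟫_𝕜) (spectralSubspace T (Set.Ioi c)) := by
  intro u hu hu0
  obtain ⟨F, v, hnorm, hform⟩ := exists_sum_of_mem_spectralSubspace hT hu
  have hpos : 0 < ∑ μ ∈ F, ‖v μ‖ ^ 2 := hnorm ▸ by positivity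
  obtain ⟨ν, hν, hvν⟩ := Finset.exists_ne_zero_of_sum_ne_zero hpos.ne'
  simp only [hnorm, hform, Finset.mul_sum, sub_neg]
  refine Finset.sum_lt_sum (fun μ _ => ?_) ⟨ν, hν, ?_⟩
  · exact mul_le_mul_of_nonneg_right μ.2.le (sq_nonneg _)
  · exact mul_lt_mul_of_pos_right ν.2 (lt_of_le_of_ne (sq_nonneg _) hvν.symm)

theorem nonnegOn_spectralSubspace_Iic (hT : T.IsSymmetric) (c : ℝ) :
    NonnegOn (fun u => c * ‖u‖ ^ 2 - re ⟪T u, u⟫_𝕜) (spectralSubspace T (Set.Iic c)) := by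
  intro u hu
  obtain ⟨F, v, hnorm, hform⟩ := exists_sum_of_mem_spectralSubspace hT hu
  simp only [hnorm, hform, Finset.mul_sum, sub_nonneg]
  exact Finset.sum_le_sum fun μ _ => mul_le_mul_of_nonneg_right μ.2 (sq_nonneg _)

theorem iSup_eigenspace_le_spectralSubspace_sup (hT : T.IsSymmetric) (s : Set ℝ) :
    ⨆ μ, eigenspace T μ ≤ spectralSubspace T s ⊔ spectralSubspace T sᶜ := by
  refine iSup_le fun μ v hv => ?_
  rcases eq_or_ne v 0 with rfl | hv0
  · exact Submodule.zero_mem _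
  have hev : Module.End.HasEigenvalue T μ := Module.End.hasEigenvalue_of_hasEigenvector ⟨hv, hv0⟩
  have hreal : ((re μ : ℝ) : 𝕜) = μ := RCLike.conj_eq_iff_re.1 (hT.conj_eigenvalue_eq_self hev)
  rw [← hreal] at hv
  by_cases hμ : re μ ∈ s
  · exact Submodule.mem_sup_left (eigenspace_le_spectralSubspace T hμ hv)
  · exact Submodule.mem_sup_right (eigenspace_le_spectralSubspace T hμ hv)

theorem nonnegOn_spectralSubspace_Ioi_orthogonal [CompleteSpace H] {T : H →L[𝕜] H}
    (hT : (T : H →ₗ[𝕜] H).IsSymmetric) (hc : IsCompactOperator T) (c : ℝ) :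
    NonnegOn (fun u => c * ‖u‖ ^ 2 - re ⟪T u, u⟫_𝕜)
      (spectralSubspace (T : H →ₗ[𝕜] H) (Set.Ioi c))ᗮ := by
  have hspan : (spectralSubspace (T : H →ₗ[𝕜] H) (Set.Ioi c) ⊔
      spectralSubspace (T : H →ₗ[𝕜] H) (Set.Iic c))ᗮ = ⊥ := by
    rw [eq_bot_iff, ← ContinuousLinearMap.orthogonalComplement_iSup_eigenspaces_eq_bot hc hT,
      ← Set.compl_Ioi]
    exact Submodule.orthogonal_le (iSup_eigenspace_le_spectralSubspace_sup hT _)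
  have hortho := spectralSubspace_isOrtho hT (Set.Iic_disjoint_Ioi (le_refl c)).symm
  have hclosed : IsClosed {u : H | 0 ≤ c * ‖u‖ ^ 2 - re ⟪T u, u⟫_𝕜} :=
    isClosed_le continuous_const (by fun_prop)
  exact fun u hu => hclosed.closure_subset_iff.2 (nonnegOn_spectralSubspace_Iic hT c)
    (orthogonal_le_topologicalClosure hortho hspan hu)

end SpectralSubspaces

section BirmanSchwinger

open Module.End (eigenspace)
open RCLike (re)

/-- The Birman–Schwinger correspondence `u ↦ r u`, with inverse `w ↦ t (A - E)⁻¹ s w`, between the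
eigenspace of `A - t s r` at `E` and that of `r (A - E)⁻¹ s` at `1 / t`. Here `B` is `A - E`. -/
def birmanSchwingerEquiv {K V W : Type*} [Field K] [AddCommGroup V] [Module K V] [AddCommGroup W]
    [Module K W] {A : Module.End K V} {B : V ≃ₗ[K] V} {E t : K} (hBA : ∀ u, B u = A u - E • u)
    (r : V →ₗ[K] W) (s : W →ₗ[K] V) (ht : t ≠ 0) :
    eigenspace (A - t • (s ∘ₗ r)) E ≃ₗ[K] eigenspace (r ∘ₗ B.symm ∘ₗ s) t⁻¹ := by
  have hleft : ∀ u ∈ eigenspace (A - t • (s ∘ₗ r)) E, t • B.symm (s (r u)) = u := fun u hu => by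
    have hu' : A u - t • s (r u) = E • u := Module.End.mem_eigenspace_iff.1 hu
    rw [← map_smul, B.symm_apply_eq, hBA, ← hu', sub_sub_cancel]
  have hright : ∀ w ∈ eigenspace (r ∘ₗ B.symm ∘ₗ s) t⁻¹, t • r (B.symm (s w)) = w := fun w hw => by
    have hw' : r (B.symm (s w)) = t⁻¹ • w := Module.End.mem_eigenspace_iff.1 hw
    rw [hw', smul_inv_smul₀ ht]
  refine LinearEquiv.ofLinearMap (r.restrict (p := _) (q := _) fun u hu => ?_)
    ((t • (B.symm ∘ₗ s : W →ₗ[K] V)).restrict (p := _) (q := _) fun w hw => ?_)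
    (by ext ⟨w, hw⟩; simpa using hright w hw) (by ext ⟨u, hu⟩; exact hleft u hu)
  · have hru := congrArg r (hleft u hu)
    rw [map_smul] at hru
    rw [Module.End.mem_eigenspace_iff, eq_inv_smul_iff₀ ht]
    exact hru
  · have hBv : A (B.symm (s w)) - E • B.symm (s w) = s w := by rw [← hBA, B.apply_symm_apply]
    have hsw := congrArg s (hright w hw)
    rw [map_smul] at hsw
    rw [Module.End.mem_eigenspace_iff]
    simp only [LinearMap.smul_apply, LinearMap.comp_apply, LinearMap.sub_apply, LinearEquiv.coe_coe,
      map_smul]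
    linear_combination (norm := module) t • hBv - t • hsw

variable {𝕜 H : Type*} [RCLike 𝕜] [NormedAddCommGroup H] [InnerProductSpace 𝕜 H]

open scoped InnerProductSpace

theorem tsum_crossings_eq_tsum_eigenspace {A r : H →L[𝕜] H} {B : H ≃L[𝕜] H} {E α : ℝ}
    (hα : 0 < α) (hBA : ∀ u, B u = A u - (E : 𝕜) • u) :
    ∑' t : Set.Ioo (0 : ℝ) α, ((Cardinal.toENat (Module.rank 𝕜 (eigenspace
        (A - ((t : ℝ) : 𝕜) • (r ∘L r) : H →L[𝕜] H).toLinearMap (E : 𝕜))) : ℕ∞) : ℝ≥0∞)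
      = ∑' μ : Set.Ioi α⁻¹, ((Cardinal.toENat (Module.rank 𝕜 (eigenspace
        (r ∘L B.symm ∘L r : H →L[𝕜] H).toLinearMap ((μ : ℝ) : 𝕜))) : ℕ∞) : ℝ≥0∞) := by
  let e : Set.Ioo (0 : ℝ) α ≃ Set.Ioi α⁻¹ :=
    { toFun := fun t => ⟨(t : ℝ)⁻¹, inv_strictAnti₀ t.2.1 t.2.2⟩
      invFun := fun μ => ⟨(μ : ℝ)⁻¹, inv_pos.2 ((inv_pos.2 hα).trans μ.2), inv_lt_of_inv_lt₀ hα μ.2⟩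
      left_inv := fun t => Subtype.ext (inv_inv _)
      right_inv := fun μ => Subtype.ext (inv_inv _) }
  rw [← e.tsum_eq]
  refine tsum_congr fun t => ?_
  have ht : ((t : ℝ) : 𝕜) ≠ 0 := RCLike.ofReal_ne_zero.2 t.2.1.ne'
  have hrank := (birmanSchwingerEquiv (B := B.toLinearEquiv) hBA (r : H →ₗ[𝕜] H) r ht).rank_eq
  rw [← RCLike.ofReal_inv] at hrank
  exact congrArg (fun κ => ((Cardinal.toENat κ : ℕ∞) : ℝ≥0∞)) hrank

theorem schurForm_sqrt_smul {B : H ≃L[𝕜] H} {r : H →L[𝕜] H} (hr : (r : H →ₗ[𝕜] H).IsSymmetric)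
    {α : ℝ} (hα : 0 < α) (w : H) : schurForm B (((√α : ℝ) : 𝕜) • r) w
      = α * (α⁻¹ * ‖w‖ ^ 2 - re ⟪(r ∘L B.symm ∘L r : H →L[𝕜] H) w, w⟫_𝕜) := by
  have hinner : ⟪(r ∘L B.symm ∘L r : H →L[𝕜] H) w, w⟫_𝕜 = ⟪B.symm (r w), r w⟫_𝕜 := hr _ _
  rw [hinner, mul_sub, mul_inv_cancel_left₀ hα.ne', schurForm, smul_apply, map_smul,
    inner_smul_left, inner_smul_right, RCLike.conj_ofReal, ← mul_assoc, ← RCLike.ofReal_mul,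
    Real.mul_self_sqrt hα.le, RCLike.re_ofReal_mul]

theorem exists_crossing_submodule [CompleteSpace H] {A r : H →L[𝕜] H} {B : H ≃L[𝕜] H} {E α : ℝ}
    (hα : 0 < α) (hBA : ∀ u, B u = A u - (E : 𝕜) • u) (hB : (B : H →ₗ[𝕜] H).IsSymmetric)
    (hr : (r : H →ₗ[𝕜] H).IsSymmetric) (hc : IsCompactOperator r) {X : Submodule 𝕜 H}
    [FiniteDimensional 𝕜 X] (hX : NonnegOn (schurForm B (((√α : ℝ) : 𝕜) • r)) Xᗮ) :
    ∃ M : Submodule 𝕜 H, FiniteDimensional 𝕜 M ∧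
      ∑' t : Set.Ioo (0 : ℝ) α, ((Cardinal.toENat (Module.rank 𝕜 (eigenspace
        (A - ((t : ℝ) : 𝕜) • (r ∘L r) : H →L[𝕜] H).toLinearMap (E : 𝕜))) : ℕ∞) : ℝ≥0∞)
          = Module.finrank 𝕜 M ∧
      NegDefOn (schurForm B (((√α : ℝ) : 𝕜) • r)) M ∧
      NonnegOn (schurForm B (((√α : ℝ) : 𝕜) • r)) Mᗮ := by
  let K : H →L[𝕜] H := r ∘L B.symm ∘L r
  have hK : (K : H →ₗ[𝕜] H).IsSymmetric := fun x y =>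
    (hr _ _).trans ((isSymmetric_symm hB _ _).trans (hr _ _))
  have hneg : NegDefOn (schurForm B (((√α : ℝ) : 𝕜) • r))
      (spectralSubspace (K : H →ₗ[𝕜] H) (Set.Ioi α⁻¹)) := fun w hw hw0 => by
    rw [schurForm_sqrt_smul hr hα]
    exact mul_neg_of_pos_of_neg hα (negDefOn_spectralSubspace_Ioi hK α⁻¹ w hw hw0)
  have hfin : FiniteDimensional 𝕜 (spectralSubspace (K : H →ₗ[𝕜] H) (Set.Ioi α⁻¹)) :=
    hneg.finiteDimensional hX
  refine ⟨_, hfin, ?_, hneg, fun w hw => ?_⟩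
  · have hindep : iSupIndep fun μ : Set.Ioi α⁻¹ => eigenspace (K : H →ₗ[𝕜] H) ((μ : ℝ) : 𝕜) :=
      (Module.End.eigenspaces_iSupIndep _).comp (ofReal_comp_val_injective _)
    rw [tsum_crossings_eq_tsum_eigenspace hα hBA]
    have : FiniteDimensional 𝕜
        (⨆ μ : Set.Ioi α⁻¹, eigenspace (K : H →ₗ[𝕜] H) ((μ : ℝ) : 𝕜) : Submodule 𝕜 H) := hfin
    exact tsum_toENat_rank_eq_finrank_iSup hindep
  · have hKc : IsCompactOperator K := hc.comp_clm ((B.symm : H →L[𝕜] H) ∘L r)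
    rw [schurForm_sqrt_smul hr hα]
    exact mul_nonneg hα.le (nonnegOn_spectralSubspace_Ioi_orthogonal hK hKc α⁻¹ w hw)

end BirmanSchwinger

section DiagonalForm

open Module (finrank)
open Submodule (span)
open RCLike (re)

variable {ι 𝕜 V : Type*} [Fintype ι] [RCLike 𝕜] [NormedAddCommGroup V] [InnerProductSpace 𝕜 V]
  (b : OrthonormalBasis ι 𝕜 V) {c : ι → ℝ} {I : Set ι}

theorem finrank_span_orthonormalBasis_image (I : Finset ι) :
    finrank 𝕜 (span 𝕜 (b '' I)) = I.card := by
  classical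
  have hI := b.orthonormal.linearIndependent.injective
  rw [← Finset.coe_image, finrank_span_finset_eq_card, Finset.card_image_of_injective _ hI]
  rw [Finset.coe_image]
  exact (b.orthonormal.linearIndependent.linearIndepOn _).id_image

theorem repr_apply_eq_zero_of_mem_span_image {v : V} (hv : v ∈ span 𝕜 (b '' I)) {i : ι}
    (hi : i ∉ I) : b.repr v i = 0 := by
  rw [← b.coe_toBasis] at hv
  rw [← b.coe_toBasis_repr_apply, ← Finsupp.notMem_support_iff]
  exact fun h => hi (b.toBasis.mem_span_image.1 hv h)

theorem negDefOn_span_image (hc : ∀ i ∈ I, c i < 0) :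
    NegDefOn (fun v => ∑ i, c i * ‖b.repr v i‖ ^ 2) (span 𝕜 (b '' I)) := by
  intro v hv hv0
  have hI : ∀ i, b.repr v i ≠ 0 → i ∈ I := fun i hi => by
    by_contra h
    exact hi (repr_apply_eq_zero_of_mem_span_image b hv h)
  obtain ⟨i, hi⟩ : ∃ i, b.repr v i ≠ 0 := by
    by_contra! h
    exact hv0 (b.repr.map_eq_zero_iff.1 (PiLp.ext h))
  refine Finset.sum_neg' (fun j _ => ?_) ⟨i, Finset.mem_univ i, ?_⟩
  · rcases eq_or_ne (b.repr v j) 0 with hj | hj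
    · simp [hj]
    · exact mul_nonpos_of_nonpos_of_nonneg (hc j (hI j hj)).le (sq_nonneg _)
  · exact mul_neg_of_neg_of_pos (hc i (hI i hi)) (by positivity)

theorem nonnegOn_span_image (hc : ∀ i ∈ I, 0 ≤ c i) :
    NonnegOn (fun v => ∑ i, c i * ‖b.repr v i‖ ^ 2) (span 𝕜 (b '' I)) := by
  intro v hv
  refine Finset.sum_nonneg fun i _ => ?_
  by_cases hi : i ∈ I
  · exact mul_nonneg (hc i hi) (sq_nonneg _)
  · simp [repr_apply_eq_zero_of_mem_span_image b hv hi]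

variable [DecidableEq ι] {M : Matrix ι ι 𝕜} (hM : M.IsHermitian) (E : ℝ)

theorem re_inner_toEuclideanLin_sub (v : EuclideanSpace 𝕜 ι) :
    re (inner 𝕜 (M.toEuclideanLin v) v) - E * ‖v‖ ^ 2
      = ∑ i, (hM.eigenvalues i - E) * ‖hM.eigenvectorBasis.repr v i‖ ^ 2 := by
  let b := hM.eigenvectorBasis
  have hMb : ∀ i, M.toEuclideanLin (b i) = (hM.eigenvalues i : 𝕜) • b i := fun i => by
    rw [Matrix.toLpLin_apply, hM.mulVec_eigenvectorBasis, RCLike.real_smul_eq_coe_smul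
      (K := 𝕜), WithLp.toLp_smul, WithLp.toLp_ofLp]
  have hrepr (i : ι) : b.repr (M.toEuclideanLin v) i = (hM.eigenvalues i : 𝕜) * b.repr v i := by
    rw [b.repr_apply_apply, b.repr_apply_apply, ← Matrix.isSymmetric_toEuclideanLin_iff.2 hM, hMb,
      inner_smul_left, RCLike.conj_ofReal]
  rw [← b.repr.inner_map_map, ← b.repr.norm_map, PiLp.inner_apply, map_sum,
    EuclideanSpace.norm_sq_eq, Finset.mul_sum, ← Finset.sum_sub_distrib]
  refine Finset.sum_congr rfl fun i _ => ?_
  rw [hrepr, ← smul_eq_mul, inner_smul_left, RCLike.conj_ofReal, RCLike.re_ofReal_mul,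
    inner_self_eq_norm_sq, sub_mul]

theorem exists_negDefOn_finrank_eq_card_eigenvalues :
    ∃ L : Submodule 𝕜 (EuclideanSpace 𝕜 ι),
      NegDefOn (fun v => re (inner 𝕜 (M.toEuclideanLin v) v) - E * ‖v‖ ^ 2) L ∧
      finrank 𝕜 L = (Finset.univ.filter fun i => hM.eigenvalues i < E).card := by
  simp only [re_inner_toEuclideanLin_sub hM E]
  exact ⟨_, negDefOn_span_image _ fun i hi => sub_neg.2 (Finset.mem_filter.1 hi).2,
    finrank_span_orthonormalBasis_image _ _⟩

theorem exists_nonnegOn_finrank_add_card_eigenvalues :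
    ∃ P : Submodule 𝕜 (EuclideanSpace 𝕜 ι),
      NonnegOn (fun v => re (inner 𝕜 (M.toEuclideanLin v) v) - E * ‖v‖ ^ 2) P ∧
      finrank 𝕜 P + (Finset.univ.filter fun i => hM.eigenvalues i < E).card = Fintype.card ι := by
  simp only [re_inner_toEuclideanLin_sub hM E]
  refine ⟨span 𝕜 (hM.eigenvectorBasis '' (Finset.univ.filter fun i => ¬ hM.eigenvalues i < E)),
    nonnegOn_span_image _ fun i hi => sub_nonneg.2 (not_lt.1 (Finset.mem_filter.1 hi).2), ?_⟩
  rw [finrank_span_orthonormalBasis_image, add_comm, Finset.card_filter_add_card_filter_not,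
    Finset.card_univ]

end DiagonalForm

section SupportedOn

open Module (finrank)

variable {d : ℕ} {S T : Finset (Zd d)}

/-- The subspace of `ℓ²(ℤ^d)` of functions that vanish off `S`. -/
def supportedOn (S : Finset (Zd d)) : Submodule ℂ (L2 d) where
  carrier := {u | ∀ n, n ∉ S → u n = 0}
  add_mem' := fun {u v} hu hv n hn => by
    rw [lp.coeFn_add, Pi.add_apply, hu n hn, hv n hn, add_zero]
  zero_mem' := fun _ _ => rfl
  smul_mem' := fun c u hu n hn => by
    rw [lp.coeFn_smul, Pi.smul_apply, hu n hn, smul_zero]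

theorem supportedOn_mono (h : S ⊆ T) : supportedOn S ≤ supportedOn T :=
  fun _ hu n hn => hu n fun hnS => hn (h hnS)

theorem disjoint_supportedOn (h : Disjoint S T) : Disjoint (supportedOn S) (supportedOn T) :=
  Submodule.disjoint_def.2 fun u huS huT => by
    ext n
    by_cases hn : n ∈ S
    · exact huT n (Finset.disjoint_left.1 h hn)
    · exact huS n hn

open Classical in
/-- The embedding of `ℓ²(S)` into `ℓ²(ℤ^d)` by zero off `S`. -/
def extendZero (S : Finset (Zd d)) : EuclideanSpace ℂ S →ₗ[ℂ] L2 d where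
  toFun v := ⟨fun n => if h : n ∈ S then v ⟨n, h⟩ else 0,
    memℓp_gen (summable_of_hasFiniteSupport (S.finite_toSet.subset fun n hn => by
      by_contra h
      rw [Finset.mem_coe] at h
      simp [h] at hn))⟩
  map_add' u v := by
    ext n
    change (if h : n ∈ S then (u + v) ⟨n, h⟩ else 0)
      = (if h : n ∈ S then u ⟨n, h⟩ else 0) + if h : n ∈ S then v ⟨n, h⟩ else 0
    split_ifs <;> simp
  map_smul' c u := by
    ext n
    by_cases h : n ∈ S <;> simp [h]

theorem extendZero_of_mem (v : EuclideanSpace ℂ S) {n : Zd d} (h : n ∈ S) :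
    extendZero S v n = v ⟨n, h⟩ :=
  dif_pos h

theorem extendZero_mem (v : EuclideanSpace ℂ S) : extendZero S v ∈ supportedOn S :=
  fun _ hn => dif_neg hn

theorem extendZero_injective (S : Finset (Zd d)) : Function.Injective (extendZero S) := by
  intro u v h
  ext ⟨n, hn⟩
  rw [← extendZero_of_mem u hn, ← extendZero_of_mem v hn, h]

theorem range_extendZero (S : Finset (Zd d)) : LinearMap.range (extendZero S) = supportedOn S := by
  refine le_antisymm ?_ fun u hu => ⟨WithLp.toLp 2 fun n => u n.1, ?_⟩
  · rintro _ ⟨v, rfl⟩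
    exact extendZero_mem v
  · ext n
    by_cases hn : n ∈ S
    · rw [extendZero_of_mem _ hn]
    · rw [extendZero_mem _ n hn, hu n hn]

instance finiteDimensional_supportedOn (S : Finset (Zd d)) :
    FiniteDimensional ℂ (supportedOn S) := by
  rw [← range_extendZero]
  infer_instance

theorem finrank_supportedOn (S : Finset (Zd d)) : finrank ℂ (supportedOn S) = S.card := by
  rw [← range_extendZero, LinearMap.finrank_range_of_inj (extendZero_injective S),
    finrank_euclideanSpace, Fintype.card_coe]

theorem inner_eq_sum_of_mem (u : L2 d) {w : L2 d} (hw : w ∈ supportedOn S) :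
    inner ℂ u w = ∑ n ∈ S, inner ℂ (u n) (w n) := by
  rw [lp.inner_eq_tsum]
  refine tsum_eq_sum fun n hn => ?_
  rw [hw n hn, inner_zero_right]

theorem norm_sq_eq_sum_of_mem {u : L2 d} (hu : u ∈ supportedOn S) :
    ‖u‖ ^ 2 = ∑ n ∈ S, ‖u n‖ ^ 2 := by
  rw [← inner_self_eq_norm_sq (𝕜 := ℂ), inner_eq_sum_of_mem u hu, map_sum]
  exact Finset.sum_congr rfl fun n _ => inner_self_eq_norm_sq (𝕜 := ℂ) (u n)

theorem inner_extendZero (u v : EuclideanSpace ℂ S) :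
    inner ℂ (extendZero S u) (extendZero S v) = inner ℂ u v := by
  rw [inner_eq_sum_of_mem _ (extendZero_mem v), PiLp.inner_apply, ← Finset.sum_coe_sort S]
  exact Finset.sum_congr rfl fun n _ => by
    rw [extendZero_of_mem u n.2, extendZero_of_mem v n.2]

theorem norm_extendZero (v : EuclideanSpace ℂ S) : ‖extendZero S v‖ = ‖v‖ := by
  rw [norm_eq_sqrt_re_inner (𝕜 := ℂ), inner_extendZero, ← norm_eq_sqrt_re_inner]

theorem apply_eq_zero_of_mem_orthogonal {w : L2 d} (hw : w ∈ (supportedOn S)ᗮ) {n : Zd d}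
    (hn : n ∈ S) : w n = 0 := by
  classical
  have hsingle : (lp.single 2 n (1 : ℂ) : L2 d) ∈ supportedOn S := fun m hm => by
    rw [lp.single_apply, Pi.single_eq_of_ne (ne_of_mem_of_not_mem hn hm).symm]
  simpa [lp.inner_single_left] using (Submodule.mem_orthogonal _ _).1 hw _ hsingle

end SupportedOn

section SchrodingerForm

variable {d : ℕ} {S T : Finset (Zd d)}

theorem neg_mem_unitVectors {v : Zd d} (hv : v ∈ unitVectors d) : -v ∈ unitVectors d := by
  have hneg : pt (-v) = -pt v := by
    ext i
    simp [pt]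
  rwa [mem_unitVectors, hneg, norm_neg, ← mem_unitVectors]

theorem inner_translation (v : Zd d) (u w : L2 d) :
    inner ℂ (translation v u) w = inner ℂ u (translation (-v) w) := by
  rw [lp.inner_eq_tsum, lp.inner_eq_tsum,
    ← (Equiv.addRight v).tsum_eq fun n => inner ℂ (u n) (translation (-v) w n)]
  exact tsum_congr fun n => by simp

theorem mulOp_isSymmetric (g : Zd d → ℝ) (hg : IsBoundedFun g) :
    (mulOp g hg : L2 d →ₗ[ℂ] L2 d).IsSymmetric := fun u w => by
  rw [lp.inner_eq_tsum, lp.inner_eq_tsum]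
  refine tsum_congr fun n => ?_
  simp only [ContinuousLinearMap.coe_coe, mulOp_apply, RCLike.inner_apply, map_mul,
    Complex.conj_ofReal]
  ring

theorem schrodinger_isSymmetric (f : Zd d → ℝ) (hf : IsBoundedFun f) :
    (schrodinger f hf : L2 d →ₗ[ℂ] L2 d).IsSymmetric := by
  have happly : ∀ u, schrodinger f hf u
      = -(∑ v ∈ unitVectors d, translation v u) + (2 * d : ℂ) • u + mulOp f hf u := fun u => by
    rw [← sum_apply (unitVectors d)]
    rfl
  intro u w
  have hpotential : inner ℂ (mulOp f hf u) w = inner ℂ u (mulOp f hf w) :=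
    mulOp_isSymmetric f hf u w
  have hhopping : ∑ v ∈ unitVectors d, inner ℂ (translation v u) w
      = ∑ v ∈ unitVectors d, inner ℂ u (translation v w) :=
    Finset.sum_nbij' (fun v => -v) (fun v => -v) (fun v hv => neg_mem_unitVectors hv)
      (fun v hv => neg_mem_unitVectors hv) (fun v _ => neg_neg v) (fun v _ => neg_neg v)
      (fun v _ => inner_translation v u w)
  rw [ContinuousLinearMap.coe_coe, happly, happly, inner_add_left, inner_add_left, inner_add_right,
    inner_add_right, inner_neg_left, inner_neg_right, sum_inner, inner_sum, hhopping, hpotential,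
    inner_smul_left, inner_smul_right, map_mul, Complex.conj_natCast, Complex.conj_ofNat]

theorem schrodinger_apply_eq_zero (f : Zd d → ℝ) (hf : IsBoundedFun f) {u : L2 d}
    (hu : u ∈ supportedOn S) {n : Zd d} (hn : n ∉ S) (hnv : ∀ v ∈ unitVectors d, n + v ∉ S) :
    schrodinger f hf u n = 0 := by
  have hsum : ∑ v ∈ unitVectors d, u (n + v) = 0 := Finset.sum_eq_zero fun v hv => hu _ (hnv v hv)
  rw [schrodinger_apply, hsum, hu n hn, neg_zero, mul_zero, mul_zero, add_zero, add_zero]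

/-- The quadratic form of `-Δ + f - E`. -/
def schrodingerForm (f : Zd d → ℝ) (hf : IsBoundedFun f) (E : ℝ) (u : L2 d) : ℝ :=
  (inner ℂ (schrodinger f hf u) u).re - E * ‖u‖ ^ 2

theorem schrodingerForm_zero (f : Zd d → ℝ) (hf : IsBoundedFun f) (E : ℝ) :
    schrodingerForm f hf E 0 = 0 := by
  simp [schrodingerForm]

theorem schrodingerForm_sub (f g : Zd d → ℝ) (hf : IsBoundedFun f) (hg : IsBoundedFun g)
    (E E' : ℝ) {u : L2 d} (hu : u ∈ supportedOn S) :
    schrodingerForm g hg E' u - schrodingerForm f hf E u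
      = ∑ n ∈ S, ((g n - E') - (f n - E)) * ‖u n‖ ^ 2 := by
  have hsub : inner ℂ (schrodinger g hg u) u - inner ℂ (schrodinger f hf u) u
      = ((∑ n ∈ S, (g n - f n) * ‖u n‖ ^ 2 : ℝ) : ℂ) := by
    rw [inner_eq_sum_of_mem _ hu, inner_eq_sum_of_mem _ hu, ← Finset.sum_sub_distrib,
      Complex.ofReal_sum]
    refine Finset.sum_congr rfl fun n _ => ?_
    rw [schrodinger_apply, schrodinger_apply, ← inner_sub_left, add_sub_add_left_eq_sub, ← sub_mul,
      ← smul_eq_mul, inner_smul_left, inner_self_eq_norm_sq_to_K]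
    simp
  have hre := congrArg Complex.re hsub
  rw [Complex.sub_re, Complex.ofReal_re] at hre
  simp only [schrodingerForm, norm_sq_eq_sum_of_mem hu]
  rw [sub_sub_sub_comm, hre, Finset.mul_sum, Finset.mul_sum, ← Finset.sum_sub_distrib,
    ← Finset.sum_sub_distrib]
  exact Finset.sum_congr rfl fun n _ => by ring

theorem schrodingerForm_add (f : Zd d → ℝ) (hf : IsBoundedFun f) (E : ℝ) (hST : Disjoint S T)
    (hadj : ∀ n ∈ S, ∀ v ∈ unitVectors d, n + v ∉ T) {u w : L2 d} (hu : u ∈ supportedOn S)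
    (hw : w ∈ supportedOn T) :
    schrodingerForm f hf E (u + w) = schrodingerForm f hf E u + schrodingerForm f hf E w := by
  have hAwu : inner ℂ (schrodinger f hf w) u = 0 := by
    rw [inner_eq_sum_of_mem _ hu]
    refine Finset.sum_eq_zero fun n hn => ?_
    rw [schrodinger_apply_eq_zero f hf hw (Finset.disjoint_left.1 hST hn) (hadj n hn),
      inner_zero_left]
  have hAuw : inner ℂ (schrodinger f hf u) w = 0 := by
    rw [← inner_conj_symm, ← ContinuousLinearMap.coe_coe, ← schrodinger_isSymmetric f hf w u,
      ContinuousLinearMap.coe_coe, hAwu, map_zero]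
  have huw : inner ℂ u w = 0 := by
    rw [inner_eq_sum_of_mem _ hw]
    refine Finset.sum_eq_zero fun n hn => ?_
    rw [hu n (Finset.disjoint_right.1 hST hn), inner_zero_left]
  have hnorm : ‖u + w‖ ^ 2 = ‖u‖ ^ 2 + ‖w‖ ^ 2 := by
    rw [sq, sq, sq, norm_add_sq_eq_norm_sq_add_norm_sq_of_inner_eq_zero u w huw]
  rw [schrodingerForm, schrodingerForm, schrodingerForm, hnorm, map_add, inner_add_left,
    inner_add_right, inner_add_right, hAwu, hAuw, zero_add, add_zero, Complex.add_re]
  ring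

theorem sum_unitVectors_add_eq_sum_ite {u : L2 d} (hu : u ∈ supportedOn S) (n : Zd d) :
    ∑ v ∈ unitVectors d, u (n + v) = ∑ m ∈ S, if ‖pt (m - n)‖ = 1 then u m else 0 := by
  have htranslate : ∑ v ∈ unitVectors d, u (n + v)
      = ∑ m ∈ (unitVectors d).map (addLeftEmbedding n), u m := by
    rw [Finset.sum_map]
    rfl
  rw [htranslate, ← Finset.sum_filter]
  refine (Finset.sum_subset (fun m hm => ?_) fun m hm hmS => hu m fun h => hmS ?_).symm
  · exact Finset.mem_map.2 ⟨m - n, (mem_unitVectors _).2 (Finset.mem_filter.1 hm).2,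
      add_sub_cancel n m⟩
  · obtain ⟨v, hv, rfl⟩ := Finset.mem_map.1 hm
    refine Finset.mem_filter.2 ⟨h, ?_⟩
    rw [addLeftEmbedding_apply, add_sub_cancel_left]
    exact (mem_unitVectors v).1 hv

theorem restrictedMatrix_mulVec (f : Zd d → ℝ) (hf : IsBoundedFun f) (v : EuclideanSpace ℂ S)
    (n : S) : (restrictedMatrix f S).mulVec v.ofLp n = schrodinger f hf (extendZero S v) n := by
  have hsum : ∑ w ∈ unitVectors d, extendZero S v (n + w)
      = ∑ m : S, if ‖pt (m.1 - n.1)‖ = 1 then v m else 0 := by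
    rw [sum_unitVectors_add_eq_sum_ite (extendZero_mem v), ← Finset.sum_coe_sort S]
    exact Finset.sum_congr rfl fun m _ => by rw [extendZero_of_mem v m.2]
  rw [schrodinger_apply, hsum, extendZero_of_mem v n.2, Matrix.mulVec, dotProduct]
  simp [restrictedMatrix, add_mul, Finset.sum_add_distrib, ite_mul, add_assoc,
    ← Finset.sum_neg_distrib, neg_ite]

open Classical in
theorem schrodingerForm_extendZero (f : Zd d → ℝ) (hf : IsBoundedFun f) (E : ℝ)
    (v : EuclideanSpace ℂ S) :
    schrodingerForm f hf E (extendZero S v)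
      = RCLike.re (inner ℂ ((restrictedMatrix f S).toEuclideanLin v) v) - E * ‖v‖ ^ 2 := by
  have hinner : inner ℂ (schrodinger f hf (extendZero S v)) (extendZero S v)
      = inner ℂ ((restrictedMatrix f S).toEuclideanLin v) v := by
    rw [inner_eq_sum_of_mem _ (extendZero_mem v), PiLp.inner_apply, ← Finset.sum_coe_sort S]
    refine Finset.sum_congr rfl fun n _ => ?_
    rw [extendZero_of_mem v n.2, ← restrictedMatrix_mulVec f hf v n, Matrix.toLpLin_apply]
  rw [schrodingerForm, hinner, norm_extendZero]
  rfl

end SchrodingerForm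

section SectionCount

open Module (finrank)

variable {d : ℕ} {S T : Finset (Zd d)}

open Classical in
/-- The number of eigenvalues below `E` of the finite section on `S` of `-Δ + f`. -/
def sectionCount (f : Zd d → ℝ) (S : Finset (Zd d)) (E : ℝ) : ℕ :=
  (Finset.univ.filter fun i => (restrictedMatrix_isHermitian f S).eigenvalues i < E).card

theorem eigenvalueCount_eq_sectionCount (f : Zd d → ℝ) (Ω : Set (EuclideanSpace ℝ (Fin d)))
    (hΩ : Bornology.IsBounded Ω) (E : ℝ) :
    eigenvalueCount f Ω hΩ E = sectionCount f (latticePoints Ω hΩ) E := rfl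

theorem exists_negDefOn_finrank_eq_sectionCount (f : Zd d → ℝ) (hf : IsBoundedFun f)
    (S : Finset (Zd d)) (E : ℝ) :
    ∃ L ≤ supportedOn S, NegDefOn (schrodingerForm f hf E) L ∧
      finrank ℂ L = sectionCount f S E := by
  classical
  obtain ⟨L, hL, hfin⟩ :=
    exists_negDefOn_finrank_eq_card_eigenvalues (restrictedMatrix_isHermitian f S) E
  simp only [← schrodingerForm_extendZero f hf] at hL
  refine ⟨L.map (extendZero S), ?_, NegDefOn.map hL, ?_⟩
  · exact LinearMap.map_le_range.trans (range_extendZero S).le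
  · rw [NegDefOn.finrank_map hL (schrodingerForm_zero f hf E), hfin, sectionCount]

theorem exists_nonnegOn_finrank_add_sectionCount (f : Zd d → ℝ) (hf : IsBoundedFun f)
    (S : Finset (Zd d)) (E : ℝ) :
    ∃ P ≤ supportedOn S, NonnegOn (schrodingerForm f hf E) P ∧
      finrank ℂ P + sectionCount f S E = S.card := by
  classical
  obtain ⟨P, hP, hfin⟩ :=
    exists_nonnegOn_finrank_add_card_eigenvalues (restrictedMatrix_isHermitian f S) E
  simp only [← schrodingerForm_extendZero f hf] at hP
  refine ⟨P.map (extendZero S), ?_, NonnegOn.map hP, ?_⟩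
  · exact LinearMap.map_le_range.trans (range_extendZero S).le
  · rw [← (Submodule.equivMapOfInjective _ (extendZero_injective S) P).finrank_eq, sectionCount,
      hfin, Fintype.card_coe]

theorem NegDefOn.finrank_le_sectionCount {f : Zd d → ℝ} {hf : IsBoundedFun f} {E : ℝ}
    {L : Submodule ℂ (L2 d)} (hL : NegDefOn (schrodingerForm f hf E) L) (hLS : L ≤ supportedOn S) :
    finrank ℂ L ≤ sectionCount f S E := by
  obtain ⟨P, hPS, hP, hfin⟩ := exists_nonnegOn_finrank_add_sectionCount f hf S E
  have hle := hL.finrank_add_finrank_le hP hLS hPS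
  rw [finrank_supportedOn] at hle
  omega

theorem NonnegOn.finrank_add_sectionCount_le {f : Zd d → ℝ} {hf : IsBoundedFun f} {E : ℝ}
    {P : Submodule ℂ (L2 d)} (hP : NonnegOn (schrodingerForm f hf E) P) (hPS : P ≤ supportedOn S) :
    finrank ℂ P + sectionCount f S E ≤ S.card := by
  obtain ⟨L, hLS, hL, hfin⟩ := exists_negDefOn_finrank_eq_sectionCount f hf S E
  have hle := hL.finrank_add_finrank_le hP hLS hPS
  rw [finrank_supportedOn] at hle
  omega

theorem sectionCount_le_card (f : Zd d → ℝ) (S : Finset (Zd d)) (E : ℝ) :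
    sectionCount f S E ≤ S.card :=
  (Finset.card_le_univ _).trans (Fintype.card_coe S).le

theorem sectionCount_mono_set (f : Zd d → ℝ) (hf : IsBoundedFun f) (h : S ⊆ T) (E : ℝ) :
    sectionCount f S E ≤ sectionCount f T E := by
  obtain ⟨L, hLS, hL, hfin⟩ := exists_negDefOn_finrank_eq_sectionCount f hf S E
  exact hfin ▸ hL.finrank_le_sectionCount (hLS.trans (supportedOn_mono h))

theorem sectionCount_add_card_le (f : Zd d → ℝ) (hf : IsBoundedFun f) (h : S ⊆ T) (E : ℝ) :
    sectionCount f T E + S.card ≤ sectionCount f S E + T.card := by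
  obtain ⟨P, hPS, hP, hfin⟩ := exists_nonnegOn_finrank_add_sectionCount f hf S E
  have hle := hP.finrank_add_sectionCount_le (hPS.trans (supportedOn_mono h))
  omega

theorem sectionCount_mono {f g : Zd d → ℝ} (hf : IsBoundedFun f) (hg : IsBoundedFun g)
    {E E' : ℝ} (h : ∀ n ∈ S, f n - E ≤ g n - E') : sectionCount g S E' ≤ sectionCount f S E := by
  obtain ⟨L, hLS, hL, hfin⟩ := exists_negDefOn_finrank_eq_sectionCount g hg S E'
  rw [← hfin]
  refine NegDefOn.finrank_le_sectionCount (hf := hf) (fun u hu hu0 => ?_) hLS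
  refine (hL u hu hu0).trans_le' (sub_nonneg.1 ?_)
  rw [schrodingerForm_sub f g hf hg E E' (hLS hu)]
  exact Finset.sum_nonneg fun n hn => mul_nonneg (sub_nonneg.2 (h n hn)) (sq_nonneg _)

theorem finrank_sup_of_disjoint {K V : Type*} [DivisionRing K] [AddCommGroup V] [Module K V]
    {L M : Submodule K V} [FiniteDimensional K L] [FiniteDimensional K M] (h : Disjoint L M) :
    finrank K (L ⊔ M : Submodule K V) = finrank K L + finrank K M := by
  rw [← Submodule.finrank_sup_add_finrank_inf_eq, h.eq_bot, finrank_bot, add_zero]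

section Union

variable (f : Zd d → ℝ) (hf : IsBoundedFun f) (hST : Disjoint S T)
  (hadj : ∀ n ∈ S, ∀ v ∈ unitVectors d, n + v ∉ T)

include hf hST hadj

open Classical in
theorem sectionCount_add_le_union (E : ℝ) :
    sectionCount f S E + sectionCount f T E ≤ sectionCount f (S ∪ T) E := by
  obtain ⟨L, hLS, hL, hfin⟩ := exists_negDefOn_finrank_eq_sectionCount f hf S E
  obtain ⟨L', hLT, hL', hfin'⟩ := exists_negDefOn_finrank_eq_sectionCount f hf T E
  have := Submodule.finiteDimensional_of_le hLS
  have := Submodule.finiteDimensional_of_le hLT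
  rw [← hfin, ← hfin', ← finrank_sup_of_disjoint ((disjoint_supportedOn hST).mono hLS hLT)]
  refine NegDefOn.finrank_le_sectionCount (hf := hf) (fun u hu hu0 => ?_)
    (sup_le (hLS.trans (supportedOn_mono Finset.subset_union_left))
      (hLT.trans (supportedOn_mono Finset.subset_union_right)))
  obtain ⟨x, hx, y, hy, rfl⟩ := Submodule.mem_sup.1 hu
  rw [schrodingerForm_add f hf E hST hadj (hLS hx) (hLT hy)]
  exact hL.prod hL' (schrodingerForm_zero f hf E) (schrodingerForm_zero f hf E) (x, y) ⟨hx, hy⟩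
    fun h => hu0 (by rw [(Prod.mk_eq_zero.1 h).1, (Prod.mk_eq_zero.1 h).2, add_zero])

open Classical in
theorem sectionCount_union_le (E : ℝ) :
    sectionCount f (S ∪ T) E ≤ sectionCount f S E + sectionCount f T E := by
  obtain ⟨P, hPS, hP, hfin⟩ := exists_nonnegOn_finrank_add_sectionCount f hf S E
  obtain ⟨P', hPT, hP', hfin'⟩ := exists_nonnegOn_finrank_add_sectionCount f hf T E
  have := Submodule.finiteDimensional_of_le hPS
  have := Submodule.finiteDimensional_of_le hPT
  have hsup : NonnegOn (schrodingerForm f hf E) (P ⊔ P') := fun u hu => by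
    obtain ⟨x, hx, y, hy, rfl⟩ := Submodule.mem_sup.1 hu
    rw [schrodingerForm_add f hf E hST hadj (hPS hx) (hPT hy)]
    exact add_nonneg (hP x hx) (hP' y hy)
  have hle := hsup.finrank_add_sectionCount_le
    (sup_le (hPS.trans (supportedOn_mono Finset.subset_union_left))
      (hPT.trans (supportedOn_mono Finset.subset_union_right)))
  rw [finrank_sup_of_disjoint ((disjoint_supportedOn hST).mono hPS hPT),
    Finset.card_union_of_disjoint hST] at hle
  omega

end Union

open Classical in
theorem sectionCount_biUnion (f : Zd d → ℝ) (hf : IsBoundedFun f) {ι : Type*} (J : Finset ι)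
    (S : ι → Finset (Zd d)) (hS : (J : Set ι).PairwiseDisjoint S)
    (hadj : (J : Set ι).Pairwise fun i j => ∀ n ∈ S i, ∀ v ∈ unitVectors d, n + v ∉ S j) (E : ℝ) :
    sectionCount f (J.biUnion S) E = ∑ j ∈ J, sectionCount f (S j) E := by
  induction J using Finset.induction_on with
  | empty => exact Nat.le_zero.1 (sectionCount_le_card f ∅ E)
  | insert a J ha ih =>
    have hne : ∀ j ∈ J, a ≠ j := fun j hj h => ha (h ▸ hj)
    have hJ : (J : Set ι) ⊆ (insert a J : Finset ι) :=
      Finset.coe_subset.2 (Finset.subset_insert a J)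
    have haJ : a ∈ (insert a J : Finset ι) := Finset.mem_insert_self a J
    have hdisj : Disjoint (S a) (J.biUnion S) := (Finset.disjoint_biUnion_right _ _ _).2
      fun j hj => hS haJ (hJ hj) (hne j hj)
    have hsep : ∀ n ∈ S a, ∀ v ∈ unitVectors d, n + v ∉ J.biUnion S := fun n hn v hv hmem => by
      obtain ⟨j, hj, hnj⟩ := Finset.mem_biUnion.1 hmem
      exact hadj haJ (hJ hj) (hne j hj) n hn v hv hnj
    rw [Finset.biUnion_insert, Finset.sum_insert ha, ← ih (hS.subset hJ) (hadj.mono hJ)]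
    exact (sectionCount_union_le f hf hdisj hsep E).antisymm
      (sectionCount_add_le_union f hf hdisj hsep E)

end SectionCount

section ShiftedOperator

open RCLike (re)

variable {𝕜 H : Type*} [RCLike 𝕜] [NormedAddCommGroup H]

section NormedSpace

variable [NormedSpace 𝕜 H]

theorem exists_equiv_eq_sub_smul {A : H →L[𝕜] H} {z : 𝕜} (hz : z ∉ spectrum 𝕜 A) :
    ∃ B : H ≃L[𝕜] H, ∀ u, B u = A u - z • u := by
  obtain ⟨U, hU⟩ := (spectrum.notMem_iff.1 hz).neg
  refine ⟨ContinuousLinearEquiv.ofUnit U, fun u => ?_⟩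
  have happly : (U : H →L[𝕜] H) u = A u - z • u := by
    rw [hU, neg_sub, Algebra.algebraMap_eq_smul_one]
    rfl
  exact happly

theorem mul_norm_symm_le_one {A : H →L[𝕜] H} {B B' : H ≃L[𝕜] H} {z z' : 𝕜}
    (hB : ∀ u, B u = A u - z • u) (hB' : ∀ u, B' u = A u - z' • u) {κ : ℝ} (hz : ‖z' - z‖ ≤ κ)
    (hκ : κ * ‖(B.symm : H →L[𝕜] H)‖ ≤ 1 / 2) : κ * ‖(B'.symm : H →L[𝕜] H)‖ ≤ 1 := by
  have hκ0 : 0 ≤ κ := (norm_nonneg _).trans hz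
  set R : ℝ := ‖(B.symm : H →L[𝕜] H)‖
  have hbound : ‖(B'.symm : H →L[𝕜] H)‖ ≤ 2 * R := by
    refine ContinuousLinearMap.opNorm_le_bound _ (by positivity) fun w => ?_
    rw [ContinuousLinearEquiv.coe_coe]
    have hBw : B (B'.symm w) = w + (z' - z) • B'.symm w := by
      have hw := hB' (B'.symm w)
      rw [B'.apply_symm_apply] at hw
      rw [hB]
      linear_combination (norm := module) -hw
    have hle : ‖B'.symm w‖ ≤ R * ‖w‖ + R * (κ * ‖B'.symm w‖) := by
      calc ‖B'.symm w‖ = ‖B.symm (w + (z' - z) • B'.symm w)‖ := by rw [← hBw, B.symm_apply_apply]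
        _ ≤ R * ‖w + (z' - z) • B'.symm w‖ := (B.symm : H →L[𝕜] H).le_opNorm _
        _ ≤ R * (‖w‖ + κ * ‖B'.symm w‖) := by
          gcongr
          refine (norm_add_le _ _).trans ?_
          rw [norm_smul]
          gcongr
        _ = _ := mul_add _ _ _
    linarith [mul_le_mul_of_nonneg_right hκ (norm_nonneg (B'.symm w))]
  linarith [mul_le_mul_of_nonneg_left hbound hκ0]

end NormedSpace

variable [InnerProductSpace 𝕜 H]

theorem isSymmetric_of_eq_sub_smul {A : H →L[𝕜] H} (hA : (A : H →ₗ[𝕜] H).IsSymmetric)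
    {B : H ≃L[𝕜] H} {E : ℝ} (hB : ∀ u, B u = A u - (E : 𝕜) • u) :
    (B : H →ₗ[𝕜] H).IsSymmetric := fun u w => by
  have hAuw : inner 𝕜 (A u) w = inner 𝕜 u (A w) := hA u w
  change inner 𝕜 (B u) w = inner 𝕜 u (B w)
  rw [hB, hB, inner_sub_left, inner_sub_right, hAuw, inner_smul_left, inner_smul_right,
    RCLike.conj_ofReal]

theorem schurForm_nonneg {B : H ≃L[𝕜] H} {s : H →L[𝕜] H} {w : H} {c : ℝ}
    (hc : c * ‖(B.symm : H →L[𝕜] H)‖ ≤ 1) (hs : ‖s w‖ ^ 2 ≤ c * ‖w‖ ^ 2) :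
    0 ≤ schurForm B s w := by
  refine sub_nonneg.2 ?_
  calc re (inner 𝕜 (B.symm (s w)) (s w)) ≤ ‖B.symm (s w)‖ * ‖s w‖ := re_inner_le_norm _ _
    _ ≤ ‖(B.symm : H →L[𝕜] H)‖ * ‖s w‖ * ‖s w‖ := by
      gcongr
      exact (B.symm : H →L[𝕜] H).le_opNorm _
    _ = ‖(B.symm : H →L[𝕜] H)‖ * ‖s w‖ ^ 2 := by ring
    _ ≤ ‖(B.symm : H →L[𝕜] H)‖ * (c * ‖w‖ ^ 2) := by gcongr
    _ = c * ‖(B.symm : H →L[𝕜] H)‖ * ‖w‖ ^ 2 := by ring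
    _ ≤ 1 * ‖w‖ ^ 2 := by gcongr
    _ = ‖w‖ ^ 2 := one_mul _

theorem isSymmetric_ofReal_smul {s : H →L[𝕜] H} (hs : (s : H →ₗ[𝕜] H).IsSymmetric) (c : ℝ) :
    (((c : 𝕜) • s : H →L[𝕜] H) : H →ₗ[𝕜] H).IsSymmetric :=
  hs.smul (RCLike.conj_ofReal c)

end ShiftedOperator

section Multiplication

variable {d : ℕ}

theorem norm_sqrt_smul_sq {H : Type*} [NormedAddCommGroup H] [NormedSpace ℂ H] {α : ℝ} (hα : 0 ≤ α)
    (w : H) : ‖((√α : ℝ) : ℂ) • w‖ ^ 2 = α * ‖w‖ ^ 2 := by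
  rw [norm_smul, mul_pow, Complex.norm_of_nonneg (Real.sqrt_nonneg α), Real.sq_sqrt hα]

theorem mulOp_mem_supportedOn (g : Zd d → ℝ) (hg : IsBoundedFun g) {S : Finset (Zd d)} {u : L2 d}
    (hu : u ∈ supportedOn S) : mulOp g hg u ∈ supportedOn S := fun n hn => by
  rw [mulOp_apply, hu n hn, mul_zero]

theorem norm_mulOp_apply_le (g : Zd d → ℝ) (hg : IsBoundedFun g) {c : ℝ} (hc : 0 ≤ c) {u : L2 d}
    (h : ∀ n, u n ≠ 0 → |g n| ≤ c) : ‖mulOp g hg u‖ ≤ c * ‖u‖ := by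
  have hle : ‖mulOp g hg u‖ ≤ ‖(c : ℂ) • u‖ := by
    refine lp.norm_mono two_ne_zero fun n => ?_
    rw [mulOp_apply, lp.coeFn_smul, Pi.smul_apply, smul_eq_mul, norm_mul, norm_mul,
      Complex.norm_real, Complex.norm_of_nonneg hc, Real.norm_eq_abs]
    by_cases hn : u n = 0
    · simp [hn]
    · exact mul_le_mul_of_nonneg_right (h n hn) (norm_nonneg _)
  rwa [norm_smul, Complex.norm_of_nonneg hc] at hle

theorem IsBoundedFun.mono {g g' : Zd d → ℝ} (hg : IsBoundedFun g) (h : ∀ n, |g' n| ≤ |g n|) :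
    IsBoundedFun g' :=
  let ⟨C, hC⟩ := hg
  ⟨C, fun n => (h n).trans (hC n)⟩

theorem isCompactOperator_of_forall_mem {𝕜 V W : Type*} [RCLike 𝕜] [NormedAddCommGroup V]
    [NormedSpace 𝕜 V] [NormedAddCommGroup W] [NormedSpace 𝕜 W] (T : V →L[𝕜] W)
    (X : Submodule 𝕜 W) [FiniteDimensional 𝕜 X] (h : ∀ u, T u ∈ X) : IsCompactOperator T := by
  have : ProperSpace X := FiniteDimensional.proper 𝕜 X
  exact (isCompactOperator_id.comp_clm (T.codRestrict X h)).clm_comp X.subtypeL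

theorem norm_mulOp_sub_mulOp_indicator_le (g : Zd d → ℝ) (hg : IsBoundedFun g) (F : Set (Zd d))
    (hF : IsBoundedFun (F.indicator g)) {c : ℝ} (hc : 0 ≤ c) (h : ∀ n ∉ F, |g n| ≤ c) :
    ‖mulOp g hg - mulOp (F.indicator g) hF‖ ≤ c := by
  refine ContinuousLinearMap.opNorm_le_bound _ hc fun u => ?_
  have hgc : IsBoundedFun (Fᶜ.indicator g) :=
    hg.mono fun n => norm_indicator_le_norm_self g n
  have happly : (mulOp g hg - mulOp (F.indicator g) hF) u = mulOp (Fᶜ.indicator g) hgc u := by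
    ext n
    rw [sub_apply, lp.coeFn_sub, Pi.sub_apply, mulOp_apply, mulOp_apply, mulOp_apply,
      Set.indicator_compl, Pi.sub_apply, Complex.ofReal_sub, sub_mul]
  rw [happly]
  refine norm_mulOp_apply_le _ _ hc fun n _ => ?_
  by_cases hn : n ∈ F
  · rwa [Set.indicator_of_notMem (Set.notMem_compl_iff.2 hn), abs_zero]
  · exact (norm_indicator_le_norm_self g n).trans (h n hn)

theorem isCompactOperator_mulOp (g : Zd d → ℝ) (hg : IsBoundedFun g)
    (hzero : Tendsto g cofinite (𝓝 0)) : IsCompactOperator (mulOp g hg) := by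
  have hbdd (F : Finset (Zd d)) : IsBoundedFun ((F : Set (Zd d)).indicator g) :=
    hg.mono fun n => norm_indicator_le_norm_self g n
  refine isCompactOperator_of_tendsto (l := atTop) (F := fun F => mulOp _ (hbdd F)) ?_
    (Eventually.of_forall fun F => isCompactOperator_of_forall_mem _ (supportedOn F)
      fun u n hn => by
        rw [mulOp_apply, Set.indicator_of_notMem (by exact_mod_cast hn), Complex.ofReal_zero,
          zero_mul])
  refine Metric.tendsto_atTop.2 fun ε hε => ?_
  have hfin : {n | ¬ |g n| < ε / 2}.Finite := by
    have hsmall := Metric.tendsto_nhds.1 hzero (ε / 2) (half_pos hε)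
    simpa only [Real.dist_eq, sub_zero] using eventually_cofinite.1 hsmall
  refine ⟨hfin.toFinset, fun F hF => ?_⟩
  rw [dist_comm, dist_eq_norm]
  refine (norm_mulOp_sub_mulOp_indicator_le g hg F (hbdd F) (half_pos hε).le
    fun n hn => ?_).trans_lt (half_lt_self hε)
  by_contra hlt
  exact hn (hF (hfin.mem_toFinset.2 fun hcon => hlt hcon.le))

end Multiplication

section Comparison

open Module (finrank)

variable {d : ℕ} {f : Zd d → ℝ} {hf : IsBoundedFun f} {E : ℝ} {B : L2 d ≃L[ℂ] L2 d}
  {S S₀ : Finset (Zd d)}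

theorem re_inner_eq_schrodingerForm (hB : ∀ u, B u = schrodinger f hf u - (E : ℂ) • u) (u : L2 d) :
    RCLike.re (inner ℂ (B u) u) = schrodingerForm f hf E u := by
  have hsq : (inner ℂ u u).re = ‖u‖ ^ 2 := inner_self_eq_norm_sq (𝕜 := ℂ) u
  rw [hB, inner_sub_left, inner_smul_left, Complex.conj_ofReal, RCLike.re_eq_complex_re,
    Complex.sub_re, Complex.re_ofReal_mul, hsq, schrodingerForm]

theorem apply_mem_supportedOn (hB : ∀ u, B u = schrodinger f hf u - (E : ℂ) • u) (hS : S₀ ⊆ S)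
    (hadj : ∀ n ∈ S₀, ∀ v ∈ unitVectors d, n + v ∈ S) {u : L2 d} (hu : u ∈ supportedOn S₀) :
    B u ∈ supportedOn S := by
  rw [hB]
  refine Submodule.sub_mem _ (fun n hn => ?_) (Submodule.smul_mem _ _ (supportedOn_mono hS hu))
  refine schrodinger_apply_eq_zero f hf hu (fun hnS => hn (hS hnS)) fun v hv hnv => hn ?_
  simpa using hadj _ hnv _ (neg_mem_unitVectors hv)

theorem sectionCount_add_le (hB : ∀ u, B u = schrodinger f hf u - (E : ℂ) • u) (hS : S₀ ⊆ S)
    (hadj : ∀ n ∈ S₀, ∀ v ∈ unitVectors d, n + v ∈ S) {τ : ℝ} (hτ : 0 ≤ τ)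
    (hτB : τ * ‖(B.symm : L2 d →L[ℂ] L2 d)‖ ≤ 1) :
    sectionCount f S (E + τ) + S₀.card ≤ sectionCount f S E + S.card := by
  obtain ⟨L, hLS, hL, hLfin⟩ := exists_negDefOn_finrank_eq_sectionCount f hf S (E + τ)
  obtain ⟨P, hPS, hP, hPfin⟩ := exists_nonnegOn_finrank_add_sectionCount f hf S E
  let s : L2 d →L[ℂ] L2 d := ((√τ : ℝ) : ℂ) • ContinuousLinearMap.id ℂ (L2 d)
  have hs : (s : L2 d →ₗ[ℂ] L2 d).IsSymmetric := isSymmetric_ofReal_smul (fun _ _ => rfl) _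
  have hnorm (w : L2 d) : ‖s w‖ ^ 2 = τ * ‖w‖ ^ 2 := norm_sqrt_smul_sq hτ w
  have hBP : NonnegOn (fun u => RCLike.re (inner ℂ (B u) u)) P := fun u hu =>
    (hP u hu).trans_eq (re_inner_eq_schrodingerForm hB u).symm
  have hBL : NegDefOn (fun u => RCLike.re (inner ℂ (B u) u) - ‖s u‖ ^ 2) L := fun u hu hu0 => by
    have hneg := hL u hu hu0
    simp only [re_inner_eq_schrodingerForm hB, hnorm]
    unfold schrodingerForm at hneg ⊢
    linarith
  have hle := hBP.finrank_add_finrank_le_schurForm (M := ⊥)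
    (isSymmetric_of_eq_sub_smul (schrodinger_isSymmetric f hf) hB) hs (supportedOn_mono hS)
    (fun u => apply_mem_supportedOn hB hS hadj) (fun u hu => Submodule.smul_mem _ _ hu) hPS hBL hLS
    fun w _ => schurForm_nonneg hτB (hnorm w).le
  rw [finrank_bot, finrank_supportedOn, finrank_supportedOn] at hle
  omega

section Crossing

variable {V : Zd d → ℝ} {α : ℝ}

theorem IsBoundedFun.sqrt (hV : IsBoundedFun V) : IsBoundedFun fun n => √(V n) := by
  obtain ⟨C, hC⟩ := hV
  refine ⟨√C, fun n => ?_⟩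
  rw [abs_of_nonneg (Real.sqrt_nonneg _)]
  exact Real.sqrt_le_sqrt ((le_abs_self _).trans (hC n))

theorem mulOp_sqrt_comp_self (hV : ∀ n, 0 ≤ V n) (hVb : IsBoundedFun V) :
    mulOp (fun n => √(V n)) hVb.sqrt ∘L mulOp (fun n => √(V n)) hVb.sqrt = mulOp V hVb := by
  ext u n
  rw [ContinuousLinearMap.comp_apply, mulOp_apply, mulOp_apply, mulOp_apply, ← mul_assoc,
    ← Complex.ofReal_mul, Real.mul_self_sqrt (hV n)]

theorem re_inner_sub_norm_sq_eq_schrodingerForm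
    (hB : ∀ u, B u = schrodinger f hf u - (E : ℂ) • u) (hV : ∀ n, 0 ≤ V n) (hVb : IsBoundedFun V)
    (hα : 0 ≤ α) (hfV : IsBoundedFun fun n => f n - α * V n) {u : L2 d} (hu : u ∈ supportedOn S) :
    RCLike.re (inner ℂ (B u) u)
        - ‖(((√α : ℝ) : ℂ) • mulOp (fun n => √(V n)) hVb.sqrt : L2 d →L[ℂ] L2 d) u‖ ^ 2
      = schrodingerForm (fun n => f n - α * V n) hfV E u := by
  have hsub := schrodingerForm_sub f (fun n => f n - α * V n) hf hfV E E hu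
  rw [re_inner_eq_schrodingerForm hB, smul_apply, norm_sqrt_smul_sq hα,
    norm_sq_eq_sum_of_mem (mulOp_mem_supportedOn _ _ hu), eq_add_of_sub_eq hsub, Finset.mul_sum,
    sub_eq_add_neg, add_comm, ← Finset.sum_neg_distrib]
  refine congrArg (· + _) (Finset.sum_congr rfl fun n _ => ?_)
  rw [mulOp_apply, norm_mul, Complex.norm_of_nonneg (Real.sqrt_nonneg _), mul_pow,
    Real.sq_sqrt (hV n)]
  ring

theorem nonnegOn_schurForm_orthogonal (hVb : IsBoundedFun V) (hα : 0 < α)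
    {c : ℝ} (hc : 0 ≤ c) (hcB : c * ‖(B.symm : L2 d →L[ℂ] L2 d)‖ ≤ 1)
    (hVc : ∀ n ∉ S, α * V n ≤ c) :
    NonnegOn (schurForm B (((√α : ℝ) : ℂ) • mulOp (fun n => √(V n)) hVb.sqrt))
      (supportedOn S)ᗮ := fun w hw => by
  refine schurForm_nonneg hcB ?_
  rw [smul_apply, norm_sqrt_smul_sq hα.le]
  have hle : ‖mulOp (fun n => √(V n)) hVb.sqrt w‖ ≤ √(c / α) * ‖w‖ :=
    norm_mulOp_apply_le _ _ (Real.sqrt_nonneg _) fun n hn => by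
      rw [abs_of_nonneg (Real.sqrt_nonneg _)]
      refine Real.sqrt_le_sqrt ((le_div_iff₀' hα).2 (hVc n fun hnS => hn ?_))
      exact apply_eq_zero_of_mem_orthogonal hw hnS
  calc α * ‖mulOp (fun n => √(V n)) hVb.sqrt w‖ ^ 2 ≤ α * (√(c / α) * ‖w‖) ^ 2 := by gcongr
    _ = c * ‖w‖ ^ 2 := by
      rw [mul_pow, Real.sq_sqrt (by positivity)]
      field_simp

theorem exists_crossingNumber_eq (hB : ∀ u, B u = schrodinger f hf u - (E : ℂ) • u)
    (hV : ∀ n, 0 ≤ V n) (hVb : IsBoundedFun V) (hzero : Tendsto V cofinite (𝓝 0)) (hα : 0 < α)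
    (hfV : IsBoundedFun fun n => f n - α * V n) (hS : S₀ ⊆ S)
    (hadj : ∀ n ∈ S₀, ∀ v ∈ unitVectors d, n + v ∈ S) {c : ℝ} (hc : 0 ≤ c)
    (hcB : c * ‖(B.symm : L2 d →L[ℂ] L2 d)‖ ≤ 1) (hVc : ∀ n ∉ S, α * V n ≤ c) :
    ∃ N : ℕ, crossingNumber (schrodinger f hf) (mulOp V hVb) E α = N ∧
      N + sectionCount f S E + S₀.card ≤ sectionCount (fun n => f n - α * V n) S E + S.card ∧
      sectionCount (fun n => f n - α * V n) S E + S₀.card ≤ N + sectionCount f S E + S.card := by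
  set r := mulOp (fun n => √(V n)) hVb.sqrt with hr_def
  have hr : (r : L2 d →ₗ[ℂ] L2 d).IsSymmetric := mulOp_isSymmetric _ _
  have hrc : IsCompactOperator r := isCompactOperator_mulOp _ _ (by
    simpa only [Real.sqrt_zero] using hzero.sqrt)
  have hBsym := isSymmetric_of_eq_sub_smul (schrodinger_isSymmetric f hf) hB
  have hX := nonnegOn_schurForm_orthogonal (B := B) hVb hα hc hcB hVc
  obtain ⟨M, _, hcross, hMneg, hMnonneg⟩ := exists_crossing_submodule hα hB hBsym hr hrc hX
  obtain ⟨L, hLS, hL, hLfin⟩ := exists_negDefOn_finrank_eq_sectionCount f hf S E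
  obtain ⟨P, hPS, hP, hPfin⟩ := exists_nonnegOn_finrank_add_sectionCount f hf S E
  obtain ⟨L', hLS', hL', hLfin'⟩ := exists_negDefOn_finrank_eq_sectionCount _ hfV S E
  obtain ⟨P', hPS', hP', hPfin'⟩ := exists_nonnegOn_finrank_add_sectionCount _ hfV S E
  have hform (u : L2 d) (hu : u ∈ supportedOn S) :=
    re_inner_sub_norm_sq_eq_schrodingerForm hB hV hVb hα.le hfV hu
  have hs := isSymmetric_ofReal_smul hr (√α)
  have hsX : ∀ u ∈ supportedOn S, (((√α : ℝ) : ℂ) • r : L2 d →L[ℂ] L2 d) u ∈ supportedOn S :=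
    fun u hu => Submodule.smul_mem _ _ (mulOp_mem_supportedOn _ _ hu)
  have hBW := fun u => apply_mem_supportedOn (u := u) hB hS hadj
  refine ⟨finrank ℂ M, by rw [← hcross, hr_def, mulOp_sqrt_comp_self hV hVb]; rfl, ?_, ?_⟩
  · have hle := NegDefOn.finrank_add_finrank_schurForm_le hBsym hs (supportedOn_mono hS) hBW hsX hX
      (L := L) (P := P')
      (fun u hu hu0 => (re_inner_eq_schrodingerForm hB u).trans_lt (hL u hu hu0)) hLS
      (fun u hu => (hP' u hu).trans_eq (hform u (hPS' hu)).symm) hPS' hMneg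
    rw [finrank_supportedOn, finrank_supportedOn] at hle
    omega
  · have hle := NonnegOn.finrank_add_finrank_le_schurForm hBsym hs (supportedOn_mono hS) hBW hsX
      (L := L') (P := P) (fun u hu => (hP u hu).trans_eq (re_inner_eq_schrodingerForm hB u).symm)
      hPS (fun u hu hu0 => (hform u (hLS' hu)).trans_lt (hL' u hu hu0)) hLS' hMnonneg
    rw [finrank_supportedOn, finrank_supportedOn] at hle
    omega

end Crossing

end Comparison

section Boxes

variable {d : ℕ} {l u : Fin d → ℝ}

/-- The open box `∏ (lᵢ, uᵢ)` in Euclidean space; these are the domains to which the density of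
states is applied. -/
def openBox (l u : Fin d → ℝ) : Set (EuclideanSpace ℝ (Fin d)) :=
  {x | ∀ i, l i < x i ∧ x i < u i}

theorem openBox_eq_preimage (l u : Fin d → ℝ) :
    openBox l u = (MeasurableEquiv.toLp 2 (Fin d → ℝ)).symm ⁻¹'
      (Set.univ.pi fun i => Set.Ioo (l i) (u i)) := by
  ext x
  simp [openBox]

theorem isOpen_openBox (l u : Fin d → ℝ) : IsOpen (openBox l u) := by
  rw [openBox_eq_preimage]
  exact (isOpen_set_pi Set.finite_univ fun _ _ => isOpen_Ioo).preimage
    (PiLp.continuous_ofLp 2 _)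

theorem convex_openBox (l u : Fin d → ℝ) : Convex ℝ (openBox l u) := by
  rw [openBox_eq_preimage]
  exact (convex_pi fun i _ => convex_Ioo (l i) (u i)).linear_preimage
    (WithLp.linearEquiv 2 ℝ (Fin d → ℝ)).toLinearMap

theorem nonempty_openBox (h : ∀ i, l i < u i) : (openBox l u).Nonempty :=
  ⟨WithLp.toLp 2 fun i => (l i + u i) / 2, fun i => ⟨left_lt_add_div_two.2 (h i),
    add_div_two_lt_right.2 (h i)⟩⟩

theorem volume_openBox (h : ∀ i, l i ≤ u i) :
    volume (openBox l u) = ENNReal.ofReal (∏ i, (u i - l i)) := by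
  rw [openBox_eq_preimage,
    (EuclideanSpace.volume_preserving_symm_measurableEquiv_toLp (Fin d)).measure_preimage_equiv,
    Real.volume_pi_Ioo, ENNReal.ofReal_prod_of_nonneg fun i _ => sub_nonneg.2 (h i)]

theorem norm_le_of_forall_abs_le {x : EuclideanSpace ℝ (Fin d)} {c : ℝ} (hc : 0 ≤ c)
    (h : ∀ i, |x i| ≤ c) : ‖x‖ ≤ d * c := by
  rw [EuclideanSpace.norm_eq]
  refine Real.sqrt_le_iff.2 ⟨by positivity, ?_⟩
  calc ∑ i, ‖x i‖ ^ 2 ≤ ∑ _i : Fin d, c ^ 2 :=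
        Finset.sum_le_sum fun i _ => pow_le_pow_left₀ (norm_nonneg _) (h i) 2
    _ = d * c ^ 2 := by rw [Finset.sum_const, Finset.card_univ, Fintype.card_fin, nsmul_eq_mul]
    _ ≤ (d * d) * c ^ 2 := by
        gcongr
        exact_mod_cast Nat.le_mul_self d
    _ = (d * c) ^ 2 := by ring

theorem isBounded_openBox (l u : Fin d → ℝ) : Bornology.IsBounded (openBox l u) := by
  refine isBounded_iff_forall_norm_le.2 ⟨d * ∑ i, (|l i| + |u i|), fun x hx => ?_⟩
  refine norm_le_of_forall_abs_le (by positivity) fun i => ?_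
  refine le_trans ?_ (Finset.single_le_sum (f := fun i => |l i| + |u i|)
    (fun i _ => by positivity) (Finset.mem_univ i))
  have hi := hx i
  rw [abs_le]
  exact ⟨by linarith [neg_abs_le (l i), abs_nonneg (u i)],
    by linarith [le_abs_self (u i), abs_nonneg (l i)]⟩

/-- The set of lattice points in the open box `∏ (lᵢ, uᵢ)`. -/
def latBox (l u : Fin d → ℝ) : Finset (Zd d) :=
  Fintype.piFinset fun i => Finset.Ioo ⌊l i⌋ ⌈u i⌉

theorem mem_latBox {n : Zd d} : n ∈ latBox l u ↔ ∀ i, l i < n i ∧ (n i : ℝ) < u i := by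
  simp [latBox, Int.floor_lt, Int.lt_ceil]

theorem latBox_mono {l' u' : Fin d → ℝ} (hl : ∀ i, l' i ≤ l i) (hu : ∀ i, u i ≤ u' i) :
    latBox l u ⊆ latBox l' u' := fun n hn => by
  rw [mem_latBox] at hn ⊢
  exact fun i => ⟨(hl i).trans_lt (hn i).1, (hn i).2.trans_le (hu i)⟩

open scoped Pointwise in
theorem latticePoints_smul_openBox {β : ℝ} (hβ : 0 < β)
    (h : Bornology.IsBounded (β • openBox l u)) :
    latticePoints (β • openBox l u) h = latBox (fun i => β * l i) (fun i => β * u i) := by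
  ext n
  rw [latticePoints, Set.Finite.mem_toFinset, Set.mem_ofPred_eq,
    Set.mem_smul_set_iff_inv_smul_mem₀ hβ.ne', mem_latBox]
  refine forall_congr' fun i => ?_
  change l i < β⁻¹ * (n i : ℝ) ∧ β⁻¹ * (n i : ℝ) < u i ↔ _
  rw [lt_inv_mul_iff₀ hβ, inv_mul_lt_iff₀ hβ]

theorem abs_card_Ioo_floor_ceil_sub_le {x y : ℝ} (h : 1 ≤ y - x) :
    |((Finset.Ioo ⌊x⌋ ⌈y⌉).card : ℝ) - (y - x)| ≤ 1 := by
  have hx := Int.floor_le x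
  have hx' := Int.lt_floor_add_one x
  have hy := Int.le_ceil y
  have hy' := Int.ceil_lt_add_one y
  have hcard : ((Finset.Ioo ⌊x⌋ ⌈y⌉).card : ℝ) = ⌈y⌉ - ⌊x⌋ - 1 := by
    have hnonneg : (0 : ℤ) ≤ ⌈y⌉ - ⌊x⌋ - 1 := by
      have : (0 : ℝ) ≤ ⌈y⌉ - ⌊x⌋ - 1 := by linarith
      exact_mod_cast this
    rw [Int.card_Ioo]
    exact_mod_cast Int.toNat_of_nonneg hnonneg
  rw [hcard, abs_le]
  constructor <;> linarith

theorem tendsto_card_Ioo_div {a b : ℝ} (hab : a < b) (c : ℝ) :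
    Tendsto (fun β : ℝ => ((Finset.Ioo ⌊β * a + c⌋ ⌈β * b - c⌉).card : ℝ) / β) atTop
      (𝓝 (b - a)) := by
  have hzero : Tendsto (fun β : ℝ => (1 + |2 * c|) / β) atTop (𝓝 0) :=
    tendsto_const_nhds.div_atTop tendsto_id
  rw [tendsto_iff_norm_sub_tendsto_zero]
  refine squeeze_zero' (Eventually.of_forall fun _ => norm_nonneg _) ?_ hzero
  filter_upwards [eventually_gt_atTop 0, (tendsto_id.atTop_mul_const
    (sub_pos.2 hab)).eventually_ge_atTop (2 * c + 1)] with β hβ hβc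
  rw [id] at hβc
  have hcard := abs_card_Ioo_floor_ceil_sub_le (x := β * a + c) (y := β * b - c) (by linarith)
  rw [Real.norm_eq_abs, div_sub' hβ.ne', abs_div, abs_of_pos hβ]
  gcongr
  rw [abs_le] at hcard ⊢
  constructor <;> linarith [neg_abs_le (2 * c), le_abs_self (2 * c)]

theorem tendsto_card_latBox_div (h : ∀ i, l i < u i) (c : ℝ) :
    Tendsto (fun β : ℝ => ((latBox (fun i => β * l i + c) (fun i => β * u i - c)).card : ℝ)
      / β ^ d) atTop (𝓝 (∏ i, (u i - l i))) := by
  refine (tendsto_finsetProd (Finset.univ : Finset (Fin d)) fun i _ =>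
    tendsto_card_Ioo_div (h i) c).congr fun β => ?_
  rw [Finset.prod_div_distrib, Finset.prod_const, Finset.card_univ, Fintype.card_fin, latBox,
    Fintype.card_piFinset, Nat.cast_prod]

theorem tendsto_card_latBox_div_zero (h : ∀ i, l i < u i) :
    Tendsto (fun β : ℝ => ((latBox (fun i => β * l i) (fun i => β * u i)).card : ℝ)
      / β ^ d) atTop (𝓝 (∏ i, (u i - l i))) := by
  simpa only [add_zero, sub_zero] using tendsto_card_latBox_div h 0

theorem abs_apply_le_one_of_mem_unitVectors {v : Zd d} (hv : v ∈ unitVectors d) (i : Fin d) :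
    |(v i : ℝ)| ≤ 1 :=
  (PiLp.norm_apply_le (pt v) i).trans_eq ((mem_unitVectors v).1 hv)

theorem add_mem_latBox {n v : Zd d} (hn : n ∈ latBox (fun i => l i + 1) (fun i => u i - 1))
    (hv : v ∈ unitVectors d) : n + v ∈ latBox l u := by
  rw [mem_latBox] at hn ⊢
  intro i
  have hni := hn i
  have hvi := abs_le.1 (abs_apply_le_one_of_mem_unitVectors hv i)
  simp only [Pi.add_apply, Int.cast_add]
  exact ⟨by linarith, by linarith⟩

end Boxes

section DensityOfStates

variable {d : ℕ} {f : Zd d → ℝ} {ρ : ℝ → ℝ}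

namespace HasDensityOfStates

theorem tendsto_sectionCount (hρ : HasDensityOfStates f ρ) {l u : Fin d → ℝ}
    (h : ∀ i, l i < u i) (E : ℝ) :
    Tendsto (fun β : ℝ => (sectionCount f (latBox (fun i => β * l i) (fun i => β * u i)) E : ℝ)
      / β ^ d) atTop (𝓝 ((∏ i, (u i - l i)) * ρ E)) := by
  have hpos : 0 < ∏ i, (u i - l i) := Finset.prod_pos fun i _ => sub_pos.2 (h i)
  have hlim := hρ (openBox l u) (isBounded_openBox l u) (isOpen_openBox l u)
    ((convex_openBox l u).isConnected (nonempty_openBox h))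
    ((convex_openBox l u).addHaar_frontier volume) E
  refine (hlim.const_mul (∏ i, (u i - l i))).congr' ?_
  filter_upwards [eventually_gt_atTop 0] with β hβ
  rw [eigenvalueCount_eq_sectionCount, latticePoints_smul_openBox hβ,
    volume_openBox fun i => (h i).le, ENNReal.toReal_ofReal hpos.le]
  field_simp

theorem tendsto_sectionCount_unit (hρ : HasDensityOfStates f ρ) (E : ℝ) :
    Tendsto (fun β : ℝ => (sectionCount f (latBox (fun _ => β * 0) (fun _ => β * 1)) E : ℝ)
      / β ^ d) atTop (𝓝 (ρ E)) := by
  simpa only [sub_zero, Finset.prod_const_one, one_mul] using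
    hρ.tendsto_sectionCount (l := fun _ => 0) (u := fun _ => 1) (fun _ => one_pos) E

theorem nonneg (hρ : HasDensityOfStates f ρ) (E : ℝ) : 0 ≤ ρ E := by
  refine ge_of_tendsto (hρ.tendsto_sectionCount_unit E) ?_
  filter_upwards [eventually_gt_atTop 0] with β hβ
  positivity

theorem le_one (hρ : HasDensityOfStates f ρ) (E : ℝ) : ρ E ≤ 1 := by
  have hcard := tendsto_card_latBox_div_zero (d := d) (l := fun _ => 0) (u := fun _ => 1)
    fun _ => one_pos
  simp only [sub_zero, Finset.prod_const_one] at hcard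
  refine le_of_tendsto_of_tendsto (hρ.tendsto_sectionCount_unit E) hcard ?_
  filter_upwards [eventually_gt_atTop 0] with β hβ
  gcongr
  exact sectionCount_le_card _ _ _

theorem monotone (hρ : HasDensityOfStates f ρ) (hf : IsBoundedFun f) : Monotone ρ := by
  intro E E' hE
  refine le_of_tendsto_of_tendsto (hρ.tendsto_sectionCount_unit E)
    (hρ.tendsto_sectionCount_unit E') ?_
  filter_upwards [eventually_gt_atTop 0] with β hβ
  gcongr
  exact sectionCount_mono hf hf fun n _ => by linarith

theorem apply_add_le (hρ : HasDensityOfStates f ρ) {hf : IsBoundedFun f} {E τ : ℝ}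
    {B : L2 d ≃L[ℂ] L2 d} (hB : ∀ u, B u = schrodinger f hf u - (E : ℂ) • u) (hτ : 0 ≤ τ)
    (hτB : τ * ‖(B.symm : L2 d →L[ℂ] L2 d)‖ ≤ 1) : ρ (E + τ) ≤ ρ E := by
  have h01 : ∀ _ : Fin d, (0 : ℝ) < 1 := fun _ => one_pos
  have hinner := tendsto_card_latBox_div (l := fun _ => 0) (u := fun _ => 1) h01 1
  have houter := tendsto_card_latBox_div_zero (l := fun _ => 0) (u := fun _ => 1) h01
  have hle := le_of_tendsto_of_tendsto ((hρ.tendsto_sectionCount_unit (E + τ)).add hinner)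
    ((hρ.tendsto_sectionCount_unit E).add houter) (by
      filter_upwards [eventually_gt_atTop 0] with β hβ
      rw [← add_div, ← add_div]
      refine div_le_div_of_nonneg_right ?_ (by positivity)
      exact_mod_cast sectionCount_add_le hB
        (latBox_mono (fun _ => by linarith) fun _ => by linarith)
        (fun n hn v hv => add_mem_latBox hn hv) hτ hτB)
  exact le_of_add_le_add_right hle

theorem eq_of_abs_sub_le (hρ : HasDensityOfStates f ρ) {hf : IsBoundedFun f} {E E' κ : ℝ}
    {B : L2 d ≃L[ℂ] L2 d} (hB : ∀ u, B u = schrodinger f hf u - (E : ℂ) • u)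
    (hκ : κ * ‖(B.symm : L2 d →L[ℂ] L2 d)‖ ≤ 1 / 2)
    (hE' : (E' : ℂ) ∉ spectrum ℂ (schrodinger f hf)) (h : |E' - E| ≤ κ) : ρ E' = ρ E := by
  obtain ⟨B', hB'⟩ := exists_equiv_eq_sub_smul hE'
  rcases le_total E E' with hle | hle
  · refine le_antisymm ?_ (hρ.monotone hf hle)
    have hτ := mul_le_mul_of_nonneg_right ((le_abs_self _).trans h)
      (norm_nonneg (B.symm : L2 d →L[ℂ] L2 d))
    simpa only [add_sub_cancel] using hρ.apply_add_le hB (sub_nonneg.2 hle) (by linarith)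
  · refine le_antisymm (hρ.monotone hf hle) ?_
    have hτ := mul_le_mul_of_nonneg_right ((neg_le_abs _).trans h)
      (norm_nonneg (B'.symm : L2 d →L[ℂ] L2 d))
    have hnorm := mul_norm_symm_le_one hB hB' (κ := κ)
      (by rwa [← Complex.ofReal_sub, Complex.norm_real]) hκ
    rw [neg_sub] at hτ
    simpa only [add_sub_cancel] using hρ.apply_add_le hB' (sub_nonneg.2 hle) (hτ.trans hnorm)

/-- Outside the spectrum the density of states is locally constant, because the counts of finite
sections change there only by the size of the boundary. -/
theorem exists_pos_forall_eq (hρ : HasDensityOfStates f ρ) {hf : IsBoundedFun f} {E : ℝ}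
    (hE : (E : ℂ) ∉ spectrum ℂ (schrodinger f hf)) :
    ∃ κ > 0, ∀ E', |E' - E| ≤ κ → ρ E' = ρ E := by
  obtain ⟨B, hB⟩ := exists_equiv_eq_sub_smul hE
  obtain ⟨ε, hε, hball⟩ := Metric.isOpen_iff.1 (spectrum.isClosed _).isOpen_compl _ hE
  set K := ‖(B.symm : L2 d →L[ℂ] L2 d)‖
  have hK : 0 < K + 1 := by positivity
  refine ⟨min (ε / 2) (1 / (2 * (K + 1))), by positivity, fun E' hE' => ?_⟩
  refine hρ.eq_of_abs_sub_le hB ?_ (hball ?_) hE'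
  · calc min (ε / 2) (1 / (2 * (K + 1))) * K ≤ 1 / (2 * (K + 1)) * (K + 1) := by
          gcongr
          · exact min_le_right _ _
          · linarith
      _ = 1 / 2 := by field_simp
  · rw [Metric.mem_ball, dist_eq_norm, ← Complex.ofReal_sub, Complex.norm_real, Real.norm_eq_abs]
    exact (hE'.trans (min_le_left _ _)).trans_lt (half_lt_self hε)

end HasDensityOfStates

end DensityOfStates

section Profile

open Bornology (cobounded)

variable {d : ℕ} {Ψ : EuclideanSpace ℝ (Fin d) → ℝ} {p : ℝ}

/-- The homogeneous function `Ψ(θ) |x|^{-p}`, `θ = x / |x|`, which is the scaling limit of the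
potential. -/
def profile (Ψ : EuclideanSpace ℝ (Fin d) → ℝ) (p : ℝ) (x : EuclideanSpace ℝ (Fin d)) : ℝ :=
  Ψ (‖x‖⁻¹ • x) * ‖x‖ ^ (-p)

theorem inv_norm_smul_mem_sphere {x : EuclideanSpace ℝ (Fin d)} (hx : x ≠ 0) :
    ‖x‖⁻¹ • x ∈ Metric.sphere (0 : EuclideanSpace ℝ (Fin d)) 1 := by
  rw [mem_sphere_zero_iff_norm, norm_smul, norm_inv, norm_norm]
  exact inv_mul_cancel₀ (norm_ne_zero_iff.2 hx)

theorem profile_smul {r : ℝ} (hr : 0 < r) (x : EuclideanSpace ℝ (Fin d)) :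
    profile Ψ p (r • x) = r ^ (-p) * profile Ψ p x := by
  unfold profile
  rw [norm_smul, Real.norm_of_nonneg hr.le, smul_smul, mul_inv_rev, mul_assoc,
    inv_mul_cancel₀ hr.ne', mul_one, Real.mul_rpow hr.le (norm_nonneg _)]
  ring

theorem continuousOn_profile (hΨ : ContinuousOn Ψ (Metric.sphere 0 1)) :
    ContinuousOn (profile Ψ p) {0}ᶜ := by
  have hn : ∀ x ∈ ({0}ᶜ : Set (EuclideanSpace ℝ (Fin d))), ‖x‖ ≠ 0 := fun x hx =>
    norm_ne_zero_iff.2 hx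
  refine ContinuousOn.mul (hΨ.comp ?_ fun x hx => inv_norm_smul_mem_sphere hx) ?_
  · exact (continuousOn_id.norm.inv₀ hn).smul continuousOn_id
  · exact continuousOn_id.norm.rpow_const fun x hx => Or.inl (hn x hx)

theorem measurable_profile (hΨ : ContinuousOn Ψ (Metric.sphere 0 1)) :
    Measurable (profile Ψ p) :=
  measurable_of_continuousOn_compl_singleton 0 (continuousOn_profile hΨ)

theorem tendsto_profile (hΨ : ContinuousOn Ψ (Metric.sphere 0 1)) (hp : 0 < p) :
    Tendsto (profile Ψ p) (cobounded _) (𝓝 0) := by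
  obtain ⟨C, hC⟩ :=
    (isCompact_sphere (0 : EuclideanSpace ℝ (Fin d)) 1).exists_bound_of_continuousOn hΨ
  have hlim : Tendsto (fun x : EuclideanSpace ℝ (Fin d) => C * ‖x‖ ^ (-p)) (cobounded _) (𝓝 0) := by
    simpa only [mul_zero, Function.comp_def] using
      ((tendsto_rpow_neg_atTop hp).comp tendsto_norm_cobounded_atTop).const_mul C
  refine squeeze_zero_norm' ?_ hlim
  filter_upwards [Bornology.eventually_ne_cobounded 0] with x hx
  rw [profile, norm_mul, Real.norm_of_nonneg (Real.rpow_nonneg (norm_nonneg x) _)]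
  gcongr
  exact hC _ (inv_norm_smul_mem_sphere hx)

theorem exists_nat_forall_abs_profile_le (hΨ : ContinuousOn Ψ (Metric.sphere 0 1)) (hp : 0 < p)
    {κ : ℝ} (hκ : 0 < κ) :
    ∃ N : ℕ, 0 < N ∧ ∀ x : EuclideanSpace ℝ (Fin d), (N : ℝ) ≤ ‖x‖ → |profile Ψ p x| ≤ κ := by
  obtain ⟨r, -, hr⟩ := hasBasis_cobounded_norm.eventually_iff.1
    ((tendsto_profile hΨ hp).eventually (Metric.closedBall_mem_nhds 0 hκ))
  refine ⟨⌈r⌉₊ + 1, Nat.succ_pos _, fun x hx => ?_⟩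
  have hxr : r ≤ ‖x‖ := by
    push_cast at hx
    linarith [Nat.le_ceil r]
  exact mem_closedBall_zero_iff.1 (hr hxr)

open scoped Pointwise in
theorem setOf_profile_eq_mul_rpow {c r : ℝ} (hr : 0 < r) :
    {x | profile Ψ p x = c * r ^ (-p)} = r • {x | profile Ψ p x = c} := by
  ext x
  rw [Set.mem_smul_set_iff_inv_smul_mem₀ hr.ne', Set.mem_ofPred_eq, Set.mem_ofPred_eq,
    profile_smul (inv_pos.2 hr), Real.inv_rpow hr.le,
    inv_mul_eq_iff_eq_mul₀ (Real.rpow_pos_of_pos hr _).ne', mul_comm c]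

/-- By homogeneity, if one level set had positive measure then uncountably many disjoint ones
would. -/
theorem volume_setOf_profile_eq (hΨ : ContinuousOn Ψ (Metric.sphere 0 1)) (hp : 0 < p) {c : ℝ}
    (hc : c ≠ 0) : volume {x | profile Ψ p x = c} = 0 := by
  by_contra hne
  have hcount : {t : ℝ | 0 < volume {x | profile Ψ p x = t}}.Countable :=
    Measure.countable_meas_level_set_pos (measurable_profile hΨ)
  have hsub : (fun r : ℝ => c * r ^ (-p)) '' Set.Ioi 0
      ⊆ {t : ℝ | 0 < volume {x | profile Ψ p x = t}} := by
    rintro _ ⟨r, hr, rfl⟩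
    have hr0 : 0 < r := hr
    simp only [Set.mem_ofPred_eq]
    rw [setOf_profile_eq_mul_rpow hr0, Measure.addHaar_smul]
    refine ENNReal.mul_pos ?_ hne
    rw [Ne, ENNReal.ofReal_eq_zero, not_le, abs_pos]
    exact pow_ne_zero _ hr0.ne'
  have hinj : Set.InjOn (fun r : ℝ => c * r ^ (-p)) (Set.Ioi 0) := fun r hr r' hr' h =>
    Real.rpow_left_injOn (neg_ne_zero.2 hp.ne') (Set.mem_Ioi.1 hr).le (Set.mem_Ioi.1 hr').le
      (mul_left_cancel₀ hc h)
  have hIoi : (Set.Ioi (0 : ℝ)).Countable :=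
    Set.countable_of_injective_of_countable_image hinj (hcount.mono hsub)
  exact absurd (hIoi.measure_zero volume) (by simp)

theorem ae_continuousAt_add_profile (hΨ : ContinuousOn Ψ (Metric.sphere 0 1)) (hp : 0 < p)
    {ρ : ℝ → ℝ} (hρ : Monotone ρ) {E : ℝ} (hE : ContinuousAt ρ E) :
    ∀ᵐ x ∂(volume : Measure (EuclideanSpace ℝ (Fin d))),
      ContinuousAt ρ (E + profile Ψ p x) := by
  have hne : ∀ᵐ x ∂(volume : Measure (EuclideanSpace ℝ (Fin d))),
      ∀ e ∈ {e | ¬ ContinuousAt ρ e}, E + profile Ψ p x ≠ e := by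
    rw [ae_ball_iff hρ.countable_not_continuousAt]
    intro e he
    have heE : e - E ≠ 0 := fun h => he (by rwa [sub_eq_zero.1 h])
    filter_upwards [compl_mem_ae_iff.2 (volume_setOf_profile_eq hΨ hp heE)] with x hx h
    exact hx (eq_sub_of_add_eq' h)
  filter_upwards [hne] with x hx
  by_contra h
  exact hx _ h rfl

theorem exists_forall_abs_profile_sub_le (hΨ : ContinuousOn Ψ (Metric.sphere 0 1)) (R : ℝ)
    {η ε : ℝ} (hη : 0 < η) (hε : 0 < ε) :
    ∃ δ > 0, ∀ x y : EuclideanSpace ℝ (Fin d), η ≤ ‖x‖ → ‖x‖ ≤ R → η ≤ ‖y‖ → ‖y‖ ≤ R →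
      ‖x - y‖ < δ → |profile Ψ p x - profile Ψ p y| ≤ ε := by
  let K : Set (EuclideanSpace ℝ (Fin d)) := Metric.closedBall 0 R \ Metric.ball 0 η
  have hmem {x : EuclideanSpace ℝ (Fin d)} (hxη : η ≤ ‖x‖) (hxR : ‖x‖ ≤ R) : x ∈ K :=
    ⟨mem_closedBall_zero_iff.2 hxR, fun h => (mem_ball_zero_iff.1 h).not_ge hxη⟩
  have hK : IsCompact K := (isCompact_closedBall _ _).diff Metric.isOpen_ball
  have hcont : ContinuousOn (profile Ψ p) K := (continuousOn_profile hΨ).mono fun x hx h0 =>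
    hx.2 ((Set.mem_singleton_iff.1 h0) ▸ Metric.mem_ball_self hη)
  obtain ⟨δ, hδ, hδK⟩ := Metric.uniformContinuousOn_iff.1
    (hK.uniformContinuousOn_of_continuous hcont) ε hε
  refine ⟨δ, hδ, fun x y hxη hxR hyη hyR hxy => ?_⟩
  exact (hδK x (hmem hxη hxR) y (hmem hyη hyR) (by rwa [dist_eq_norm])).le

theorem tendsto_pt : Tendsto (pt : Zd d → EuclideanSpace ℝ (Fin d)) cofinite (cobounded _) := by
  intro s hs
  have hfin := finite_lattice_of_isBounded (Bornology.isBounded_compl_iff.2 hs)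
  exact hfin

theorem eventually_forall_mul_le_norm_pt {P : Zd d → Prop} (hP : ∀ᶠ n in cofinite, P n) {η : ℝ}
    (hη : 0 < η) : ∀ᶠ β : ℝ in atTop, ∀ n : Zd d, β * η ≤ ‖pt n‖ → P n := by
  have hfin : {n | ¬ P n}.Finite := hP
  obtain ⟨M, hM⟩ := (hfin.image fun n => ‖pt n‖).bddAbove
  filter_upwards [eventually_gt_atTop (M / η)] with β hβ n hn
  by_contra hcon
  have hle : ‖pt n‖ ≤ M := hM ⟨n, hcon, rfl⟩
  rw [div_lt_iff₀ hη] at hβ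
  linarith

theorem rpow_mul_sub_profile_inv_smul {β : ℝ} (hβ : 0 < β) {x : EuclideanSpace ℝ (Fin d)}
    (hx : x ≠ 0) (v : ℝ) :
    β ^ p * v - profile Ψ p (β⁻¹ • x)
      = β ^ p / ‖x‖ ^ p * (‖x‖ ^ p * v - Ψ (‖x‖⁻¹ • x)) := by
  have hxp : ‖x‖ ^ p ≠ 0 := (Real.rpow_pos_of_pos (norm_pos_iff.2 hx) p).ne'
  rw [profile_smul (inv_pos.2 hβ), profile, Real.rpow_neg (inv_pos.2 hβ).le,
    Real.inv_rpow hβ.le, inv_inv, Real.rpow_neg (norm_nonneg x)]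
  field_simp [hxp]

namespace HasDecay

variable {V : Zd d → ℝ}

theorem eventually_abs_sub_profile_le (hV : HasDecay V Ψ p) (hp : 0 < p) {η ε : ℝ} (hη : 0 < η)
    (hε : 0 < ε) : ∀ᶠ β : ℝ in atTop, ∀ n : Zd d, β * η ≤ ‖pt n‖ →
      |β ^ p * V n - profile Ψ p (β⁻¹ • pt n)| ≤ ε := by
  have hηp : 0 < η ^ p := Real.rpow_pos_of_pos hη p
  have hev := eventually_forall_mul_le_norm_pt
    (hV.eventually (Metric.closedBall_mem_nhds 0 (mul_pos hηp hε))) hη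
  filter_upwards [eventually_gt_atTop 0, hev] with β hβ hβV n hn
  have hpos : 0 < ‖pt n‖ := (mul_pos hβ hη).trans_le hn
  have hnp : 0 < ‖pt n‖ ^ p := Real.rpow_pos_of_pos hpos p
  have hpow : β ^ p * η ^ p ≤ ‖pt n‖ ^ p := by
    rw [← Real.mul_rpow hβ.le hη.le]
    exact Real.rpow_le_rpow (by positivity) hn hp.le
  rw [rpow_mul_sub_profile_inv_smul hβ (norm_pos_iff.1 hpos), abs_mul, abs_of_pos (by positivity)]
  calc β ^ p / ‖pt n‖ ^ p * |‖pt n‖ ^ p * V n - Ψ (‖pt n‖⁻¹ • pt n)|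
      ≤ β ^ p / ‖pt n‖ ^ p * (η ^ p * ε) := by
        gcongr
        exact mem_closedBall_zero_iff.1 (hβV n hn)
    _ = (β ^ p * η ^ p) / ‖pt n‖ ^ p * ε := by ring
    _ ≤ 1 * ε := by
        gcongr
        exact div_le_one_of_le₀ hpow hnp.le
    _ = ε := one_mul ε

theorem tendsto_zero (hV : HasDecay V Ψ p) (hΨ : ContinuousOn Ψ (Metric.sphere 0 1))
    (hp : 0 < p) : Tendsto V cofinite (𝓝 0) := by
  have hpow := (tendsto_rpow_neg_atTop hp).comp
    (tendsto_norm_cobounded_atTop.comp (tendsto_pt (d := d)))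
  have hsum := (hpow.mul hV).add ((tendsto_profile hΨ hp).comp tendsto_pt)
  rw [zero_mul, zero_add] at hsum
  refine hsum.congr' ?_
  filter_upwards [(tendsto_norm_cobounded_atTop.comp tendsto_pt).eventually_gt_atTop 0] with n hn
  rw [Function.comp_apply] at hn
  simp only [Function.comp_apply, profile]
  rw [mul_sub, mul_comm (Ψ _), sub_add_cancel, ← mul_assoc, ← Real.rpow_add hn, neg_add_cancel,
    Real.rpow_zero, one_mul]

end HasDecay

end Profile

section Cubes

variable {d N k : ℕ}

/-- The large cube `(-N, N)^d`. -/
def largeCube (d N : ℕ) : Set (EuclideanSpace ℝ (Fin d)) :=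
  openBox (fun _ => -(N : ℝ)) (fun _ => N)

/-- The lattice points in `β • (-N, N)^d`. -/
def latLargeCube (d N : ℕ) (β : ℝ) : Finset (Zd d) :=
  latBox (fun _ => β * -(N : ℝ)) (fun _ => β * N)

/-- Lower left corners, in units of `1 / k`, of the cubes of side `1 / k` in `(-N, N)^d`. -/
def cubeIndex (d N k : ℕ) : Finset (Fin d → ℤ) :=
  Fintype.piFinset fun _ => Finset.Ico (-(N * k : ℤ)) (N * k)

/-- The open cube of side `1 / k` with lower left corner `j / k`. -/
def smallCube (k : ℕ) (j : Fin d → ℤ) : Set (EuclideanSpace ℝ (Fin d)) :=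
  openBox (fun i => (j i : ℝ) / k) (fun i => ((j i : ℝ) + 1) / k)

/-- The lattice points of `β • smallCube k j` lying in the box that is smaller by `c` on each
side. -/
def latSmallCube (k : ℕ) (j : Fin d → ℤ) (c β : ℝ) : Finset (Zd d) :=
  latBox (fun i => β * ((j i : ℝ) / k) + c) (fun i => β * (((j i : ℝ) + 1) / k) - c)

theorem cube_bounds (hk : 0 < k) {j : Fin d → ℤ} (hj : j ∈ cubeIndex d N k) (i : Fin d) :
    -(N : ℝ) ≤ (j i : ℝ) / k ∧ ((j i : ℝ) + 1) / k ≤ N := by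
  have hk' : (0 : ℝ) < k := Nat.cast_pos.2 hk
  obtain ⟨hlow, hup⟩ := Finset.mem_Ico.1 (Fintype.mem_piFinset.1 hj i)
  have hlow' : (-(N * k : ℤ) : ℝ) ≤ j i := by exact_mod_cast hlow
  have hup' : (j i : ℝ) + 1 ≤ N * k := by exact_mod_cast Int.add_one_le_of_lt hup
  push_cast at hlow'
  rw [le_div_iff₀ hk', div_le_iff₀ hk']
  exact ⟨by linarith, hup'⟩

theorem smallCube_lt (hk : 0 < k) (j : Fin d → ℤ) (i : Fin d) :
    (j i : ℝ) / k < ((j i : ℝ) + 1) / k := by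
  gcongr
  exact lt_add_one _

theorem smallCube_subset (hk : 0 < k) {j : Fin d → ℤ} (hj : j ∈ cubeIndex d N k) :
    smallCube k j ⊆ largeCube d N := fun _ hx i =>
  ⟨(cube_bounds hk hj i).1.trans_lt (hx i).1, (hx i).2.trans_le (cube_bounds hk hj i).2⟩

theorem prod_smallCube (j : Fin d → ℤ) :
    ∏ i, (((j i : ℝ) + 1) / k - (j i : ℝ) / k) = (1 / k : ℝ) ^ d := by
  simp only [← sub_div, add_sub_cancel_left, Finset.prod_const, Finset.card_univ, Fintype.card_fin]

theorem volume_smallCube (hk : 0 < k) (j : Fin d → ℤ) :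
    volume (smallCube k j) = ENNReal.ofReal ((1 / k : ℝ) ^ d) := by
  rw [smallCube, volume_openBox fun i => (smallCube_lt hk j i).le, prod_smallCube]

theorem prod_largeCube (N : ℕ) : ∏ _i : Fin d, ((N : ℝ) - -N) = (2 * N : ℝ) ^ d := by
  rw [Finset.prod_const, Finset.card_univ, Fintype.card_fin, sub_neg_eq_add, two_mul]

theorem volume_largeCube (N : ℕ) : volume (largeCube d N) = ENNReal.ofReal ((2 * N : ℝ) ^ d) := by
  rw [largeCube, volume_openBox fun _ => neg_le_self (Nat.cast_nonneg N), prod_largeCube]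

theorem volume_largeCube_ne_top (d N : ℕ) : volume (largeCube d N) ≠ ⊤ := by
  rw [volume_largeCube]
  exact ENNReal.ofReal_ne_top

theorem card_cubeIndex_mul (hk : 0 < k) :
    ((cubeIndex d N k).card : ℝ) * (1 / k : ℝ) ^ d = (2 * N : ℝ) ^ d := by
  have hcard : ((N : ℤ) * k - -(N * k : ℤ)).toNat = 2 * N * k := by
    have hcast : (N : ℤ) * k - -(N * k : ℤ) = (2 * N * k : ℕ) := by push_cast; ring
    rw [hcast, Int.toNat_natCast]
  rw [cubeIndex, Fintype.card_piFinset, Finset.prod_const, Finset.card_univ, Fintype.card_fin,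
    Int.card_Ico, hcard, Nat.cast_pow, ← mul_pow]
  congr 1
  push_cast
  field_simp

theorem disjoint_smallCube (hk : 0 < k) {j j' : Fin d → ℤ} (h : j ≠ j') :
    Disjoint (smallCube k j) (smallCube k j') := by
  have hk' : (0 : ℝ) < k := Nat.cast_pos.2 hk
  obtain ⟨i, hi⟩ := Function.ne_iff.1 h
  refine Set.disjoint_left.2 fun x hx hx' => hi (le_antisymm ?_ ?_)
  · have hlt := (hx i).1.trans (hx' i).2
    rw [div_lt_div_iff_of_pos_right hk'] at hlt
    exact Int.lt_add_one_iff.1 (by exact_mod_cast hlt)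
  · have hlt := (hx' i).1.trans (hx i).2
    rw [div_lt_div_iff_of_pos_right hk'] at hlt
    exact Int.lt_add_one_iff.1 (by exact_mod_cast hlt)

theorem setIntegral_largeCube_eq_sum (hk : 0 < k) {G : EuclideanSpace ℝ (Fin d) → ℝ}
    (hG : IntegrableOn G (largeCube d N)) :
    ∫ x in largeCube d N, G x = ∑ j ∈ cubeIndex d N k, ∫ x in smallCube k j, G x := by
  have hmeas : ∀ j ∈ cubeIndex d N k, MeasurableSet (smallCube k j) := fun j _ =>
    (isOpen_openBox _ _).measurableSet
  have hdisj : (cubeIndex d N k : Set (Fin d → ℤ)).PairwiseDisjoint (smallCube k) :=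
    fun j _ j' _ h => disjoint_smallCube hk h
  have hsub : (⋃ j ∈ cubeIndex d N k, smallCube k j) ⊆ largeCube d N :=
    Set.iUnion₂_subset fun j hj => smallCube_subset hk hj
  rw [← integral_biUnion_finset _ hmeas hdisj fun j hj => hG.mono_set (smallCube_subset hk hj)]
  refine setIntegral_congr_set (ae_eq_of_subset_of_measure_ge hsub ?_ ?_ ?_).symm
  · rw [measure_biUnion_finset hdisj hmeas, volume_largeCube, ← card_cubeIndex_mul hk,
      Finset.sum_congr rfl fun j _ => volume_smallCube hk j, Finset.sum_const, nsmul_eq_mul,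
      ENNReal.ofReal_mul (Nat.cast_nonneg _), ENNReal.ofReal_natCast]
  · exact (Finset.measurableSet_biUnion _ hmeas).nullMeasurableSet
  · exact volume_largeCube_ne_top d N

theorem setIntegral_smallCube_const (hk : 0 < k) (j : Fin d → ℤ) (m : ℝ) :
    ∫ _x in smallCube k j, m = (1 / k : ℝ) ^ d * m := by
  rw [setIntegral_const, Measure.real, volume_smallCube hk, ENNReal.toReal_ofReal (by positivity),
    smul_eq_mul]

theorem sum_mul_le_setIntegral_largeCube (hk : 0 < k) {G : EuclideanSpace ℝ (Fin d) → ℝ}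
    (hG : IntegrableOn G (largeCube d N)) {m : (Fin d → ℤ) → ℝ}
    (hm : ∀ j ∈ cubeIndex d N k, ∀ x ∈ smallCube k j, m j ≤ G x) :
    ∑ j ∈ cubeIndex d N k, (1 / k : ℝ) ^ d * m j ≤ ∫ x in largeCube d N, G x := by
  rw [setIntegral_largeCube_eq_sum hk hG]
  refine Finset.sum_le_sum fun j hj => ?_
  rw [← setIntegral_smallCube_const hk j]
  refine setIntegral_mono_on (integrableOn_const ?_) (hG.mono_set (smallCube_subset hk hj))
    (isOpen_openBox _ _).measurableSet (hm j hj)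
  rw [volume_smallCube hk]
  exact ENNReal.ofReal_ne_top

theorem setIntegral_largeCube_le_sum_mul (hk : 0 < k) {G : EuclideanSpace ℝ (Fin d) → ℝ}
    (hG : IntegrableOn G (largeCube d N)) {m : (Fin d → ℤ) → ℝ}
    (hm : ∀ j ∈ cubeIndex d N k, ∀ x ∈ smallCube k j, G x ≤ m j) :
    ∫ x in largeCube d N, G x ≤ ∑ j ∈ cubeIndex d N k, (1 / k : ℝ) ^ d * m j := by
  have hneg := sum_mul_le_setIntegral_largeCube hk hG.neg (m := -m)
    fun j hj x hx => neg_le_neg (hm j hj x hx)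
  simpa only [Pi.neg_apply, integral_neg, mul_neg, Finset.sum_neg_distrib, neg_le_neg_iff]
    using hneg

theorem latSmallCube_subset (j : Fin d → ℤ) {c c' : ℝ} (h : c' ≤ c) (β : ℝ) :
    latSmallCube k j c β ⊆ latSmallCube k j c' β :=
  latBox_mono (fun _ => by linarith) fun _ => by linarith

theorem latSmallCube_subset_latLargeCube (hk : 0 < k) {j : Fin d → ℤ} (hj : j ∈ cubeIndex d N k)
    {c β : ℝ} (hc : 0 ≤ c) (hβ : 0 ≤ β) : latSmallCube k j c β ⊆ latLargeCube d N β :=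
  latBox_mono (fun i => by linarith [mul_le_mul_of_nonneg_left (cube_bounds hk hj i).1 hβ])
    fun i => by linarith [mul_le_mul_of_nonneg_left (cube_bounds hk hj i).2 hβ]

theorem exists_one_lt_abs_sub {j j' : Fin d → ℤ} (h : j ≠ j') {β : ℝ} (hβ : 0 ≤ β) {n m : Zd d}
    (hn : n ∈ latSmallCube k j 1 β) (hm : m ∈ latSmallCube k j' 1 β) :
    ∃ i, 1 < |(m i : ℝ) - n i| := by
  obtain ⟨i, hi⟩ := Function.ne_iff.1 h
  have hni := mem_latBox.1 hn i
  have hmi := mem_latBox.1 hm i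
  have hend (a b : ℤ) (hab : a < b) : β * (((a : ℝ) + 1) / k) ≤ β * ((b : ℝ) / k) := by
    gcongr
    exact_mod_cast hab
  refine ⟨i, lt_abs.2 ?_⟩
  rcases lt_or_gt_of_ne hi with hlt | hlt
  · exact Or.inl (by linarith [hend _ _ hlt])
  · exact Or.inr (by linarith [hend _ _ hlt])

theorem pairwiseDisjoint_latSmallCube {β : ℝ} (hβ : 0 ≤ β) (J : Set (Fin d → ℤ)) :
    J.PairwiseDisjoint fun j => latSmallCube k j 1 β := by
  refine fun i _ j _ hij => Finset.disjoint_left.2 fun n hn hm => ?_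
  obtain ⟨t, ht⟩ := exists_one_lt_abs_sub hij hβ hn hm
  rw [sub_self, abs_zero] at ht
  exact ht.not_ge zero_le_one

open Classical in
theorem sectionCount_biUnion_latSmallCube {β : ℝ} (hβ : 0 ≤ β) (f : Zd d → ℝ)
    (hf : IsBoundedFun f) (J : Finset (Fin d → ℤ)) (E : ℝ) :
    sectionCount f (J.biUnion fun j => latSmallCube k j 1 β) E
      = ∑ j ∈ J, sectionCount f (latSmallCube k j 1 β) E := by
  refine sectionCount_biUnion f hf J _ (pairwiseDisjoint_latSmallCube hβ _)
    (fun i _ j _ hij n hn v hv hm => ?_) E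
  obtain ⟨t, ht⟩ := exists_one_lt_abs_sub hij hβ hn hm
  rw [Pi.add_apply, Int.cast_add, add_sub_cancel_left] at ht
  exact ht.not_ge (abs_apply_le_one_of_mem_unitVectors hv t)

open Classical in
theorem biUnion_latSmallCube_subset (hk : 0 < k) {β : ℝ} (hβ : 0 ≤ β) :
    ((cubeIndex d N k).biUnion fun j => latSmallCube k j 1 β) ⊆ latLargeCube d N β :=
  Finset.biUnion_subset.2 fun _ hj => latSmallCube_subset_latLargeCube hk hj zero_le_one hβ

theorem sectionCount_latLargeCube_add_le (hk : 0 < k) {β : ℝ} (hβ : 0 ≤ β) (f : Zd d → ℝ)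
    (hf : IsBoundedFun f) (E : ℝ) :
    sectionCount f (latLargeCube d N β) E + ∑ j ∈ cubeIndex d N k, (latSmallCube k j 1 β).card
      ≤ ∑ j ∈ cubeIndex d N k, sectionCount f (latSmallCube k j 0 β) E
        + (latLargeCube d N β).card := by
  classical
  have hadd := sectionCount_add_card_le f hf (biUnion_latSmallCube_subset (N := N) hk hβ) E
  rw [sectionCount_biUnion_latSmallCube hβ f hf,
    Finset.card_biUnion (pairwiseDisjoint_latSmallCube hβ _)] at hadd
  refine hadd.trans (Nat.add_le_add_right (Finset.sum_le_sum fun j _ => ?_) _)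
  exact sectionCount_mono_set f hf (latSmallCube_subset j zero_le_one β) E

theorem sum_sectionCount_latSmallCube_add_le (hk : 0 < k) {β : ℝ} (hβ : 0 ≤ β) (f : Zd d → ℝ)
    (hf : IsBoundedFun f) (E : ℝ) :
    ∑ j ∈ cubeIndex d N k, sectionCount f (latSmallCube k j 0 β) E
        + ∑ j ∈ cubeIndex d N k, (latSmallCube k j 1 β).card
      ≤ sectionCount f (latLargeCube d N β) E
        + ∑ j ∈ cubeIndex d N k, (latSmallCube k j 0 β).card := by
  classical
  have hmono := sectionCount_mono_set f hf (biUnion_latSmallCube_subset (N := N) hk hβ) E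
  rw [sectionCount_biUnion_latSmallCube hβ f hf] at hmono
  refine le_trans ?_ (Nat.add_le_add_right hmono _)
  rw [← Finset.sum_add_distrib, ← Finset.sum_add_distrib]
  exact Finset.sum_le_sum fun j _ =>
    sectionCount_add_card_le f hf (latSmallCube_subset j zero_le_one β) E

theorem tendsto_card_latSmallCube (hk : 0 < k) (j : Fin d → ℤ) (c : ℝ) :
    Tendsto (fun β : ℝ => ((latSmallCube k j c β).card : ℝ) / β ^ d) atTop
      (𝓝 ((1 / k : ℝ) ^ d)) := by
  rw [← prod_smallCube j]
  exact tendsto_card_latBox_div (smallCube_lt hk j) c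

theorem tendsto_sum_card_latSmallCube (d N : ℕ) (hk : 0 < k) (c : ℝ) :
    Tendsto (fun β : ℝ => (∑ j ∈ cubeIndex d N k, ((latSmallCube k j c β).card : ℝ)) / β ^ d)
      atTop (𝓝 ((2 * N : ℝ) ^ d)) := by
  rw [← card_cubeIndex_mul hk, ← nsmul_eq_mul, ← Finset.sum_const]
  simp only [Finset.sum_div]
  exact tendsto_finsetSum _ fun j _ => tendsto_card_latSmallCube hk j c

theorem tendsto_card_latLargeCube (d : ℕ) (hN : 0 < N) :
    Tendsto (fun β : ℝ => ((latLargeCube d N β).card : ℝ) / β ^ d) atTop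
      (𝓝 ((2 * N : ℝ) ^ d)) := by
  rw [← prod_largeCube]
  exact tendsto_card_latBox_div_zero fun _ => neg_lt_self (Nat.cast_pos.2 hN)

theorem tendsto_sectionCount_latLargeCube_sub_sum (hN : 0 < N) (hk : 0 < k) {F : ℝ → Zd d → ℝ}
    (hF : ∀ β, IsBoundedFun (F β)) (E : ℝ) :
    Tendsto (fun β : ℝ => ((sectionCount (F β) (latLargeCube d N β) E : ℝ)
      - ∑ j ∈ cubeIndex d N k, (sectionCount (F β) (latSmallCube k j 0 β) E : ℝ)) / β ^ d)
      atTop (𝓝 0) := by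
  have hinner := tendsto_sum_card_latSmallCube d N hk 1
  have hlow := hinner.sub (tendsto_sum_card_latSmallCube d N hk 0)
  have hup := (tendsto_card_latLargeCube d hN).sub hinner
  rw [sub_self] at hlow hup
  refine tendsto_of_tendsto_of_tendsto_of_le_of_le' hlow hup ?_ ?_
  · filter_upwards [eventually_gt_atTop 0] with β hβ
    have hle := sum_sectionCount_latSmallCube_add_le (N := N) hk hβ.le (F β) (hF β) E
    rw [← @Nat.cast_le ℝ] at hle
    push_cast at hle
    rw [← sub_div]
    gcongr ?_ / _
    linarith
  · filter_upwards [eventually_gt_atTop 0] with β hβ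
    have hle := sectionCount_latLargeCube_add_le (N := N) hk hβ.le (F β) (hF β) E
    rw [← @Nat.cast_le ℝ] at hle
    push_cast at hle
    rw [← sub_div]
    gcongr ?_ / _
    linarith

theorem eventually_sectionCount_div_le (hN : 0 < N) (hk : 0 < k) {F : ℝ → Zd d → ℝ}
    (hF : ∀ β, IsBoundedFun (F β)) {E : ℝ} {G : EuclideanSpace ℝ (Fin d) → ℝ}
    (hG : IntegrableOn G (largeCube d N))
    (h : ∀ j ∈ cubeIndex d N k, ∃ m : ℝ, (∀ x ∈ smallCube k j, m ≤ G x) ∧ ∃ b : ℝ → ℝ,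
      Tendsto (fun β => b β / β ^ d) atTop (𝓝 ((1 / k : ℝ) ^ d * m)) ∧
      ∀ᶠ β in atTop, (sectionCount (F β) (latSmallCube k j 0 β) E : ℝ) ≤ b β)
    {ε : ℝ} (hε : 0 < ε) :
    ∀ᶠ β in atTop, (sectionCount (F β) (latLargeCube d N β) E : ℝ) / β ^ d
      ≤ (∫ x in largeCube d N, G x) + ε := by
  choose! m hmG b hb hcount using h
  have hlim := (tendsto_sectionCount_latLargeCube_sub_sum hN hk hF E).add
    (tendsto_finsetSum (cubeIndex d N k) hb)
  rw [zero_add] at hlim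
  have hlt := lt_add_of_le_of_pos (sum_mul_le_setIntegral_largeCube hk hG hmG) hε
  filter_upwards [hlim.eventually_lt_const hlt, (eventually_all_finset _).2 hcount,
    eventually_gt_atTop 0] with β hβlim hβcount hβ
  refine le_trans ?_ hβlim.le
  rw [← Finset.sum_div, ← add_div]
  gcongr ?_ / _
  linarith [Finset.sum_le_sum hβcount]

theorem eventually_le_sectionCount_div (hN : 0 < N) (hk : 0 < k) {F : ℝ → Zd d → ℝ}
    (hF : ∀ β, IsBoundedFun (F β)) {E : ℝ} {G : EuclideanSpace ℝ (Fin d) → ℝ}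
    (hG : IntegrableOn G (largeCube d N))
    (h : ∀ j ∈ cubeIndex d N k, ∃ m : ℝ, (∀ x ∈ smallCube k j, G x ≤ m) ∧ ∃ b : ℝ → ℝ,
      Tendsto (fun β => b β / β ^ d) atTop (𝓝 ((1 / k : ℝ) ^ d * m)) ∧
      ∀ᶠ β in atTop, b β ≤ (sectionCount (F β) (latSmallCube k j 0 β) E : ℝ))
    {ε : ℝ} (hε : 0 < ε) :
    ∀ᶠ β in atTop, (∫ x in largeCube d N, G x) - ε
      ≤ (sectionCount (F β) (latLargeCube d N β) E : ℝ) / β ^ d := by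
  choose! m hmG b hb hcount using h
  have hlim := (tendsto_sectionCount_latLargeCube_sub_sum hN hk hF E).add
    (tendsto_finsetSum (cubeIndex d N k) hb)
  rw [zero_add] at hlim
  have hlt := sub_lt_iff_lt_add.2
    (lt_add_of_le_of_pos (setIntegral_largeCube_le_sum_mul hk hG hmG) hε)
  filter_upwards [hlim.eventually_const_lt hlt, (eventually_all_finset _).2 hcount,
    eventually_gt_atTop 0] with β hβlim hβcount hβ
  refine hβlim.le.trans ?_
  rw [← Finset.sum_div, ← add_div]
  gcongr ?_ / _
  linarith [Finset.sum_le_sum hβcount]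

end Cubes

section Mesh

variable {d N k : ℕ} {Ψ : EuclideanSpace ℝ (Fin d) → ℝ} {p : ℝ}

theorem norm_sub_le_of_mem_smallCube {j : Fin d → ℤ} {x y : EuclideanSpace ℝ (Fin d)}
    (hx : x ∈ smallCube k j) (hy : y ∈ smallCube k j) : ‖x - y‖ ≤ d * (1 / k) := by
  refine norm_le_of_forall_abs_le (by positivity) fun i => ?_
  have hxi := hx i
  have hyi := hy i
  simp only [add_div] at hxi hyi
  rw [PiLp.sub_apply, abs_le]
  exact ⟨by linarith, by linarith⟩

theorem exists_forall_norm_sub_lt_of_mem_smallCube (d : ℕ) {δ : ℝ} (hδ : 0 < δ) :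
    ∃ k : ℕ, 0 < k ∧ ∀ j : Fin d → ℤ, ∀ x ∈ smallCube k j, ∀ y ∈ smallCube k j, ‖x - y‖ < δ := by
  obtain ⟨k, hk⟩ := exists_nat_gt (d / δ)
  have hk0 : (0 : ℝ) < k := (by positivity : (0 : ℝ) ≤ d / δ).trans_lt hk
  refine ⟨k, Nat.cast_pos.1 hk0, fun j x hx y hy => ?_⟩
  refine (norm_sub_le_of_mem_smallCube hx hy).trans_lt ?_
  rwa [mul_one_div, div_lt_comm₀ hk0 hδ]

theorem norm_le_of_mem_largeCube {x : EuclideanSpace ℝ (Fin d)} (hx : x ∈ largeCube d N) :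
    ‖x‖ ≤ d * N :=
  norm_le_of_forall_abs_le (Nat.cast_nonneg N) fun i => abs_le.2 ⟨(hx i).1.le, (hx i).2.le⟩

theorem le_norm_of_notMem_largeCube {x : EuclideanSpace ℝ (Fin d)} (hx : x ∉ largeCube d N) :
    (N : ℝ) ≤ ‖x‖ := by
  contrapose! hx
  exact fun i => abs_lt.1 ((PiLp.norm_apply_le x i).trans_lt hx)

theorem mul_le_norm_pt_of_notMem_latLargeCube {β : ℝ} {n : Zd d} (hn : n ∉ latLargeCube d N β) :
    β * N ≤ ‖pt n‖ := by
  contrapose! hn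
  refine mem_latBox.2 fun i => ?_
  rw [mul_neg]
  exact abs_lt.1 ((PiLp.norm_apply_le (pt n) i).trans_lt hn)

theorem inv_smul_pt_mem_smallCube {j : Fin d → ℤ} {β : ℝ} (hβ : 0 < β) {n : Zd d}
    (hn : n ∈ latSmallCube k j 0 β) : β⁻¹ • pt n ∈ smallCube k j := fun i => by
  have hni := mem_latBox.1 hn i
  rw [add_zero, sub_zero] at hni
  change _ < β⁻¹ * (n i : ℝ) ∧ β⁻¹ * (n i : ℝ) < _
  rwa [lt_inv_mul_iff₀ hβ, inv_mul_lt_iff₀ hβ]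

theorem exists_mesh (hΨ : ContinuousOn Ψ (Metric.sphere 0 1)) (N : ℕ) {η : ℝ} (hη : 0 < η) :
    ∃ k : ℕ, 0 < k ∧ ∀ j ∈ cubeIndex d N k, (∀ x ∈ smallCube k j, ‖x‖ < 2 * η) ∨
      ((∀ x ∈ smallCube k j, η ≤ ‖x‖) ∧
        ∀ x ∈ smallCube k j, ∀ y ∈ smallCube k j, |profile Ψ p x - profile Ψ p y| ≤ η / 4) := by
  obtain ⟨δ, hδ, hosc⟩ := exists_forall_abs_profile_sub_le (p := p) hΨ (d * N) hη
    (show 0 < η / 4 by positivity)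
  obtain ⟨k, hk, hdiam⟩ := exists_forall_norm_sub_lt_of_mem_smallCube d (lt_min hδ hη)
  refine ⟨k, hk, fun j hj => ?_⟩
  by_cases hnear : ∃ x ∈ smallCube k j, ‖x‖ < η
  · obtain ⟨x, hx, hxη⟩ := hnear
    refine Or.inl fun y hy => ?_
    linarith [norm_sub_norm_le y x, (hdiam j y hy x hx).trans_le (min_le_right _ _)]
  · push Not at hnear
    have hnorm (x : EuclideanSpace ℝ (Fin d)) (hx : x ∈ smallCube k j) : ‖x‖ ≤ d * N :=
      norm_le_of_mem_largeCube (smallCube_subset hk hj hx)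
    exact Or.inr ⟨hnear, fun x hx y hy => hosc x y (hnear x hx) (hnorm x hx) (hnear y hy)
      (hnorm y hy) ((hdiam j x hx y hy).trans_le (min_le_left _ _))⟩

end Mesh

section ShiftedDensity

variable {d : ℕ} {Ψ : EuclideanSpace ℝ (Fin d) → ℝ} {p : ℝ} {f : Zd d → ℝ} {ρ : ℝ → ℝ} {E c : ℝ}

open Classical in
/-- The density `ρ(E + Ψ(θ)|x|^{-p} + t)`, replaced by the constant `c` on the ball of radius `r`
about the singularity of the profile. For small `r` and `±t` these functions bound the eigenvalue
counts of finite sections from above (`c = 1`) and from below (`c = 0`). -/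
def shiftedDensity (ρ : ℝ → ℝ) (Ψ : EuclideanSpace ℝ (Fin d) → ℝ) (p E c r t : ℝ)
    (x : EuclideanSpace ℝ (Fin d)) : ℝ :=
  if ‖x‖ < r then c else ρ (E + profile Ψ p x + t)

theorem measurable_shiftedDensity (hΨ : ContinuousOn Ψ (Metric.sphere 0 1)) (hρ : Monotone ρ)
    (c r t : ℝ) : Measurable (shiftedDensity ρ Ψ p E c r t) :=
  Measurable.ite (measurableSet_lt measurable_norm measurable_const) measurable_const
    (hρ.measurable.comp ((measurable_const.add (measurable_profile hΨ)).add measurable_const))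

theorem norm_shiftedDensity_le (hρ : HasDensityOfStates f ρ) (hc0 : 0 ≤ c) (hc1 : c ≤ 1) (r t : ℝ)
    (x : EuclideanSpace ℝ (Fin d)) : ‖shiftedDensity ρ Ψ p E c r t x‖ ≤ 1 := by
  unfold shiftedDensity
  split_ifs
  · rwa [Real.norm_of_nonneg hc0]
  · rw [Real.norm_of_nonneg (hρ.nonneg _)]
    exact hρ.le_one _

theorem integrableOn_shiftedDensity (hΨ : ContinuousOn Ψ (Metric.sphere 0 1))
    (hρ : HasDensityOfStates f ρ) (hf : IsBoundedFun f) (N : ℕ) (hc0 : 0 ≤ c) (hc1 : c ≤ 1)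
    (r t : ℝ) : IntegrableOn (shiftedDensity ρ Ψ p E c r t) (largeCube d N) :=
  Measure.integrableOn_of_bounded (volume_largeCube_ne_top d N)
    (measurable_shiftedDensity hΨ (hρ.monotone hf) c r t).aestronglyMeasurable
    (Eventually.of_forall (norm_shiftedDensity_le hρ hc0 hc1 r t))

theorem tendsto_shiftedDensity {x : EuclideanSpace ℝ (Fin d)} (hx : x ≠ 0)
    (hρ : ContinuousAt ρ (E + profile Ψ p x)) {r t : ℕ → ℝ} (hr : Tendsto r atTop (𝓝 0))
    (ht : Tendsto t atTop (𝓝 0)) (c : ℝ) :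
    Tendsto (fun m => shiftedDensity ρ Ψ p E c (r m) (t m) x) atTop
      (𝓝 (ρ (E + profile Ψ p x))) := by
  have hshift : Tendsto (fun m => E + profile Ψ p x + t m) atTop (𝓝 (E + profile Ψ p x)) := by
    simpa only [add_zero] using ht.const_add (E + profile Ψ p x)
  refine (hρ.tendsto.comp hshift).congr' ?_
  filter_upwards [hr.eventually_lt_const (norm_pos_iff.2 hx)] with m hm
  rw [shiftedDensity, if_neg hm.le.not_gt, Function.comp_apply]

theorem tendsto_setIntegral_shiftedDensity (hd : 1 ≤ d)
    (hΨ : ContinuousOn Ψ (Metric.sphere 0 1)) (hp : 0 < p) (hρ : HasDensityOfStates f ρ)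
    (hf : IsBoundedFun f) (hE : ContinuousAt ρ E) (N : ℕ) (hc0 : 0 ≤ c) (hc1 : c ≤ 1)
    {r t : ℕ → ℝ} (hr : Tendsto r atTop (𝓝 0)) (ht : Tendsto t atTop (𝓝 0)) :
    Tendsto (fun m => ∫ x in largeCube d N, shiftedDensity ρ Ψ p E c (r m) (t m) x) atTop
      (𝓝 (∫ x in largeCube d N, ρ (E + profile Ψ p x))) := by
  have : Nonempty (Fin d) := ⟨⟨0, hd⟩⟩
  have : IsFiniteMeasure (volume.restrict (largeCube d N)) :=
    isFiniteMeasure_restrict.2 (volume_largeCube_ne_top d N)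
  refine tendsto_integral_of_dominated_convergence (fun _ => 1)
    (fun m => (measurable_shiftedDensity hΨ (hρ.monotone hf) c (r m) (t m)).aestronglyMeasurable)
    (integrable_const 1)
    (fun m => Eventually.of_forall (norm_shiftedDensity_le hρ hc0 hc1 (r m) (t m)))
    (ae_restrict_of_ae ?_)
  filter_upwards [ae_continuousAt_add_profile hΨ hp (hρ.monotone hf) hE,
    compl_mem_ae_iff.2 (measure_singleton 0)] with x hx hx0
  exact tendsto_shiftedDensity hx0 hx hr ht c

end ShiftedDensity

section FiniteSections

variable {d N : ℕ} {Ψ : EuclideanSpace ℝ (Fin d) → ℝ} {p : ℝ} {f V : Zd d → ℝ} {ρ : ℝ → ℝ} {E : ℝ}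

theorem IsBoundedFun.sub_mul (hf : IsBoundedFun f) (hV : IsBoundedFun V) (t : ℝ) :
    IsBoundedFun fun n => f n - t * V n := by
  obtain ⟨C, hC⟩ := hf
  obtain ⟨C', hC'⟩ := hV
  refine ⟨C + |t| * C', fun n => (abs_sub _ _).trans (add_le_add (hC n) ?_)⟩
  rw [abs_mul]
  exact mul_le_mul_of_nonneg_left (hC' n) (abs_nonneg t)

theorem HasDensityOfStates.tendsto_latSmallCube (hρ : HasDensityOfStates f ρ) {k : ℕ} (hk : 0 < k)
    (j : Fin d → ℤ) (E : ℝ) :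
    Tendsto (fun β : ℝ => (sectionCount f (latSmallCube k j 0 β) E : ℝ) / β ^ d) atTop
      (𝓝 ((1 / k : ℝ) ^ d * ρ E)) := by
  have hlim := hρ.tendsto_sectionCount (smallCube_lt hk j) E
  rw [prod_smallCube] at hlim
  simpa only [latSmallCube, add_zero, sub_zero] using hlim

theorem HasDecay.eventually_abs_sub_profile_le_of_smallCube (hV : HasDecay V Ψ p) (hp : 0 < p)
    {η : ℝ} (hη : 0 < η) {k : ℕ} {j : Fin d → ℤ} (hfar : ∀ x ∈ smallCube k j, η ≤ ‖x‖)
    (hosc : ∀ x ∈ smallCube k j, ∀ y ∈ smallCube k j, |profile Ψ p x - profile Ψ p y| ≤ η / 4)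
    {x₀ : EuclideanSpace ℝ (Fin d)} (hx₀ : x₀ ∈ smallCube k j) :
    ∀ᶠ β : ℝ in atTop, ∀ n ∈ latSmallCube k j 0 β, |β ^ p * V n - profile Ψ p x₀| ≤ η / 2 := by
  filter_upwards [hV.eventually_abs_sub_profile_le hp hη (show 0 < η / 4 by positivity),
    eventually_gt_atTop 0] with β hVβ hβ n hn
  have hx := inv_smul_pt_mem_smallCube hβ hn
  have hnorm := hfar _ hx
  rw [norm_smul, norm_inv, Real.norm_of_nonneg hβ.le, le_inv_mul_iff₀ hβ] at hnorm
  linarith [hVβ n hnorm, hosc _ hx _ hx₀,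
    abs_sub_le (β ^ p * V n) (profile Ψ p (β⁻¹ • pt n)) (profile Ψ p x₀)]

theorem eventually_sectionCount_le_integral (hf : IsBoundedFun f)
    (hΨ : ContinuousOn Ψ (Metric.sphere 0 1)) (hp : 0 < p) (hVb : IsBoundedFun V)
    (hV : HasDecay V Ψ p) (hρ : HasDensityOfStates f ρ) (hN : 0 < N) (E : ℝ) {η ε : ℝ}
    (hη : 0 < η) (hε : 0 < ε) :
    ∀ᶠ β : ℝ in atTop,
      (sectionCount (fun n => f n - β ^ p * V n) (latLargeCube d N β) E : ℝ) / β ^ d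
        ≤ (∫ x in largeCube d N, shiftedDensity ρ Ψ p E 1 (2 * η) η x) + ε := by
  obtain ⟨k, hk, hmesh⟩ := exists_mesh (p := p) hΨ N hη
  refine eventually_sectionCount_div_le hN hk (fun β => hf.sub_mul hVb (β ^ p))
    (integrableOn_shiftedDensity hΨ hρ hf N zero_le_one le_rfl _ _) (fun j hj => ?_) hε
  rcases hmesh j hj with hnear | ⟨hfar, hosc⟩
  · refine ⟨1, fun x hx => ?_, fun β => (latSmallCube k j 0 β).card, ?_,
      Eventually.of_forall fun β => Nat.cast_le.2 (sectionCount_le_card _ _ _)⟩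
    · rw [shiftedDensity, if_pos (hnear x hx)]
    · rw [mul_one]
      exact tendsto_card_latSmallCube hk j 0
  · obtain ⟨x₀, hx₀⟩ := nonempty_openBox (smallCube_lt hk j)
    refine ⟨ρ (E + profile Ψ p x₀ + η / 2), fun x hx => ?_, _,
      hρ.tendsto_latSmallCube hk j _, ?_⟩
    · unfold shiftedDensity
      split_ifs
      · exact hρ.le_one _
      · exact hρ.monotone hf (by linarith [(abs_le.1 (hosc _ hx₀ _ hx)).2])
    · filter_upwards [hV.eventually_abs_sub_profile_le_of_smallCube hp hη hfar hosc hx₀] with β hβ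
      exact_mod_cast sectionCount_mono hf (hf.sub_mul hVb (β ^ p)) fun n hn => by
        linarith [(abs_le.1 (hβ n hn)).2]

theorem eventually_integral_le_sectionCount (hf : IsBoundedFun f)
    (hΨ : ContinuousOn Ψ (Metric.sphere 0 1)) (hp : 0 < p) (hVb : IsBoundedFun V)
    (hV : HasDecay V Ψ p) (hρ : HasDensityOfStates f ρ) (hN : 0 < N) (E : ℝ) {η ε : ℝ}
    (hη : 0 < η) (hε : 0 < ε) :
    ∀ᶠ β : ℝ in atTop,
      (∫ x in largeCube d N, shiftedDensity ρ Ψ p E 0 (2 * η) (-η) x) - ε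
        ≤ (sectionCount (fun n => f n - β ^ p * V n) (latLargeCube d N β) E : ℝ) / β ^ d := by
  obtain ⟨k, hk, hmesh⟩ := exists_mesh (p := p) hΨ N hη
  refine eventually_le_sectionCount_div hN hk (fun β => hf.sub_mul hVb (β ^ p))
    (integrableOn_shiftedDensity hΨ hρ hf N le_rfl zero_le_one _ _) (fun j hj => ?_) hε
  rcases hmesh j hj with hnear | ⟨hfar, hosc⟩
  · refine ⟨0, fun x hx => ?_, fun _ => 0, ?_, Eventually.of_forall fun β => Nat.cast_nonneg _⟩
    · rw [shiftedDensity, if_pos (hnear x hx)]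
    · simp only [zero_div, mul_zero, tendsto_const_nhds]
  · obtain ⟨x₀, hx₀⟩ := nonempty_openBox (smallCube_lt hk j)
    refine ⟨ρ (E + profile Ψ p x₀ - η / 2), fun x hx => ?_, _,
      hρ.tendsto_latSmallCube hk j _, ?_⟩
    · unfold shiftedDensity
      split_ifs
      · exact hρ.nonneg _
      · exact hρ.monotone hf (by linarith [(abs_le.1 (hosc _ hx₀ _ hx)).1])
    · filter_upwards [hV.eventually_abs_sub_profile_le_of_smallCube hp hη hfar hosc hx₀] with β hβ
      exact_mod_cast sectionCount_mono (hf.sub_mul hVb (β ^ p)) hf fun n hn => by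
        linarith [(abs_le.1 (hβ n hn)).1]

theorem tendsto_sectionCount_sub_rpow_mul (hd : 1 ≤ d) (hf : IsBoundedFun f)
    (hΨ : ContinuousOn Ψ (Metric.sphere 0 1)) (hp : 0 < p) (hVb : IsBoundedFun V)
    (hV : HasDecay V Ψ p) (hρ : HasDensityOfStates f ρ) (hE : ContinuousAt ρ E) (hN : 0 < N) :
    Tendsto (fun β : ℝ =>
        (sectionCount (fun n => f n - β ^ p * V n) (latLargeCube d N β) E : ℝ) / β ^ d) atTop
      (𝓝 (∫ x in largeCube d N, ρ (E + profile Ψ p x))) := by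
  have hη : Tendsto (fun m : ℕ => 1 / ((m : ℝ) + 1)) atTop (𝓝 0) :=
    tendsto_one_div_add_atTop_nhds_zero_nat
  have hη2 : Tendsto (fun m : ℕ => 2 * (1 / ((m : ℝ) + 1))) atTop (𝓝 0) := by
    simpa only [mul_zero] using hη.const_mul 2
  have hηneg : Tendsto (fun m : ℕ => -(1 / ((m : ℝ) + 1))) atTop (𝓝 0) := by
    simpa only [neg_zero] using hη.neg
  have hup := tendsto_setIntegral_shiftedDensity hd hΨ hp hρ hf hE N zero_le_one le_rfl hη2 hη
  have hlow := tendsto_setIntegral_shiftedDensity hd hΨ hp hρ hf hE N le_rfl zero_le_one hη2 hηneg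
  refine tendsto_order.2 ⟨fun a ha => ?_, fun a ha => ?_⟩
  · obtain ⟨b, hab, hb⟩ := exists_between ha
    obtain ⟨m, hm⟩ := (hlow.eventually_const_lt hb).exists
    filter_upwards [eventually_integral_le_sectionCount hf hΨ hp hVb hV hρ hN E
      (Nat.one_div_pos_of_nat (n := m)) (sub_pos.2 hab)] with β hβ
    linarith
  · obtain ⟨b, hb, hba⟩ := exists_between ha
    obtain ⟨m, hm⟩ := (hup.eventually_lt_const hb).exists
    filter_upwards [eventually_sectionCount_le_integral hf hΨ hp hVb hV hρ hN E
      (Nat.one_div_pos_of_nat (n := m)) (sub_pos.2 hba)] with β hβ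
    linarith

end FiniteSections

section CrossingAsymptotics

variable {d : ℕ} {f V : Zd d → ℝ} {hf : IsBoundedFun f} {Ψ : EuclideanSpace ℝ (Fin d) → ℝ}
  {ρ : ℝ → ℝ} {p E : ℝ}

theorem crossingNumber_ne_top (hE : (E : ℂ) ∉ spectrum ℂ (schrodinger f hf)) (hV0 : ∀ n, 0 ≤ V n)
    (hVb : IsBoundedFun V) (hzero : Tendsto V cofinite (𝓝 0)) (α : ℝ) :
    crossingNumber (schrodinger f hf) (mulOp V hVb) E α ≠ ∞ := by
  rcases le_or_gt α 0 with hα | hα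
  · have : IsEmpty (Set.Ioo (0 : ℝ) α) := Set.isEmpty_coe_sort.2 (Set.Ioo_eq_empty hα.not_gt)
    rw [crossingNumber, tsum_empty]
    exact ENNReal.zero_ne_top
  · obtain ⟨B, hB⟩ := exists_equiv_eq_sub_smul hE
    obtain ⟨c, hc, hcB⟩ := exists_pos_mul_lt one_pos ‖(B.symm : L2 d →L[ℂ] L2 d)‖
    have hfin : {n | ¬ V n ≤ c / α}.Finite := hzero.eventually_le_const (div_pos hc hα)
    obtain ⟨M, hM, -⟩ := exists_crossingNumber_eq hB hV0 hVb hzero hα (hf.sub_mul hVb α)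
      (Finset.empty_subset hfin.toFinset) (by simp) hc.le ((mul_comm _ _).trans_le hcB.le)
      fun n hn => (le_div_iff₀' hα).1 (not_not.1 fun hlt => hn (hfin.mem_toFinset.2 hlt))
    rw [hM]
    exact ENNReal.natCast_ne_top M

theorem eventually_abs_crossingNumber_sub_le {B : L2 d ≃L[ℂ] L2 d}
    (hB : ∀ u, B u = schrodinger f hf u - (E : ℂ) • u) (hV0 : ∀ n, 0 ≤ V n)
    (hVb : IsBoundedFun V) (hzero : Tendsto V cofinite (𝓝 0)) (hV : HasDecay V Ψ p) (hp : 0 < p)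
    {c : ℝ} (hc : 0 < c) (hcB : c * ‖(B.symm : L2 d →L[ℂ] L2 d)‖ ≤ 1) {N : ℕ} (hN : 0 < N)
    (hfar : ∀ x : EuclideanSpace ℝ (Fin d), (N : ℝ) ≤ ‖x‖ → |profile Ψ p x| ≤ c / 2) :
    ∀ᶠ β : ℝ in atTop,
      |(crossingNumber (schrodinger f hf) (mulOp V hVb) E (β ^ p)).toReal
          - (sectionCount (fun n => f n - β ^ p * V n) (latLargeCube d N β) E
            - sectionCount f (latLargeCube d N β) E : ℝ)|
        ≤ (latLargeCube d N β).card
          - (latBox (fun _ : Fin d => β * -(N : ℝ) + 1) (fun _ => β * N - 1)).card := by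
  filter_upwards [eventually_gt_atTop 0, hV.eventually_abs_sub_profile_le hp
    (Nat.cast_pos.2 hN) (half_pos hc)] with β hβ hVβ
  have hsmall (n) (hn : n ∉ latLargeCube d N β) : β ^ p * V n ≤ c := by
    have hnorm := mul_le_norm_pt_of_notMem_latLargeCube hn
    have hprofile := hfar (β⁻¹ • pt n) (by
      rwa [norm_smul, norm_inv, Real.norm_of_nonneg hβ.le, le_inv_mul_iff₀ hβ])
    linarith [(abs_le.1 (hVβ n hnorm)).2, (abs_le.1 hprofile).2]
  obtain ⟨M, hM, hle, hge⟩ := exists_crossingNumber_eq hB hV0 hVb hzero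
    (Real.rpow_pos_of_pos hβ p) (hf.sub_mul hVb _)
    (latBox_mono (fun _ => by linarith) fun _ => by linarith)
    (fun n hn v hv => add_mem_latBox hn hv) hc.le hcB hsmall
  rw [hM, ENNReal.toReal_natCast, abs_le]
  rify at hle hge
  constructor <;> unfold latLargeCube at * <;> linarith

theorem tendsto_crossingNumber_rpow (hd : 1 ≤ d) {B : L2 d ≃L[ℂ] L2 d}
    (hB : ∀ u, B u = schrodinger f hf u - (E : ℂ) • u) (hV0 : ∀ n, 0 ≤ V n)
    (hVb : IsBoundedFun V) (hΨ : ContinuousOn Ψ (Metric.sphere 0 1)) (hV : HasDecay V Ψ p)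
    (hp : 0 < p) (hρ : HasDensityOfStates f ρ) (hE : ContinuousAt ρ E)
    {c : ℝ} (hc : 0 < c) (hcB : c * ‖(B.symm : L2 d →L[ℂ] L2 d)‖ ≤ 1) {N : ℕ} (hN : 0 < N)
    (hfar : ∀ x : EuclideanSpace ℝ (Fin d), (N : ℝ) ≤ ‖x‖ → |profile Ψ p x| ≤ c / 2) :
    Tendsto (fun β : ℝ =>
        (crossingNumber (schrodinger f hf) (mulOp V hVb) E (β ^ p)).toReal / β ^ d) atTop
      (𝓝 ((∫ x in largeCube d N, ρ (E + profile Ψ p x)) - (2 * N : ℝ) ^ d * ρ E)) := by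
  have hlt : ∀ _ : Fin d, -(N : ℝ) < N := fun _ => neg_lt_self (Nat.cast_pos.2 hN)
  have hsection := hρ.tendsto_sectionCount hlt E
  have hinner := tendsto_card_latBox_div hlt 1
  rw [prod_largeCube] at hsection hinner
  have hmain := (tendsto_sectionCount_sub_rpow_mul hd hf hΨ hp hVb hV hρ hE hN).sub hsection
  have hboundary := (tendsto_card_latLargeCube d hN).sub hinner
  rw [sub_self] at hboundary
  refine hmain.congr_dist (squeeze_zero' (Eventually.of_forall fun _ => dist_nonneg) ?_ hboundary)
  filter_upwards [eventually_gt_atTop 0, eventually_abs_crossingNumber_sub_le hB hV0 hVb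
    (hV.tendsto_zero hΨ hp) hV hp hc hcB hN hfar] with β hβ hle
  rw [dist_comm, Real.dist_eq, ← sub_div, ← sub_div, ← sub_div, abs_div,
    abs_of_pos (pow_pos hβ d)]
  exact div_le_div_of_nonneg_right hle (pow_pos hβ d).le

theorem dosIncrement_eq_zero_of_notMem_largeCube {κ : ℝ}
    (hρκ : ∀ E', |E' - E| ≤ κ → ρ E' = ρ E) {N : ℕ}
    (hfar : ∀ x : EuclideanSpace ℝ (Fin d), (N : ℝ) ≤ ‖x‖ → |profile Ψ p x| ≤ κ)
    {x : EuclideanSpace ℝ (Fin d)} (hx : x ∉ largeCube d N) : dosIncrement ρ Ψ p E x = 0 :=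
  sub_eq_zero.2 <| hρκ _ <| by
    rw [add_sub_cancel_left]
    exact hfar x (le_norm_of_notMem_largeCube hx)

theorem integrableOn_add_profile (hρ : HasDensityOfStates f ρ) (hf : IsBoundedFun f)
    (hΨ : ContinuousOn Ψ (Metric.sphere 0 1)) (E : ℝ) (N : ℕ) :
    IntegrableOn (fun x => ρ (E + profile Ψ p x)) (largeCube d N) := by
  refine Measure.integrableOn_of_bounded (M := 1) (volume_largeCube_ne_top d N)
    ((hρ.monotone hf).measurable.comp
      (measurable_const.add (measurable_profile hΨ))).aestronglyMeasurable
    (Eventually.of_forall fun x => ?_)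
  rw [Real.norm_of_nonneg (hρ.nonneg _)]
  exact hρ.le_one _

theorem integrable_dosIncrement (hρ : HasDensityOfStates f ρ) (hf : IsBoundedFun f)
    (hΨ : ContinuousOn Ψ (Metric.sphere 0 1)) {N : ℕ}
    (hzero : ∀ x, x ∉ largeCube d N → dosIncrement ρ Ψ p E x = 0) :
    Integrable (dosIncrement ρ Ψ p E) :=
  ((integrableOn_add_profile hρ hf hΨ E N).sub
    (integrableOn_const (volume_largeCube_ne_top d N))).integrable_of_forall_notMem_eq_zero hzero

theorem integral_dosIncrement (hρ : HasDensityOfStates f ρ) (hf : IsBoundedFun f)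
    (hΨ : ContinuousOn Ψ (Metric.sphere 0 1)) {N : ℕ}
    (hzero : ∀ x, x ∉ largeCube d N → dosIncrement ρ Ψ p E x = 0) :
    ∫ x, dosIncrement ρ Ψ p E x
      = (∫ x in largeCube d N, ρ (E + profile Ψ p x)) - (2 * N : ℝ) ^ d * ρ E := by
  rw [← setIntegral_eq_integral_of_forall_compl_eq_zero hzero]
  refine (integral_sub (integrableOn_add_profile hρ hf hΨ E N)
    (integrableOn_const (volume_largeCube_ne_top d N))).trans ?_
  rw [setIntegral_const, Measure.real, volume_largeCube, ENNReal.toReal_ofReal (by positivity),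
    smul_eq_mul]

theorem integrable_and_tendsto_crossingNumber_div_rpow (hd : 1 ≤ d)
    (hE : (E : ℂ) ∉ spectrum ℂ (schrodinger f hf)) (hp : 0 < p)
    (hΨ : ContinuousOn Ψ (Metric.sphere 0 1)) (hV0 : ∀ n, 0 ≤ V n) (hVb : IsBoundedFun V)
    (hV : HasDecay V Ψ p) (hρ : HasDensityOfStates f ρ) :
    Integrable (dosIncrement ρ Ψ p E) ∧
    Tendsto (fun α : ℝ => (crossingNumber (schrodinger f hf) (mulOp V hVb) E α).toReal
      / α ^ ((d : ℝ) / p)) atTop (𝓝 (∫ x, dosIncrement ρ Ψ p E x)) := by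
  obtain ⟨B, hB⟩ := exists_equiv_eq_sub_smul hE
  obtain ⟨c, hc, hcB⟩ := exists_pos_mul_lt one_pos ‖(B.symm : L2 d →L[ℂ] L2 d)‖
  obtain ⟨κ, hκ, hρκ⟩ := hρ.exists_pos_forall_eq hE
  obtain ⟨N, hN, hfar⟩ := exists_nat_forall_abs_profile_le hΨ hp (lt_min (half_pos hc) hκ)
  have hcont : ContinuousAt ρ E := by
    refine continuousAt_const.congr (f := fun _ => ρ E) ?_
    filter_upwards [Metric.closedBall_mem_nhds E hκ] with E' hE'
    exact (hρκ E' hE').symm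
  have hzero := fun x hx => dosIncrement_eq_zero_of_notMem_largeCube (x := x) hρκ
    (fun y hy => (hfar y hy).trans (min_le_right _ _)) hx
  have hlim := tendsto_crossingNumber_rpow hd hB hV0 hVb hΨ hV hp hρ hcont hc
    ((mul_comm _ _).trans_le hcB.le) hN fun x hx => (hfar x hx).trans (min_le_left _ _)
  rw [← integral_dosIncrement hρ hf hΨ hzero] at hlim
  refine ⟨integrable_dosIncrement hρ hf hΨ hzero,
    (hlim.comp (tendsto_rpow_atTop (inv_pos.2 hp))).congr' ?_⟩
  filter_upwards [eventually_gt_atTop 0] with α hα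
  rw [Function.comp_apply, Real.rpow_inv_rpow hα.le hp.ne', ← Real.rpow_natCast,
    ← Real.rpow_mul hα.le, inv_mul_eq_div]

end CrossingAsymptotics

theorem isEquivalent_mul_const_of_tendsto_div {ι 𝕜 : Type*} [NormedField 𝕜] {l : Filter ι}
    {u v : ι → 𝕜} {c : 𝕜} (h : Tendsto (fun i => u i / v i) l (𝓝 c)) (hc : c ≠ 0)
    (hv : ∀ᶠ i in l, v i ≠ 0) : Asymptotics.IsEquivalent l u fun i => v i * c := by
  refine (Asymptotics.isEquivalent_iff_tendsto_one (hv.mono fun i hi => mul_ne_zero hi hc)).2 ?_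
  rw [← div_self hc]
  exact (h.div_const c).congr fun i => div_div _ _ _

theorem theorem1p1_general {d : ℕ} (hd : 1 ≤ d) (f : Zd d → ℝ) (hf : IsBoundedFun f)
    (p : ℝ) (hp : 0 < p)
    (Ψ : EuclideanSpace ℝ (Fin d) → ℝ) (hΨ : ContinuousOn Ψ (Metric.sphere 0 1))
    (V : Zd d → ℝ) (hV0 : ∀ n, 0 ≤ V n) (hV : HasDecay V Ψ p)
    (ρ : ℝ → ℝ) (hρ : HasDensityOfStates f ρ)
    (E : ℝ) (hE : (E : ℂ) ∉ spectrum ℂ (schrodinger f hf)) :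
    (∀ α : ℝ, crossingNumber (schrodinger f hf) (mulOp V (hV.isBoundedFun hp hΨ)) E α ≠ ∞) ∧
    Integrable (dosIncrement ρ Ψ p E) ∧
    Tendsto (fun α : ℝ =>
        (crossingNumber (schrodinger f hf) (mulOp V (hV.isBoundedFun hp hΨ)) E α).toReal
          / α ^ ((d : ℝ) / p))
      atTop (𝓝 (∫ x, dosIncrement ρ Ψ p E x)) ∧
    ((∫ x, dosIncrement ρ Ψ p E x) ≠ 0 →
      Asymptotics.IsEquivalent atTop
        (fun α : ℝ =>
          (crossingNumber (schrodinger f hf) (mulOp V (hV.isBoundedFun hp hΨ)) E α).toReal)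
        (fun α : ℝ => α ^ ((d : ℝ) / p) * ∫ x, dosIncrement ρ Ψ p E x)) := by
  have hVb := hV.isBoundedFun hp hΨ
  obtain ⟨hint, hlim⟩ := integrable_and_tendsto_crossingNumber_div_rpow hd hE hp hΨ hV0 hVb hV hρ
  have hpow : ∀ᶠ α : ℝ in atTop, α ^ ((d : ℝ) / p) ≠ 0 :=
    (eventually_gt_atTop 0).mono fun α hα => (Real.rpow_pos_of_pos hα _).ne'
  exact ⟨crossingNumber_ne_top hE hV0 hVb (hV.tendsto_zero hΨ hp), hint, hlim,
    fun hne => isEquivalent_mul_const_of_tendsto_div hlim hne hpow⟩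

end

theorem theorem1p1 {d : ℕ} (hd : 1 ≤ d)
    (f : Zd d → ℝ) (hf : IsBoundedFun f)
    (a b : ℝ) (hgap : IsSpectralGap (schrodinger f hf) a b)
    (p : ℝ) (hp : 0 < p)
    (Ψ : EuclideanSpace ℝ (Fin d) → ℝ) (hΨ : ContinuousOn Ψ (Metric.sphere 0 1))
    (V : Zd d → ℝ) (hV0 : ∀ n, 0 ≤ V n) (hV : HasDecay V Ψ p)
    (ρ : ℝ → ℝ) (hρ : HasDensityOfStates f ρ)
    (E : ℝ) (hE : E ∈ Set.Ioo a b) :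
    (∀ α : ℝ, crossingNumber (schrodinger f hf) (mulOp V (hV.isBoundedFun hp hΨ)) E α ≠ ∞) ∧
    Integrable (dosIncrement ρ Ψ p E) ∧
    Tendsto (fun α : ℝ =>
        (crossingNumber (schrodinger f hf) (mulOp V (hV.isBoundedFun hp hΨ)) E α).toReal
          / α ^ ((d : ℝ) / p))
      atTop (𝓝 (∫ x, dosIncrement ρ Ψ p E x)) ∧
    ((∫ x, dosIncrement ρ Ψ p E x) ≠ 0 →
      Asymptotics.IsEquivalent atTop
        (fun α : ℝ =>
          (crossingNumber (schrodinger f hf) (mulOp V (hV.isBoundedFun hp hΨ)) E α).toReal)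
        (fun α : ℝ => α ^ ((d : ℝ) / p) * ∫ x, dosIncrement ρ Ψ p E x)) :=
  theorem1p1_general hd f hf p hp Ψ hΨ V hV0 hV ρ hρ E (hgap.disjoint E hE.1 hE.2)
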